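/- **Conventions.** All logarithms are to base $2$. $\mathcal X,\mathcal Y$ are sets and $\mu$ is a discrete probability distribution on $\mathcal X\times\mathcal Y$. A (two-party) protocol $\pi$ first draws public randomness $R$ from a probability space, independently of the inputs, and then, given $R=r$, runs a finite binary protocol tree: each internal node is owned by Alice or by Bob, and the owner sends one bit, sampled with fresh private coins from a distribution that depends only on $r$, on the node and on the owner's input (Alice's input is $x\in\mathcal X$, Bob's is $y\in\mathcal Y$); the tree and its transition probabilities depend measurably on $r$. Let $M$ be the sequence of bits sent and let the transcript be $\Pi=\Pi(x,y)=(R,M)$. The communication $\|\pi\|$ is the largest number of bits that are ever sent, i.e. the supremum over $r$ of the depth of the tree. For $(X,Y)\sim\mu$ the internal information cost of $\pi$ is $$\mathsf{IC}_\mu(\pi)=I(M;X\mid YR)+I(M;Y\mid XR)=I(\Pi;X\mid Y)+I(\Pi;Y\mid X).$$ A protocol $\tau$ with transcript $\mathrm T$ (which includes the public randomness of $\tau$) *$\varepsilon$-simulates* $\pi$ if there are measurable functions $g_A(x,\cdot)$, $g_B(y,\cdot)$ from transcripts of $\tau$ to transcripts of $\pi$ such that, for $(X,Y)\sim\mu$,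 the joint law of $\bigl(X,Y,g_A(X,\mathrm T(X,Y)),g_B(Y,\mathrm T(X,Y))\bigr)$ is within total variation distance $\varepsilon$ of that of $\bigl(X,Y,\Pi(X,Y),\Pi(X,Y)\bigr)$. Write $\log^+ t=\max(0,\log t)$ for $t>0$ and $\log^+0=0$. **Theorem (Barak–Braverman–Chen–Rao compression).** There is a universal constant $K>0$ such that the following holds. Let $\pi$ be a protocol over inputs $(x,y)\sim\mu$ with $\mathsf{IC}_\mu(\pi)=I$ and $\|\pi\|=C<\infty$. Then for every $\varepsilon>0$ there is a protocol $\tau$ that $\varepsilon$-simulates $\pi$ and has $$\|\tau\|\;\le\;K\cdot\sqrt{C\cdot I}\cdot\frac{\log^+(C/\varepsilon)}{\varepsilon}.$$ -/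

import Mathlib

open MeasureTheory

universe u v w

noncomputable section

namespace CommCompression

/-! ### Entropy and mutual information (discrete random variables, logarithms to base 2) -/

/-- Shannon entropy, in bits, of the distribution with point masses `q a`. -/
def entropy {α : Type*} (q : α → ℝ) : ℝ :=
  ∑' a, q a * Real.logb 2 (1 / q a)

/-- `H(A | B) = E_b [H(A | B = b)]`, where `p` is the joint law of `(A, B)`. -/
def condEntropy {α β : Type*} (p : PMF (α × β)) : ℝ :=
  ∑' b, ((p.map Prod.snd) b).toReal *
    entropy (fun a => (p (a, b)).toReal / ((p.map Prod.snd) b).toReal)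

/-- `I(A; B | C) = H(A | C) - H(A | B C)`, where `p` is the joint law of `(A, B, C)`. -/
def condMutualInfo {α β γ : Type*} (p : PMF (α × β × γ)) : ℝ :=
  condEntropy (p.map fun t => (t.1, t.2.2)) - condEntropy p

/-! ### Two-party communication protocols -/

/-- The two players. -/
inductive Player
  | alice
  | bob

/-- A two-party protocol tree with private coins. Each internal node is owned by one player, who
sends one bit; the bit is `1` (`true`) with a probability that depends on the node and on the
owner's input only. `t₀` and `t₁` are the subtrees in which the protocol continues after the bit
`0`, respectively `1`. -/
inductive Tree (X : Type u) (Y : Type v) : Type (max u v)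
  | leaf : Tree X Y
  | alice (p : X → unitInterval) (t₀ t₁ : Tree X Y) : Tree X Y
  | bob (p : Y → unitInterval) (t₀ t₁ : Tree X Y) : Tree X Y

namespace Tree

variable {X : Type u} {Y : Type v}

/-- The largest number of bits sent along a path from the root to a leaf. -/
def depth : Tree X Y → ℕ
  | leaf => 0
  | alice _ t₀ t₁ => max t₀.depth t₁.depth + 1
  | bob _ t₀ t₁ => max t₀.depth t₁.depth + 1

/-- The law of one bit that is `true` with probability `p`. -/
def bitLaw (p : unitInterval) : PMF Bool :=
  PMF.ofFintype (fun b => ENNReal.ofReal (if b then (p : ℝ) else 1 - p)) (by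
    rw [Fintype.sum_bool, ← ENNReal.ofReal_add (by simpa using p.2.1) (by simpa using p.2.2)]
    simp)

/-- The law of the sequence of bits sent on the inputs `x`, `y`, over the private coins. -/
def law : Tree X Y → X → Y → PMF (List Bool)
  | leaf, _, _ => PMF.pure []
  | alice p t₀ t₁, x, y => (bitLaw (p x)).bind fun b =>
      (if b then t₁.law x y else t₀.law x y).map (List.cons b)
  | bob p t₀ t₁, x, y => (bitLaw (p y)).bind fun b =>
      (if b then t₁.law x y else t₀.law x y).map (List.cons b)

/-- The subtree reached from the root after the bits `h` (a leaf if `h` runs past a leaf). -/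
def nodeAt : Tree X Y → List Bool → Tree X Y
  | t, [] => t
  | leaf, _ :: _ => leaf
  | alice _ t₀ t₁, b :: h => if b then t₁.nodeAt h else t₀.nodeAt h
  | bob _ t₀ t₁, b :: h => if b then t₁.nodeAt h else t₀.nodeAt h

/-- The player who speaks at the root; nobody does at a leaf. -/
def owner : Tree X Y → Option Player
  | leaf => none
  | alice _ _ _ => some Player.alice
  | bob _ _ _ => some Player.bob

/-- The probability that the bit sent at the root is `1`, on the inputs `x`, `y`
(`0` at a leaf, where no bit is sent). -/
def bias : Tree X Y → X → Y → ℝ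
  | leaf, _, _ => 0
  | alice p _ _, x, _ => (p x : ℝ)
  | bob p _ _, _, y => (p y : ℝ)

end Tree

/-- A two-party protocol with public and private coins: a public random element `r` of a
probability space is drawn, independently of the inputs, and the private-coin protocol tree
`tree r` is run. Owners and transition probabilities of all nodes are measurable in `r`. -/
structure Protocol (X : Type u) (Y : Type v) where
  Pub : Type w
  [mPub : MeasurableSpace Pub]
  coin : Measure Pub
  [probCoin : IsProbabilityMeasure coin]
  tree : Pub → Tree X Y
  measurable_owner : ∀ (h : List Bool) (o : Option Player),
    MeasurableSet {r | ((tree r).nodeAt h).owner = o}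
  measurable_bias : ∀ (h : List Bool) (x : X) (y : Y),
    Measurable fun r => ((tree r).nodeAt h).bias x y

attribute [instance] Protocol.mPub Protocol.probCoin

/-- All sets of bit strings are measurable. -/
instance : MeasurableSpace (List Bool) := ⊤

/-- Total variation distance `sup_S |P(S) - Q(S)|` of two probability measures. -/
def tvDist {Ω : Type*} [MeasurableSpace Ω] (P Q : Measure Ω) : ℝ :=
  ⨆ S : {S : Set Ω // MeasurableSet S}, |P.real S.1 - Q.real S.1|

namespace Protocol

variable {X : Type u} {Y : Type v}

/-- A full transcript: the public randomness together with all bits sent. -/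
abbrev Transcript (π : Protocol.{u, v, w} X Y) : Type w := π.Pub × List Bool

/-- The communication cost `‖π‖`: the largest number of bits that are ever sent. -/
def comm (π : Protocol.{u, v, w} X Y) : ℕ∞ :=
  ⨆ r, ((π.tree r).depth : ℕ∞)

/-- The law of the transcript (public randomness and bits sent) on the inputs `x`, `y`. -/
def transcriptLaw (π : Protocol.{u, v, w} X Y) (x : X) (y : Y) : Measure π.Transcript :=
  π.coin.bind fun r => (((π.tree r).law x y).map (Prod.mk r)).toMeasure

/-- The joint law of `(M, X, Y)` given that the public randomness is `r`, where `(X, Y) ∼ μ` and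
`M` is the sequence of bits sent. -/
def lawMXY (π : Protocol.{u, v, w} X Y) (μ : PMF (X × Y)) (r : π.Pub) :
    PMF (List Bool × X × Y) :=
  μ.bind fun z => ((π.tree r).law z.1 z.2).map fun m => (m, z.1, z.2)

/-- The internal information cost `I(Π; X | Y R) + I(Π; Y | X R)`. The public randomness `R` is
independent of the inputs, so that conditioning on it is averaging over its values. -/
def infoCost (π : Protocol.{u, v, w} X Y) (μ : PMF (X × Y)) : ℝ :=
  (∫ r, condMutualInfo (π.lawMXY μ r) ∂π.coin) +
    ∫ r, condMutualInfo ((π.lawMXY μ r).map fun t => (t.1, t.2.2, t.2.1)) ∂π.coin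

/-- `τ` `ε`-simulates `π` on inputs `(x, y) ∼ μ`: from her own input and the transcript of `τ`
(which includes the public randomness of `τ`) Alice computes a transcript of `π`, from his own
input and the transcript of `τ` Bob computes one, and the joint law of the inputs and the two
computed transcripts is within total variation distance `ε` of the law of
`(X, Y, Π(X, Y), Π(X, Y))`. The two joint laws have the same marginal `μ` on the inputs, so that
their distance is the `μ`-average of the distances given the inputs. -/
def Simulates (τ π : Protocol.{u, v, w} X Y) (μ : PMF (X × Y)) (ε : ℝ) : Prop :=
  ∃ (gA : X → τ.Transcript → π.Transcript) (gB : Y → τ.Transcript → π.Transcript),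
    (∀ x, Measurable (gA x)) ∧ (∀ y, Measurable (gB y)) ∧
    ∑' z : X × Y, (μ z).toReal *
      tvDist ((τ.transcriptLaw z.1 z.2).map fun t => (gA z.1 t, gB z.2 t))
        ((π.transcriptLaw z.1 z.2).map fun t => (t, t)) ≤ ε

end Protocol

end CommCompression

end

noncomputable section

namespace CommCompression

/-! ### Averages over lists of coins -/

-- Add to the public randomness of `π` one uniform threshold per level of the tree. Sending a one
-- exactly when the threshold of the level lies below the probability at the node reproduces the law
-- of `π` (`lintegral_leafPath`). With common thresholds each player can run the tree alone: at own
-- nodes with the true probability `p`, at the other's nodes with a belief `q`, the conditional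
-- probability of a one given the own input and the bits so far. Following the owner's bit at every
-- node gives the joint path, which is the transcript to be output. The players disagree at a node
-- of this path with probability at most |p - q|, so the expected number of mistakes is at most the
-- expected sum of |p - q| along the path (`lintegral_numMistakes_le`).
--
-- Information pays for this sum. Averaged over the sender's input, the divergence of `p` from `q`
-- is the information in the bit. Pinsker's inequality and |d| ≤ λ + d²/λ bound the average of |p -
-- q| linearly in that information, and the chain rule adds up the levels (`Tree.tsum_aliceGap_le`).
-- Linear bounds survive averaging over inputs and public randomness; only then is λ = √(I/C)
-- chosen, which gives at most 4√(CI) expected mistakes (`expected_numMistakes_le_sqrt`).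
--
-- Mistakes are repaired one at a time. A player flips the guessed bits at the positions found so
-- far, and the two corrected sequences first differ at the next mistake
-- (`isFirstDiff_correctedBits`). That position is located by binary search over prefix lengths,
-- comparing prefixes through one hash bit per player: equal prefixes always match, different ones
-- match with probability 1/2. Since a match may be false, the search keeps a stack of accepted
-- prefixes and rechecks the top. A potential that charges each false entry a factor 5/4 shrinks on
-- average by 39/40 per round (`avg_potential_le`), so O(log(C/ε)) rounds per mistake suffice.
--
-- With T = ⌊8√(CI)/ε⌋ phases, Markov's inequality leaves probability ε/2 for more than T mistakes,
-- and the searches fail with total probability at most ε/2. An average over the hash coins fixes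
-- one good list of them (`exists_simulation`). If T ≥ C, then `π` itself is short enough; the cases
-- with small C/ε need no communication.

/-- The average of `f` over all lists of length `k`. -/
def listAvg {Z : Type*} [Fintype Z] : ℕ → (List Z → ℝ) → ℝ
  | 0, f => f []
  | k + 1, f => (∑ z, listAvg k fun l => f (z :: l)) / Fintype.card Z

theorem listAvg_mono {Z : Type*} [Fintype Z] {k : ℕ} {f g : List Z → ℝ}
    (h : ∀ l, l.length = k → f l ≤ g l) : listAvg k f ≤ listAvg k g := by
  induction k generalizing f g with
  | zero => exact h _ rfl
  | succ k ih =>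
    simp only [listAvg]
    gcongr with z
    exact ih fun l hl => h _ (by simp [hl])

theorem listAvg_const {Z : Type*} [Fintype Z] [Nonempty Z] (k : ℕ) (c : ℝ) :
    listAvg k (fun _ : List Z => c) = c := by
  induction k with
  | zero => rfl
  | succ k ih => simp [listAvg, ih]

theorem listAvg_add {Z : Type*} [Fintype Z] (k : ℕ) (f g : List Z → ℝ) :
    listAvg k (fun l => f l + g l) = listAvg k f + listAvg k g := by
  induction k generalizing f g with
  | zero => rfl
  | succ k ih => simp [listAvg, ih, Finset.sum_add_distrib, add_div]

/-! ### Locating the first difference of two bit sequences by noisy binary search -/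

/-- The first `m` bits of a sequence, padded with zeros. -/
def mask (n : ℕ) (P : ℕ → Bool) (m : ℕ) : Fin n → Bool := fun i => decide (i.1 < m) && P i

/-- `d` is the first index below `n` at which `P` and `Q` differ, and `n` if there is none. -/
structure IsFirstDiff (n : ℕ) (P Q : ℕ → Bool) (d : ℕ) : Prop where
  le : d ≤ n
  agree : ∀ i < d, P i = Q i
  differ : d < n → P d ≠ Q d

/-- Comparisons err on one side only: up to the first difference the two keys are the same, so no
hash function separates them. -/
theorem IsFirstDiff.mask_eq {n d m : ℕ} {P Q : ℕ → Bool} (h : IsFirstDiff n P Q d) (hm : m ≤ d) :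
    mask n P m = mask n Q m := by
  funext i
  by_cases hi : i.1 < m
  · simp [mask, h.agree i (by omega)]
  · simp [mask, hi]

theorem IsFirstDiff.mask_ne {n d m : ℕ} {P Q : ℕ → Bool} (h : IsFirstDiff n P Q d) (hm : d < m)
    (hmn : m ≤ n) : mask n P m ≠ mask n Q m := by
  intro he
  have := congrFun he ⟨d, by omega⟩
  simp only [mask, hm, decide_true, Bool.true_and] at this
  exact h.differ (by omega) this

/-- The public coins of one round: a selector of the query and a hash function. -/
abbrev Coin (n : ℕ) : Type := Fin 3 × ((Fin n → Bool) → Bool)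

/-- The prefix length that is compared in the next round, when the first difference is known to be
below `hi` and the stack `st` holds increasingly long prefixes that seem to agree. -/
def query (sel : Fin 3) (s : ℕ × List ℕ) : ℕ :=
  if sel = 0 ∧ s.2.headD 0 + 1 < s.1 then (s.2.headD 0 + s.1) / 2 else s.2.headD 0

/-- The search state after the prefixes of length `m` were (or were not) found equal. -/
def searchUpdate (m : ℕ) (same : Bool) (s : ℕ × List ℕ) : ℕ × List ℕ :=
  if m = s.2.headD 0 then (if same then s else (m, s.2.tail))
  else (if same then (s.1, m :: s.2) else (m, s.2))

/-- The hash bit of the sequence `P` that is sent in a round with coins `z`. -/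
def hashBit {n : ℕ} (P : ℕ → Bool) (z : Coin n) (s : ℕ × List ℕ) : Bool :=
  z.2 (mask n P (query z.1 s))

/-- One round of the search. -/
def searchStep {n : ℕ} (P Q : ℕ → Bool) (s : ℕ × List ℕ) (z : Coin n) : ℕ × List ℕ :=
  searchUpdate (query z.1 s) (hashBit P z s == hashBit Q z s) s

/-- The potential of a search state, when the first difference is at `d`. -/
def potential (d : ℕ) : ℕ × List ℕ → ℝ
  | (hi, []) => (hi : ℝ) - 1
  | (hi, m :: st) => if d < m then 5 / 4 * potential d (hi, st) else (hi : ℝ) - m - 1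

/-- The search states that can occur, when the first difference is at `d ≤ n`. -/
structure SearchInv (n d : ℕ) (s : ℕ × List ℕ) : Prop where
  lt : d < s.1
  le : s.1 ≤ n + 1
  sorted : (s.1 :: s.2).Pairwise (· > ·)

/-- Lowering `hi` is the only effect of an exposed difference on the interval, and it never hurts:
`hi` enters the base value positively and the false entries on top of it only multiply. -/
theorem potential_mono {d hi hi' : ℕ} (h : hi ≤ hi') (st : List ℕ) :
    potential d (hi, st) ≤ potential d (hi', st) := by
  have h' : (hi : ℝ) ≤ hi' := by exact_mod_cast h
  induction st with
  | nil => simp only [potential]; linarith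
  | cons m st ih => simp only [potential]; split_ifs <;> linarith

theorem potential_nonneg {d hi : ℕ} (h : d < hi) (st : List ℕ) : 0 ≤ potential d (hi, st) := by
  have h' : (d : ℝ) + 1 ≤ hi := by exact_mod_cast h
  have h0 : (0 : ℝ) ≤ d := by positivity
  induction st with
  | nil => simp only [potential]; linarith
  | cons m st ih =>
    simp only [potential]
    split_ifs with hm
    · linarith
    · have : (m : ℝ) ≤ d := by exact_mod_cast not_lt.1 hm
      linarith

theorem one_le_potential {d hi : ℕ} (hd : d + 1 < hi) (st : List ℕ)
    (h : ∀ m ∈ st, d < m ∨ m + 1 < hi) : 1 ≤ potential d (hi, st) := by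
  have h' : (d : ℝ) + 2 ≤ hi := by exact_mod_cast hd
  have h0 : (0 : ℝ) ≤ d := by positivity
  induction st with
  | nil => simp only [potential]; linarith
  | cons m st ih =>
    simp only [potential]
    split_ifs with hm
    · linarith [ih fun k hk => h k (List.mem_cons_of_mem _ hk)]
    · have : (m : ℝ) ≤ d := by exact_mod_cast not_lt.1 hm
      linarith

/-- Potential below one forces the top of the stack to be `d`, so the expected potential bounds the
probability of failure. If the top is false, then `hi` exceeds `d + 1`, and this room remains below
all false entries. -/
theorem SearchInv.one_le_potential {n d : ℕ} {s : ℕ × List ℕ} (hs : SearchInv n d s)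
    (h : s.2.headD 0 ≠ d) : 1 ≤ potential d s := by
  obtain ⟨hi, st⟩ := s
  have h1 := hs.lt
  have h3 := hs.sorted
  cases st with
  | nil =>
    simp only [List.headD_nil, potential] at h h1 ⊢
    have : (2 : ℝ) ≤ hi := by exact_mod_cast (by omega : 2 ≤ hi)
    linarith
  | cons m st =>
    simp only [List.headD_cons, List.pairwise_cons, List.mem_cons, forall_eq_or_imp] at h h1 h3
    by_cases hm : d < m
    · simp only [potential, if_pos hm]
      have := CommCompression.one_le_potential (d := d) (hi := hi) (by omega) st
        (fun k hk => Or.inr (by have := h3.2.1 k hk; omega))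
      linarith
    · simp only [potential, if_neg hm]
      have : (m : ℝ) + 2 ≤ hi := by exact_mod_cast (by omega : m + 2 ≤ hi)
      linarith

theorem query_lt {sel : Fin 3} {s : ℕ × List ℕ} (hs : (s.1 :: s.2).Pairwise (· > ·))
    (h0 : 0 < s.1) : query sel s < s.1 := by
  obtain ⟨hi, st⟩ := s
  have : st.headD 0 < hi := by
    cases st with
    | nil => simpa using h0
    | cons m st => simp only [List.pairwise_cons, List.mem_cons] at hs; simpa using hs.1 m (Or.inl rfl)
  simp only [query]
  split_ifs with h <;> dsimp only at * <;> omega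

theorem SearchInv.step {n d : ℕ} {P Q : ℕ → Bool} (h : IsFirstDiff n P Q d) {s : ℕ × List ℕ}
    (hs : SearchInv n d s) (z : Coin n) : SearchInv n d (searchStep P Q s z) := by
  have hq := query_lt (sel := z.1) hs.sorted (Nat.zero_lt_of_lt hs.lt)
  -- Different hash bits prove different prefixes, so whenever `hi` drops to the queried length, `d`
  -- stays below it.
  have hd : (hashBit P z s == hashBit Q z s) = false → d < query z.1 s := by
    intro hb
    by_contra hcon
    simp [hashBit, h.mask_eq (not_lt.1 hcon)] at hb
  unfold searchStep
  generalize (hashBit P z s == hashBit Q z s) = b at hd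
  obtain ⟨hi, st⟩ := s
  have h2 := hs.le
  have h1 := hs.lt
  have h3 := hs.sorted
  dsimp only at h1 h2 h3 hq
  have hge : st.headD 0 ≤ query z.1 (hi, st) := by
    simp only [query]; split_ifs with hc <;> omega
  generalize query z.1 (hi, st) = m at *
  simp only [searchUpdate]
  cases b
  · have hd := hd rfl
    simp only [Bool.false_eq_true, if_false]
    split_ifs with hm
    · refine ⟨hd, by simp; omega, ?_⟩
      cases st with
      | nil => simp
      | cons k st =>
        simp only [List.headD_cons] at hm
        subst hm
        exact h3.of_cons
    · refine ⟨hd, by simp; omega, ?_⟩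
      cases st with
      | nil => simp
      | cons k st =>
        simp only [List.headD_cons, List.pairwise_cons, List.mem_cons, forall_eq_or_imp] at *
        refine ⟨⟨by omega, fun a ha => ?_⟩, h3.2⟩
        have := h3.2.1 a ha
        omega
  · simp only [if_true]
    split_ifs with hm
    · exact hs
    · refine ⟨h1, h2, ?_⟩
      cases st with
      | nil => simp at *; omega
      | cons k st =>
        simp only [List.headD_cons, List.pairwise_cons, List.mem_cons, forall_eq_or_imp] at *
        refine ⟨⟨hq, h3.1⟩, ⟨by omega, fun a ha => ?_⟩, h3.2⟩
        have := h3.2.1 a ha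
        omega

/-- A uniformly random hash function separates two different keys with probability `1/2`. -/
theorem sum_hash_eq {K : Type*} [Fintype K] [DecidableEq K] {k₁ k₂ : K} (hk : k₁ ≠ k₂)
    (φ : Bool → ℝ) :
    ∑ z : K → Bool, φ (z k₁ == z k₂) = Fintype.card (K → Bool) * ((φ true + φ false) / 2) := by
  -- Flipping the value at `k₁` permutes the hash functions and toggles their agreement on the two
  -- keys.
  have hinv : Function.Involutive fun z : K → Bool => Function.update z k₁ (!z k₁) := by
    intro z; simp
  have h1 : ∑ z : K → Bool, φ (z k₁ == z k₂) = ∑ z : K → Bool, φ (!(z k₁ == z k₂)) := by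
    rw [← Equiv.sum_comp (Function.Involutive.toPerm _ hinv)]
    refine Finset.sum_congr rfl fun z _ => ?_
    congr 1
    simp only [Function.Involutive.coe_toPerm, Function.update_self,
      Function.update_of_ne hk.symm]
    cases z k₁ <;> cases z k₂ <;> rfl
  have h2 : ∑ z : K → Bool, (φ (z k₁ == z k₂) + φ (!(z k₁ == z k₂))) =
      ∑ _z : K → Bool, (φ true + φ false) := by
    refine Finset.sum_congr rfl fun z _ => ?_
    cases (z k₁ == z k₂) <;> simp [add_comm]
  rw [Finset.sum_add_distrib, ← h1] at h2
  simp only [Finset.sum_const, Finset.card_univ, nsmul_eq_mul] at h2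
  linarith

/-- The expected value of `f` over the two possible outcomes of a comparison at `m`. -/
theorem sum_hash_mask {n d : ℕ} {P Q : ℕ → Bool} (h : IsFirstDiff n P Q d) {m : ℕ} (hm : m ≤ n)
    (φ : Bool → ℝ) :
    ∑ z : (Fin n → Bool) → Bool, φ (z (mask n P m) == z (mask n Q m)) =
      Fintype.card ((Fin n → Bool) → Bool) *
        (if m ≤ d then φ true else (φ true + φ false) / 2) := by
  split_ifs with hmd
  · simp [h.mask_eq hmd]
  · exact sum_hash_eq (h.mask_ne (not_le.1 hmd) hm) φ

theorem searchUpdate_head_true (s : ℕ × List ℕ) : searchUpdate (s.2.headD 0) true s = s := by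
  simp [searchUpdate]

/-- Removing a false top takes away its factor 5/4, and `hi` moves down to it. -/
theorem potential_pop {d : ℕ} {s : ℕ × List ℕ} (h : d < s.2.headD 0) (hlt : s.2.headD 0 ≤ s.1) :
    potential d (searchUpdate (s.2.headD 0) false s) ≤ 4 / 5 * potential d s := by
  obtain ⟨hi, st⟩ := s
  cases st with
  | nil => simp at h
  | cons m st =>
    simp only [List.headD_cons] at h hlt
    have h1 : potential d (hi, m :: st) = 5 / 4 * potential d (hi, st) := by
      simp only [potential, if_pos h]
    have h2 : searchUpdate m false (hi, m :: st) = (m, st) := by simp [searchUpdate]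
    simp only [List.headD_cons]
    rw [h1, h2]
    linarith [potential_mono (d := d) hlt st]

theorem potential_push_wrong {d m : ℕ} {s : ℕ × List ℕ} (h : d < m) (hm : s.2.headD 0 < m) :
    potential d (searchUpdate m true s) = 5 / 4 * potential d s := by
  simp only [searchUpdate, if_neg hm.ne', if_true, potential, if_pos h]

theorem potential_lower {d m : ℕ} {s : ℕ × List ℕ} (hm : s.2.headD 0 < m) (hms : m ≤ s.1) :
    potential d (searchUpdate m false s) ≤ potential d s := by
  simp only [searchUpdate, if_neg hm.ne', Bool.false_eq_true, if_false]
  exact potential_mono hms s.2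

/-- An empty stack acts as the top `0`, which is never false; both base cases of the potential are
then the same formula. -/
theorem potential_head_le {d : ℕ} {s : ℕ × List ℕ} (h : s.2.headD 0 ≤ d) :
    potential d s = (s.1 : ℝ) - (s.2.headD 0 : ℕ) - 1 := by
  obtain ⟨hi, st⟩ := s
  cases st with
  | nil => simp [potential]
  | cons m st =>
    simp only [List.headD_cons] at h
    simp only [potential, if_neg (not_lt.2 h), List.headD_cons]

/-- The expected potential after a comparison at `m`. -/
def nextPotential (d m : ℕ) (s : ℕ × List ℕ) : ℝ :=
  if m ≤ d then potential d (searchUpdate m true s)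
  else (potential d (searchUpdate m true s) + potential d (searchUpdate m false s)) / 2

/-- Rechecking a true top changes nothing. A false top is caught with probability 1/2, and (1 + 4/5)
/ 2 = 9/10. -/
theorem nextPotential_head {d : ℕ} {s : ℕ × List ℕ} (hlt : s.2.headD 0 ≤ s.1) :
    nextPotential d (s.2.headD 0) s ≤
      (if s.2.headD 0 ≤ d then 1 else 9 / 10) * potential d s := by
  simp only [nextPotential, searchUpdate_head_true]
  split_ifs with h
  · simp
  · linarith [potential_pop (not_le.1 h) hlt]

/-- With a true top, a midpoint up to `d` is always accepted and halves the interval. A midpoint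
beyond `d` either becomes a false entry (factor 5/4) or halves the interval, and (5/4 + 1/2) / 2 =
7/8. With a false top the midpoint is beyond `d` as well; the worst outcomes are 5/4 and 1, with
average 9/8. -/
theorem nextPotential_mid {d : ℕ} {s : ℕ × List ℕ} (hd : d < s.1)
    (hlt : s.2.headD 0 + 1 < s.1) :
    nextPotential d ((s.2.headD 0 + s.1) / 2) s ≤
      (if s.2.headD 0 ≤ d then 7 / 8 else 9 / 8) * potential d s := by
  have hpos : 0 ≤ potential d s := potential_nonneg hd s.2
  set lo := s.2.headD 0 with hlo
  obtain ⟨m, hm⟩ : ∃ m, m = (lo + s.1) / 2 := ⟨_, rfl⟩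
  rw [← hm]
  have hm1 : lo < m := by omega
  have hm2 : m ≤ s.1 := by omega
  have hlow := potential_lower (d := d) hm1 hm2
  simp only [nextPotential]
  by_cases hd1 : lo ≤ d
  · rw [if_pos hd1]
    have hp := potential_head_le hd1
    rw [← hlo] at hp
    have h1 : (m : ℝ) ≤ (lo + s.1) / 2 := by
      have : 2 * m ≤ lo + s.1 := by omega
      have : (2 : ℝ) * m ≤ lo + s.1 := by exact_mod_cast this
      linarith
    have h2 : ((lo : ℝ) + s.1 - 1) / 2 ≤ m := by
      have : lo + s.1 ≤ 2 * m + 1 := by omega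
      have : (lo : ℝ) + s.1 ≤ 2 * m + 1 := by exact_mod_cast this
      linarith
    split_ifs with h
    · simp only [searchUpdate, ← hlo, if_neg hm1.ne', if_true, potential, if_neg (not_lt.2 h)]
      linarith
    · rw [potential_push_wrong (not_le.1 h) hm1]
      have : potential d (searchUpdate m false s) = (m : ℝ) - lo - 1 := by
        simp only [searchUpdate, ← hlo, if_neg hm1.ne', Bool.false_eq_true, if_false]
        exact potential_head_le (s := (m, s.2)) hd1
      linarith
  · rw [if_neg hd1, if_neg (by omega), potential_push_wrong (by omega) hm1]
    linarith

/-- The midpoint is queried with probability 1/3 and the top with probability 2/3. The rates are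
(7/8 + 1 + 1) / 3 < 39/40 for a true top and (9/8 + 9/10 + 9/10) / 3 = 39/40 for a false one:
rechecking twice as often as advancing makes false entries decay. -/
theorem avg_potential_le {n d : ℕ} {P Q : ℕ → Bool} (h : IsFirstDiff n P Q d) {s : ℕ × List ℕ}
    (hs : SearchInv n d s) :
    (∑ z : Coin n, potential d (searchStep P Q s z)) / Fintype.card (Coin n) ≤
      39 / 40 * potential d s := by
  have hpos : 0 ≤ potential d s := potential_nonneg hs.lt s.2
  have hlt : s.2.headD 0 < s.1 := by
    have := query_lt (sel := 1) hs.sorted (Nat.zero_lt_of_lt hs.lt)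
    simpa [query] using this
  set c : ℝ := (Fintype.card ((Fin n → Bool) → Bool) : ℝ) with hc
  have hcpos : 0 < c := by rw [hc]; exact_mod_cast Fintype.card_pos
  have hsel : ∀ sel : Fin 3, ∑ y : (Fin n → Bool) → Bool,
      potential d (searchStep P Q s ((sel, y) : Coin n)) = c * nextPotential d (query sel s) s := by
    intro sel
    have hq := query_lt (sel := sel) hs.sorted (Nat.zero_lt_of_lt hs.lt)
    have := hs.le
    exact sum_hash_mask h (m := query sel s) (by omega) fun b => potential d (searchUpdate (query sel s) b s)
  have h1 := nextPotential_head (d := d) hlt.le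
  have q1 : query 1 s = s.2.headD 0 := by simp [query]
  have q2 : query 2 s = s.2.headD 0 := by simp [query]
  rw [Fintype.sum_prod_type, Fin.sum_univ_three, hsel, hsel, hsel, q1, q2, Fintype.card_prod,
    Fintype.card_fin, Nat.cast_mul, ← hc, div_le_iff₀ (by positivity)]
  have key : nextPotential d (query 0 s) s + nextPotential d (s.2.headD 0) s +
      nextPotential d (s.2.headD 0) s ≤ 3 * (39 / 40 * potential d s) := by
    by_cases hmid : s.2.headD 0 + 1 < s.1
    · have q0 : query 0 s = (s.2.headD 0 + s.1) / 2 := by simp only [query, hmid]; simp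
      have h0 := nextPotential_mid hs.lt hmid
      rw [q0]
      split_ifs at h0 h1 <;> linarith
    · have q0 : query 0 s = s.2.headD 0 := by simp only [query, hmid]; simp
      rw [q0]
      split_ifs at h1 with hd
      -- Without room for a midpoint, a true top already equals `d`.
      · have : potential d s = 0 := by
          rw [potential_head_le hd]
          have : s.1 = s.2.headD 0 + 1 := by omega
          rw [this]; push_cast; ring
        linarith
      · linarith
  push_cast
  nlinarith

theorem listAvg_potential_le {n d : ℕ} {P Q : ℕ → Bool} (h : IsFirstDiff n P Q d) (N : ℕ)
    {s : ℕ × List ℕ} (hs : SearchInv n d s) :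
    listAvg N (fun l : List (Coin n) => potential d (l.foldl (searchStep P Q) s)) ≤
      (39 / 40) ^ N * potential d s := by
  induction N generalizing s with
  | zero => simp [listAvg]
  | succ N ih =>
    simp only [listAvg, List.foldl_cons]
    calc _ ≤ (∑ z : Coin n, (39 / 40) ^ N * potential d (searchStep P Q s z)) /
          Fintype.card (Coin n) := by
          gcongr with z
          exact ih (hs.step h z)
      _ = (39 / 40) ^ N * ((∑ z : Coin n, potential d (searchStep P Q s z)) /
          Fintype.card (Coin n)) := by rw [← Finset.mul_sum, mul_div_assoc]
      _ ≤ (39 / 40) ^ N * (39 / 40 * potential d s) := by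
          gcongr
          exact avg_potential_le h hs
      _ = _ := by ring

theorem SearchInv.foldl {n d : ℕ} {P Q : ℕ → Bool} (h : IsFirstDiff n P Q d) (l : List (Coin n))
    {s : ℕ × List ℕ} (hs : SearchInv n d s) : SearchInv n d (l.foldl (searchStep P Q) s) := by
  induction l generalizing s with
  | nil => exact hs
  | cons z l ih => exact ih (hs.step h z)

open Classical in
/-- The search fails to find the first difference in `N` rounds with probability at most
`n (39/40)^N`. -/
theorem search_failure_le {n d : ℕ} {P Q : ℕ → Bool} (h : IsFirstDiff n P Q d) (N : ℕ) :
    listAvg N (fun l : List (Coin n) =>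
      if (l.foldl (searchStep P Q) (n + 1, [])).2.headD 0 = d then (0 : ℝ) else 1) ≤
      n * (39 / 40) ^ N := by
  -- The upper end is `n + 1` because `d = n`, no difference at all, must be a possible answer. The
  -- initial potential is then `n`.
  have h0 : SearchInv n d (n + 1, []) := ⟨by have := h.le; simp; omega, by simp, by simp⟩
  calc _ ≤ listAvg N (fun l : List (Coin n) =>
        potential d (l.foldl (searchStep P Q) (n + 1, []))) := by
        refine listAvg_mono fun l _ => ?_
        have hl := h0.foldl h l
        split_ifs with hd
        · exact potential_nonneg hl.lt _
        · exact hl.one_le_potential hd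
    _ ≤ (39 / 40) ^ N * potential d (n + 1, []) := listAvg_potential_le h N h0
    _ = _ := by simp [potential, mul_comm]

/-! ### Paths described by tables, and their corrections -/

/-- The first `k` bits of the path that sends the bit `s h` after the bits `h`. -/
def walk (s : List Bool → Bool) : ℕ → List Bool
  | 0 => []
  | k + 1 => walk s k ++ [s (walk s k)]

@[simp]
theorem length_walk (s : List Bool → Bool) (k : ℕ) : (walk s k).length = k := by
  induction k with
  | zero => rfl
  | succ k ih => simp [walk, ih]

theorem walk_succ_eq_cons (s : List Bool → Bool) (k : ℕ) :
    walk s (k + 1) = s [] :: walk (fun h => s (s [] :: h)) k := by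
  induction k with
  | zero => rfl
  | succ k ih => rw [walk, ih]; rfl

theorem walk_congr {s t : List Bool → Bool} {k : ℕ}
    (h : ∀ i < k, walk s i = walk t i → s (walk t i) = t (walk t i)) : walk s k = walk t k := by
  induction k with
  | zero => rfl
  | succ k ih =>
    have hk := ih fun i hi => h i (by omega)
    rw [walk, walk, hk, h k (by omega) hk]

/-- The table of a player who owns the nodes in `own`, has the table `a`, and flips the bits of
the nodes of the other player at the positions in `J`. -/
def corrected (own a : List Bool → Bool) (J : Finset ℕ) (h : List Bool) : Bool :=
  xor (a h) (decide (h.length ∈ J) && !own h)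

/-- The bits of the path of a player after corrections at the positions in `J`. -/
def correctedBits (own a : List Bool → Bool) (J : Finset ℕ) (i : ℕ) : Bool :=
  corrected own a J (walk (corrected own a J) i)

/-- The table that takes each bit from the owner of the node. -/
def jointTable (own a b : List Bool → Bool) (h : List Bool) : Bool := if own h then a h else b h

/-- The positions on the joint path at which the tables of the players differ. -/
def mistakes (n : ℕ) (own a b : List Bool → Bool) : Finset ℕ :=
  (Finset.range n).filter fun i =>
    a (walk (jointTable own a b) i) ≠ b (walk (jointTable own a b) i)

/-- `d` is the first position in `S` that is missing from its initial part `J`, and `n` if there is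
none. -/
structure IsNext (n : ℕ) (S J : Finset ℕ) (d : ℕ) : Prop where
  le : d ≤ n
  subset : J ⊆ S
  lt : ∀ i ∈ J, i < d
  mem : ∀ i < d, i ∈ S → i ∈ J
  next : d < n → d ∈ S

section Walks

variable {n d : ℕ} {own a b : List Bool → Bool} {J : Finset ℕ}

/-- At a corrected position the tables differ, so flipping the non-owner's bit yields the owner's
bit. At any other position before `d` there is no mistake, and both already have it. -/
theorem corrected_eq_of_isNext (hd : IsNext n (mistakes n own a b) J d) {i : ℕ} (hi : i < d) :
    corrected own a J (walk (jointTable own a b) i) =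
        jointTable own a b (walk (jointTable own a b) i) ∧
      corrected (fun h => !own h) b J (walk (jointTable own a b) i) =
        jointTable own a b (walk (jointTable own a b) i) := by
  have hin : i < n := lt_of_lt_of_le hi hd.le
  by_cases hJ : i ∈ J
  · have hne := (Finset.mem_filter.1 (hd.subset hJ)).2
    simp only [corrected, length_walk, hJ, decide_true, Bool.true_and]
    generalize walk (jointTable own a b) i = h at *
    simp only [jointTable]
    revert hne
    cases own h <;> cases a h <;> cases b h <;> simp
  · have heq : a (walk (jointTable own a b) i) = b (walk (jointTable own a b) i) := by
      by_contra hne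
      exact hJ (hd.mem i hi (Finset.mem_filter.2 ⟨Finset.mem_range.2 hin, hne⟩))
    simp only [corrected, length_walk, hJ, decide_false, Bool.false_and, Bool.xor_false]
    generalize walk (jointTable own a b) i = h at *
    simp only [jointTable]
    revert heq
    cases own h <;> cases a h <;> cases b h <;> simp

theorem walk_corrected_eq (hd : IsNext n (mistakes n own a b) J d) {i : ℕ} (hi : i ≤ d) :
    walk (corrected own a J) i = walk (jointTable own a b) i ∧
      walk (corrected (fun h => !own h) b J) i = walk (jointTable own a b) i :=
  ⟨walk_congr fun j hj _ => (corrected_eq_of_isNext hd (by omega)).1,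
    walk_congr fun j hj _ => (corrected_eq_of_isNext hd (by omega)).2⟩

/-- Before `d` both corrected walks follow the joint path. At `d` they stand at the same node,
nobody flips there, and the tables differ if `d < n`. Searching for a first difference therefore
finds the next mistake. -/
theorem isFirstDiff_correctedBits (hd : IsNext n (mistakes n own a b) J d) :
    IsFirstDiff n (correctedBits own a J) (correctedBits (fun h => !own h) b J) d where
  le := hd.le
  agree i hi := by
    have h1 := walk_corrected_eq hd hi.le
    have h2 := corrected_eq_of_isNext hd hi
    simp only [correctedBits, h1.1, h1.2, h2.1, h2.2]
  differ hn := by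
    have h1 := walk_corrected_eq hd le_rfl
    have hJ : d ∉ J := fun h => (hd.lt d h).false
    have h2 := (Finset.mem_filter.1 (hd.next hn)).2
    simpa only [correctedBits, h1.1, h1.2, corrected, length_walk, hJ, decide_false,
      Bool.false_and, Bool.xor_false] using h2

end Walks

-- Growing initial parts of the set of mistakes

theorem isNext_self {n : ℕ} {S : Finset ℕ} (hS : ∀ i ∈ S, i < n) : IsNext n S S n :=
  ⟨le_rfl, subset_rfl, hS, fun _ _ h => h, fun h => absurd h (lt_irrefl _)⟩

theorem IsNext.eq_of_le {n d : ℕ} {S J : Finset ℕ} (hS : ∀ i ∈ S, i < n) (h : IsNext n S J d)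
    (hd : n ≤ d) : J = S :=
  Finset.Subset.antisymm h.subset fun i hi => h.mem i ((hS i hi).trans_le hd) hi

/-- The initial parts of `S` have a next element. -/
theorem exists_isNext {n : ℕ} {S J : Finset ℕ} (hS : ∀ i ∈ S, i < n) (hJ : J ⊆ S)
    (h : ∀ i ∈ J, ∀ j ∈ S, j ∉ J → i < j) : ∃ d, IsNext n S J d := by
  by_cases hne : (S \ J).Nonempty
  · obtain ⟨h1, h2⟩ := Finset.mem_sdiff.1 (Finset.min'_mem _ hne)
    refine ⟨_, (hS _ h1).le, hJ, fun i hi => h i hi _ h1 h2, fun i hi hiS => ?_, fun _ => h1⟩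
    by_contra hiJ
    exact absurd (Finset.min'_le _ i (Finset.mem_sdiff.2 ⟨hiS, hiJ⟩)) (not_le.2 hi)
  · have : S ⊆ J := Finset.sdiff_eq_empty_iff_subset.1 (Finset.not_nonempty_iff_eq_empty.1 hne)
    rw [Finset.Subset.antisymm hJ this]
    exact ⟨n, isNext_self hS⟩

theorem IsNext.exists_insert {n d : ℕ} {S J : Finset ℕ} (hS : ∀ i ∈ S, i < n)
    (h : IsNext n S J d) (hd : d < n) : ∃ d', IsNext n S (insert d J) d' := by
  refine exists_isNext hS (Finset.insert_subset (h.next hd) h.subset) fun i hi j hj hjJ => ?_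
  simp only [Finset.mem_insert, not_or] at hi hjJ
  have hdj : d < j := lt_of_le_of_ne (not_lt.1 fun hlt => hjJ.2 (h.mem j hlt hj)) (Ne.symm hjJ.1)
  rcases hi with rfl | hi
  · exact hdj
  · exact (h.lt i hi).trans hdj

/-! ### The rounds of the simulation -/

/-- The public state: the positions corrected so far and the state of the search for the next. -/
abbrev SimState : Type := Finset ℕ × ℕ × List ℕ

/-- The state before the first round. -/
def SimState.init (n : ℕ) : SimState := (∅, n + 1, [])

/-- The end of a phase: correct the position that was found, and start a new search. -/
def commit (n : ℕ) (σ : SimState) : SimState :=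
  (if σ.2.2.headD 0 < n then insert (σ.2.2.headD 0) σ.1 else σ.1, n + 1, [])

/-- The effect of a round with coins `z`, or of the end of a phase, for players whose bit sequences
after corrections `J` are `PA J` and `PB J`. -/
def simStep {n : ℕ} (PA PB : Finset ℕ → ℕ → Bool) (σ : SimState) : Option (Coin n) → SimState
  | none => commit n σ
  | some z => (σ.1, searchStep (PA σ.1) (PB σ.1) σ.2 z)

/-- The rounds of one phase after another. -/
def phases {n : ℕ} (ls : List (List (Coin n))) : List (Option (Coin n)) :=
  ls.flatMap fun l => l.map some ++ [none]

/-- The average of `f` over all lists of `T` lists of length `N`. -/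
def phaseAvg {Z : Type*} [Fintype Z] (N : ℕ) : ℕ → (List (List Z) → ℝ) → ℝ
  | 0, f => f []
  | T + 1, f => listAvg N fun l => phaseAvg N T fun ls => f (l :: ls)

theorem phaseAvg_mono {Z : Type*} [Fintype Z] {N T : ℕ} {f g : List (List Z) → ℝ}
    (h : ∀ l, f l ≤ g l) : phaseAvg N T f ≤ phaseAvg N T g := by
  induction T generalizing f g with
  | zero => exact h _
  | succ k ih => exact listAvg_mono fun l _ => ih fun ls => h _

theorem phaseAvg_const {Z : Type*} [Fintype Z] [Nonempty Z] (N T : ℕ) (c : ℝ) :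
    phaseAvg N T (fun _ : List (List Z) => c) = c := by
  induction T with
  | zero => rfl
  | succ k ih => simp [phaseAvg, ih, listAvg_const]

theorem foldl_simStep_map_some {n : ℕ} (PA PB : Finset ℕ → ℕ → Bool) (l : List (Coin n))
    (σ : SimState) : (l.map some).foldl (simStep PA PB) σ =
      (σ.1, l.foldl (searchStep (PA σ.1) (PB σ.1)) σ.2) := by
  induction l generalizing σ with
  | nil => rfl
  | cons z l ih => simp only [List.map_cons, List.foldl_cons, ih, simStep]

open Classical in
/-- The probability that the `T` phases do not find all mistakes. -/
theorem phaseAvg_failure_le {n : ℕ} {own a b : List Bool → Bool} (N : ℕ) {T : ℕ} {J : Finset ℕ}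
    (hJ : ∃ d, IsNext n (mistakes n own a b) J d)
    (hT : (mistakes n own a b).card ≤ J.card + T) :
    phaseAvg N T (fun ls : List (List (Coin n)) =>
      if ((phases ls).foldl (simStep (correctedBits own a) (correctedBits (fun h => !own h) b))
        (J, n + 1, [])).1 = mistakes n own a b then (0 : ℝ) else 1) ≤
      T * (n * (39 / 40) ^ N) := by
  have hS : ∀ i ∈ mistakes n own a b, i < n := fun i hi =>
    Finset.mem_range.1 (Finset.mem_filter.1 hi).1
  induction T generalizing J with
  | zero =>
    obtain ⟨d, hd⟩ := hJ
    have : J = mistakes n own a b := Finset.eq_of_subset_of_card_le hd.subset (by simpa using hT)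
    simp [phaseAvg, phases, this]
  | succ T ih =>
    obtain ⟨d, hd⟩ := hJ
    have hdiff := isFirstDiff_correctedBits hd
    calc _ ≤ listAvg N (fun l : List (Coin n) =>
            (T * (n * (39 / 40) ^ N) : ℝ) +
            if (l.foldl (searchStep (correctedBits own a J) (correctedBits (fun h => !own h) b J))
              (n + 1, [])).2.headD 0 = d then (0 : ℝ) else 1) := by
          refine listAvg_mono fun l _ => ?_
          split_ifs with hl
          · rw [add_zero]
            have hcommit : ∀ ls : List (List (Coin n)), (phases (l :: ls)).foldl
                (simStep (correctedBits own a) (correctedBits (fun h => !own h) b))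
                (J, n + 1, []) = (phases ls).foldl
                (simStep (correctedBits own a) (correctedBits (fun h => !own h) b))
                (if d < n then insert d J else J, n + 1, []) := by
              intro ls
              simp only [phases, List.flatMap_cons, List.foldl_append, foldl_simStep_map_some,
                List.foldl_cons, List.foldl_nil, simStep, commit, hl]
            simp only [hcommit]
            -- An answer below `n` adds one mistake and uses up one phase. The answer `n` means that
            -- nothing is left to correct, and later phases keep the set as it is.
            by_cases hdn : d < n
            · simp only [if_pos hdn]
              refine ih (hd.exists_insert hS hdn) ?_
              rw [Finset.card_insert_of_notMem fun h => (hd.lt d h).false]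
              omega
            · simp only [if_neg hdn]
              refine ih ⟨d, hd⟩ ?_
              rw [hd.eq_of_le hS (not_lt.1 hdn)]
              omega
          -- After a wrong answer the remaining phases are written off: failure is bounded by one.
          · calc _ ≤ phaseAvg N T (fun _ : List (List (Coin n)) => (1 : ℝ)) :=
                  phaseAvg_mono fun ls => by dsimp only; split_ifs <;> norm_num
              _ = 1 := phaseAvg_const _ _ _
              _ ≤ _ := le_add_of_nonneg_left (by positivity)
      _ ≤ (T * (n * (39 / 40) ^ N) : ℝ) + n * (39 / 40) ^ N := by
          rw [listAvg_add, listAvg_const]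
          gcongr
          exact search_failure_le hdiff N
      _ = _ := by push_cast; ring

-- Coin lists as a finite uniform sample space

/-- A recursive average becomes a plain sum over a finite index type, which can be exchanged with
integrals and from which a single good index can later be picked. -/
theorem exists_listAvg_eq {Z : Type} [Fintype Z] [Nonempty Z] (k : ℕ) :
    ∃ (ι : Type) (_ : Fintype ι) (_ : Nonempty ι) (L : ι → List Z), (∀ i, (L i).length = k) ∧
      ∀ f, listAvg k f = (∑ i, f (L i)) / Fintype.card ι := by
  induction k with
  | zero => exact ⟨Unit, inferInstance, inferInstance, fun _ => [], by simp, by simp [listAvg]⟩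
  | succ k ih =>
    obtain ⟨ι, _, _, L, hL, h⟩ := ih
    refine ⟨Z × ι, inferInstance, inferInstance, fun i => i.1 :: L i.2, by simp [hL], fun f => ?_⟩
    simp only [listAvg, h, Fintype.sum_prod_type, Fintype.card_prod, Nat.cast_mul,
      ← Finset.sum_div]
    rw [div_div, mul_comm]

theorem exists_phaseAvg_eq {Z : Type} [Fintype Z] [Nonempty Z] (N T : ℕ) :
    ∃ (ι : Type) (_ : Fintype ι) (_ : Nonempty ι) (L : ι → List (List Z)),
      (∀ i, (L i).flatten.length = T * N) ∧
      ∀ f, phaseAvg N T f = (∑ i, f (L i)) / Fintype.card ι := by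
  induction T with
  | zero => exact ⟨Unit, inferInstance, inferInstance, fun _ => [], by simp, by simp [phaseAvg]⟩
  | succ k ih =>
    obtain ⟨ι, _, _, L, hL, h⟩ := ih
    obtain ⟨κ, _, _, M, hM, h'⟩ := exists_listAvg_eq (Z := Z) N
    refine ⟨κ × ι, inferInstance, inferInstance, fun i => M i.1 :: L i.2, fun i => ?_,
      fun f => ?_⟩
    · rw [List.flatten_cons, List.length_append, hM, hL]; ring
    simp only [phaseAvg, h, h', Fintype.sum_prod_type, Fintype.card_prod, Nat.cast_mul,
      ← Finset.sum_div]
    rw [div_div, mul_comm]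

/-- The number of communicating rounds in a list of rounds. -/
def numRounds {Z : Type*} : List (Option Z) → ℕ
  | [] => 0
  | none :: l => numRounds l
  | some _ :: l => numRounds l + 1

theorem numRounds_map_some_append {Z : Type*} (l : List Z) (l' : List (Option Z)) :
    numRounds (l.map some ++ l') = l.length + numRounds l' := by
  induction l with
  | nil => simp
  | cons z l ih => simp [numRounds, ih]; omega

theorem numRounds_phases {n : ℕ} (ls : List (List (Coin n))) :
    numRounds (phases ls) = ls.flatten.length := by
  induction ls with
  | nil => rfl
  | cons l ls ih =>
    have : phases (l :: ls) = l.map some ++ none :: phases ls := by simp [phases]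
    rw [this, numRounds_map_some_append, numRounds, ih]
    simp

/-- The corrections that have been made when all rounds are over. -/
def finalFixes {n : ℕ} (ops : List (Option (Coin n))) (own a b : List Bool → Bool) : Finset ℕ :=
  (ops.foldl (simStep (correctedBits own a) (correctedBits (fun h => !own h) b))
    (SimState.init n)).1

open Classical in
theorem exists_coins (n N T : ℕ) :
    ∃ (ι : Type) (_ : Fintype ι) (_ : Nonempty ι) (L : ι → List (Option (Coin n))),
      (∀ i, numRounds (L i) = T * N) ∧
      ∀ own a b : List Bool → Bool, (mistakes n own a b).card ≤ T →
        ∑ i, (if finalFixes (L i) own a b = mistakes n own a b then (0 : ℝ) else 1) ≤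
          Fintype.card ι * (T * (n * (39 / 40) ^ N)) := by
  obtain ⟨ι, _, _, L, hL, h⟩ := exists_phaseAvg_eq (Z := Coin n) N T
  refine ⟨ι, inferInstance, inferInstance, fun i => phases (L i),
    fun i => by rw [numRounds_phases, hL], fun own a b hT => ?_⟩
  have hS : ∀ i ∈ mistakes n own a b, i < n := fun i hi =>
    Finset.mem_range.1 (Finset.mem_filter.1 hi).1
  have := phaseAvg_failure_le (n := n) (own := own) (a := a) (b := b) N (T := T) (J := ∅)
    (exists_isNext hS (by simp) (by simp)) (by simpa using hT)
  rw [h, div_le_iff₀ (by exact_mod_cast Fintype.card_pos), mul_comm] at this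
  exact this

/-! ### The protocol tree of the simulation -/

section RoundTree

variable {X : Type u} {Y : Type v} {n : ℕ}

/-- The probability that sends the bit `b` for sure. -/
def sureBit (b : Bool) : unitInterval := if b then 1 else 0

theorem coe_sureBit (b : Bool) : (sureBit b : ℝ) = if b then 1 else 0 := by
  cases b <;> simp [sureBit]

theorem bitLaw_sureBit (b : Bool) : Tree.bitLaw (sureBit b) = PMF.pure b := by
  ext a
  simp only [Tree.bitLaw, PMF.ofFintype_apply, PMF.pure_apply, coe_sureBit]
  cases a <;> cases b <;> simp

/-- The public state after Alice and Bob have sent the bits `a` and `b` in a round. -/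
def advance (z : Coin n) (σ : SimState) (a b : Bool) : SimState :=
  (σ.1, searchUpdate (query z.1 σ.2) (a == b) σ.2)

/-- The protocol tree that runs the given rounds from the state `σ`; in each of them both players
send a hash bit of their current sequence. -/
def roundTree (PA : X → Finset ℕ → ℕ → Bool) (PB : Y → Finset ℕ → ℕ → Bool) :
    List (Option (Coin n)) → SimState → Tree X Y
  | [], _ => .leaf
  | none :: ops, σ => roundTree PA PB ops (commit n σ)
  | some z :: ops, σ =>
    .alice (fun x => sureBit (hashBit (PA x σ.1) z σ.2))
      (.bob (fun y => sureBit (hashBit (PB y σ.1) z σ.2))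
        (roundTree PA PB ops (advance z σ false false))
        (roundTree PA PB ops (advance z σ false true)))
      (.bob (fun y => sureBit (hashBit (PB y σ.1) z σ.2))
        (roundTree PA PB ops (advance z σ true false))
        (roundTree PA PB ops (advance z σ true true)))

/-- The bits that are sent in the given rounds. -/
def roundBits (PA PB : Finset ℕ → ℕ → Bool) : List (Option (Coin n)) → SimState → List Bool
  | [], _ => []
  | none :: ops, σ => roundBits PA PB ops (commit n σ)
  | some z :: ops, σ => hashBit (PA σ.1) z σ.2 :: hashBit (PB σ.1) z σ.2 ::
      roundBits PA PB ops (simStep PA PB σ (some z))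

/-- The final state, computed from the bits that were sent. -/
def replay : List (Option (Coin n)) → SimState → List Bool → SimState
  | [], σ, _ => σ
  | none :: ops, σ, m => replay ops (commit n σ) m
  | some z :: ops, σ, a :: b :: m => replay ops (advance z σ a b) m
  | some _ :: _, σ, _ => σ

theorem depth_roundTree (PA : X → Finset ℕ → ℕ → Bool) (PB : Y → Finset ℕ → ℕ → Bool)
    (ops : List (Option (Coin n))) (σ : SimState) :
    (roundTree PA PB ops σ).depth = 2 * numRounds ops := by
  induction ops generalizing σ with
  | nil => rfl
  | cons op ops ih =>
    cases op with
    | none => exact ih _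
    | some z => simp [roundTree, Tree.depth, ih, numRounds]; omega

/-- The hash coins are built into the tree and every bit is forced, so the only randomness left in
the transcript is the public one. -/
theorem law_roundTree (PA : X → Finset ℕ → ℕ → Bool) (PB : Y → Finset ℕ → ℕ → Bool)
    (ops : List (Option (Coin n))) (σ : SimState) (x : X) (y : Y) :
    (roundTree PA PB ops σ).law x y = PMF.pure (roundBits (PA x) (PB y) ops σ) := by
  induction ops generalizing σ with
  | nil => rfl
  | cons op ops ih =>
    cases op with
    | none => exact ih _
    | some z =>
      simp only [roundTree, Tree.law, bitLaw_sureBit, PMF.pure_bind, roundBits, ih, simStep,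
        searchStep]
      cases hashBit (PA x σ.1) z σ.2 <;> cases hashBit (PB y σ.1) z σ.2 <;>
        simp [PMF.pure_map, advance]

/-- A round changes the state only through the agreement of two transmitted bits. The state is thus
public, although it is driven by both private sequences, and either player can recover the
corrections from the transcript. -/
theorem replay_roundBits (PA PB : Finset ℕ → ℕ → Bool) (ops : List (Option (Coin n)))
    (σ : SimState) : replay ops σ (roundBits PA PB ops σ) = ops.foldl (simStep PA PB) σ := by
  induction ops generalizing σ with
  | nil => rfl
  | cons op ops ih =>
    cases op with
    | none => exact ih _
    | some z => simp only [roundBits, replay, List.foldl_cons, ← ih]; rfl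

variable {Ω : Type w} [MeasurableSpace Ω]

theorem measurable_hashBit {P : Ω → ℕ → Bool} (hP : ∀ i, Measurable fun ω => P ω i) (z : Coin n)
    (s : ℕ × List ℕ) : Measurable fun ω => hashBit (P ω) z s := by
  have h1 : Measurable fun ω => mask n (P ω) (query z.1 s) := by
    refine measurable_pi_lambda _ fun i => ?_
    exact (Measurable.of_discrete (f := fun b : Bool => decide (i.1 < query z.1 s) && b)).comp (hP i)
  exact (Measurable.of_discrete (f := z.2)).comp h1

theorem measurable_sureBit {f : Ω → Bool} (hf : Measurable f) :
    Measurable fun ω => (sureBit (f ω) : ℝ) :=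
  (Measurable.of_discrete (f := fun b : Bool => (sureBit b : ℝ))).comp hf

theorem nodeAt_leaf (h : List Bool) : (Tree.leaf : Tree X Y).nodeAt h = .leaf := by
  cases h <;> rfl

/-- The list of rounds fixes the shape and the owners; only the forced bits vary with `ω`. -/
theorem roundTree_measurable {PA : Ω → X → Finset ℕ → ℕ → Bool} {PB : Ω → Y → Finset ℕ → ℕ → Bool}
    (hA : ∀ x J i, Measurable fun ω => PA ω x J i) (hB : ∀ y J i, Measurable fun ω => PB ω y J i)
    (ops : List (Option (Coin n))) (σ : SimState) (h : List Bool) :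
    (∃ o, ∀ ω, ((roundTree (PA ω) (PB ω) ops σ).nodeAt h).owner = o) ∧
      ∀ x y, Measurable fun ω => ((roundTree (PA ω) (PB ω) ops σ).nodeAt h).bias x y := by
  induction ops generalizing σ h with
  | nil => exact ⟨⟨none, fun ω => by simp [roundTree, nodeAt_leaf, Tree.owner]⟩,
      by simp [roundTree, nodeAt_leaf, Tree.bias]⟩
  | cons op ops ih =>
    cases op with
    | none => exact ih _ _
    | some z =>
      match h with
      | [] => exact ⟨⟨_, fun ω => rfl⟩, fun x y => measurable_sureBit (measurable_hashBit (hA x _) _ _)⟩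
      | [a] =>
        cases a <;>
        exact ⟨⟨_, fun ω => rfl⟩, fun x y => measurable_sureBit (measurable_hashBit (hB y _) _ _)⟩
      | a :: b :: h =>
        cases a <;> cases b <;> simpa [roundTree, Tree.nodeAt] using ih _ h

end RoundTree

/-! ### Measurability of paths -/

section Measurability

variable {Ω : Type*} [MeasurableSpace Ω]

/-- This handles lookups at a random node: there are only countably many nodes. -/
theorem Measurable.apply_countable {γ δ : Type*} [MeasurableSpace γ] [Countable γ]
    [MeasurableSingletonClass γ] [MeasurableSpace δ] {f : Ω → γ → δ} {g : Ω → γ}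
    (hf : ∀ c, Measurable fun ω => f ω c) (hg : Measurable g) : Measurable fun ω => f ω (g ω) :=
  (measurable_from_prod_countable_left (f := fun p : Ω × γ => f p.1 p.2) hf).comp
    (measurable_id.prodMk hg)

theorem measurable_walk {s : Ω → List Bool → Bool} (hs : ∀ h, Measurable fun ω => s ω h) (k : ℕ) :
    Measurable fun ω => walk (s ω) k := by
  induction k with
  | zero => exact measurable_const
  | succ k ih =>
    refine Measurable.apply_countable (f := fun ω h => h ++ [s ω h]) (fun h => ?_) ih
    exact (Measurable.of_discrete (f := fun b : Bool => h ++ [b])).comp (hs h)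

theorem measurable_walk_bit {s t : Ω → List Bool → Bool} (hs : ∀ h, Measurable fun ω => s ω h)
    (ht : ∀ h, Measurable fun ω => t ω h) (k : ℕ) : Measurable fun ω => t ω (walk (s ω) k) :=
  Measurable.apply_countable ht (measurable_walk hs k)

theorem measurable_corrected {own a : Ω → List Bool → Bool}
    (ho : ∀ h, Measurable fun ω => own ω h) (ha : ∀ h, Measurable fun ω => a ω h) (J : Finset ℕ)
    (h : List Bool) : Measurable fun ω => corrected (own ω) (a ω) J h :=
  (Measurable.of_discrete (f := fun p : Bool × Bool =>
    xor p.1 (decide (h.length ∈ J) && !p.2))).comp ((ha h).prodMk (ho h))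

theorem measurable_jointTable {own a b : Ω → List Bool → Bool}
    (ho : ∀ h, Measurable fun ω => own ω h) (ha : ∀ h, Measurable fun ω => a ω h)
    (hb : ∀ h, Measurable fun ω => b ω h) (h : List Bool) :
    Measurable fun ω => jointTable (own ω) (a ω) (b ω) h :=
  (Measurable.of_discrete (f := fun p : Bool × Bool × Bool =>
    if p.1 then p.2.1 else p.2.2)).comp ((ho h).prodMk ((ha h).prodMk (hb h)))

theorem measurable_correctedBits {own a : Ω → List Bool → Bool}
    (ho : ∀ h, Measurable fun ω => own ω h) (ha : ∀ h, Measurable fun ω => a ω h) (J : Finset ℕ)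
    (i : ℕ) : Measurable fun ω => correctedBits (own ω) (a ω) J i :=
  measurable_walk_bit (measurable_corrected ho ha J) (measurable_corrected ho ha J) i

theorem measurable_not_own {own : Ω → List Bool → Bool} (ho : ∀ h, Measurable fun ω => own ω h)
    (h : List Bool) : Measurable fun ω => !own ω h :=
  (Measurable.of_discrete (f := fun b : Bool => !b)).comp (ho h)

/-- The tables of the two players disagree at the positions where this is `true`. -/
def mistakeBits (n : ℕ) (own a b : List Bool → Bool) : Fin n → Bool := fun i =>
  xor (a (walk (jointTable own a b) i)) (b (walk (jointTable own a b) i))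

/-- The set is read off from a vector of finitely many bits, a discrete space on which every
function is measurable. -/
theorem mistakes_eq (n : ℕ) (own a b : List Bool → Bool) :
    mistakes n own a b =
      (Finset.univ.filter fun i => mistakeBits n own a b i = true).map Fin.valEmbedding := by
  ext i
  simp only [mistakes, mistakeBits, Finset.mem_filter, Finset.mem_range, Finset.mem_map,
    Fin.valEmbedding_apply]
  constructor
  · rintro ⟨h1, h2⟩
    exact ⟨⟨i, h1⟩, by simpa using h2, rfl⟩
  · rintro ⟨j, h1, rfl⟩
    exact ⟨j.2, by simpa using h1⟩

theorem measurable_mistakeBits {own a b : Ω → List Bool → Bool} (n : ℕ)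
    (ho : ∀ h, Measurable fun ω => own ω h) (ha : ∀ h, Measurable fun ω => a ω h)
    (hb : ∀ h, Measurable fun ω => b ω h) :
    Measurable fun ω => mistakeBits n (own ω) (a ω) (b ω) := by
  have hj := measurable_jointTable ho ha hb
  refine measurable_pi_lambda _ fun i => ?_
  exact (Measurable.of_discrete (f := fun p : Bool × Bool => xor p.1 p.2)).comp
    ((measurable_walk_bit hj ha i).prodMk (measurable_walk_bit hj hb i))

theorem measurable_card_mistakes {own a b : Ω → List Bool → Bool} (n : ℕ)
    (ho : ∀ h, Measurable fun ω => own ω h) (ha : ∀ h, Measurable fun ω => a ω h)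
    (hb : ∀ h, Measurable fun ω => b ω h) :
    Measurable fun ω => (mistakes n (own ω) (a ω) (b ω)).card := by
  simp only [mistakes_eq]
  exact (Measurable.of_discrete (f := fun v : Fin n → Bool =>
    ((Finset.univ.filter fun i => v i = true).map Fin.valEmbedding).card)).comp
    (measurable_mistakeBits n ho ha hb)

theorem measurable_roundBits {n : ℕ} {PA PB : Ω → Finset ℕ → ℕ → Bool}
    (hA : ∀ J i, Measurable fun ω => PA ω J i) (hB : ∀ J i, Measurable fun ω => PB ω J i)
    (ops : List (Option (Coin n))) (σ : SimState) :
    Measurable fun ω => roundBits (PA ω) (PB ω) ops σ := by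
  induction ops generalizing σ with
  | nil => exact measurable_const
  | cons op ops ih =>
    cases op with
    | none => exact ih _
    | some z =>
      have hab := (measurable_hashBit (hA σ.1) z σ.2).prodMk (measurable_hashBit (hB σ.1) z σ.2)
      refine Measurable.apply_countable (f := fun ω (p : Bool × Bool) =>
        p.1 :: p.2 :: roundBits (PA ω) (PB ω) ops (advance z σ p.1 p.2)) (fun p => ?_) hab
      exact (Measurable.of_discrete (f := fun l : List Bool => p.1 :: p.2 :: l)).comp (ih _)

theorem finalFixes_eq {n : ℕ} (ops : List (Option (Coin n))) (own a b : List Bool → Bool) :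
    finalFixes ops own a b = (replay ops (SimState.init n) (roundBits (correctedBits own a)
      (correctedBits (fun h => !own h) b) ops (SimState.init n))).1 := by
  rw [replay_roundBits]; rfl

theorem measurableSet_finalFixes_eq {n : ℕ} {own a b : Ω → List Bool → Bool}
    (ops : List (Option (Coin n)))
    (ho : ∀ h, Measurable fun ω => own ω h) (ha : ∀ h, Measurable fun ω => a ω h)
    (hb : ∀ h, Measurable fun ω => b ω h) :
    MeasurableSet {ω | finalFixes ops (own ω) (a ω) (b ω) = mistakes n (own ω) (a ω) (b ω)} := by
  simp only [finalFixes_eq, mistakes_eq]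
  have h1 := measurable_roundBits (measurable_correctedBits ho ha)
    (measurable_correctedBits (measurable_not_own ho) hb) ops (SimState.init n)
  have h2 := h1.prodMk (measurable_mistakeBits n ho ha hb)
  exact h2 (MeasurableSet.of_discrete (s := {p : List Bool × (Fin n → Bool) |
    (replay ops (SimState.init n) p.1).1 =
      (Finset.univ.filter fun i => p.2 i = true).map Fin.valEmbedding}))

end Measurability

/-! ### Running a protocol tree with shared uniform thresholds -/

section Thresholds

variable {X : Type u} {Y : Type v}

/-- The table that sends a one at `h` if the threshold at this depth is below `α h`. -/
def thr (α : List Bool → ℝ) (ρ : ℕ → ℝ) (h : List Bool) : Bool := decide (ρ h.length < α h)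

namespace Tree

/-- Whether the first bit is sent by Alice. -/
def isAlice : Tree X Y → Bool
  | alice _ _ _ => true
  | _ => false

/-- Alice's probability for the bit at the root, where `q` is her belief about Bob's bits. -/
def aliceProb : Tree X Y → X → ℝ → ℝ
  | leaf, _, _ => 0
  | alice p _ _, x, _ => p x
  | bob _ _ _, _, q => q

/-- Bob's probability for the bit at the root, where `q` is his belief about Alice's bits. -/
def bobProb : Tree X Y → Y → ℝ → ℝ
  | leaf, _, _ => 0
  | alice _ _ _, _, q => q
  | bob p _ _, y, _ => p y

/-- The leaf that is reached when all bits are chosen by the thresholds `ρ`. -/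
def leafPath : Tree X Y → X → Y → (ℕ → ℝ) → List Bool
  | leaf, _, _, _ => []
  | alice p t₀ t₁, x, y, ρ =>
    if ρ 0 < p x then true :: t₁.leafPath x y (fun i => ρ (i + 1))
    else false :: t₀.leafPath x y (fun i => ρ (i + 1))
  | bob p t₀ t₁, x, y, ρ =>
    if ρ 0 < p y then true :: t₁.leafPath x y (fun i => ρ (i + 1))
    else false :: t₀.leafPath x y (fun i => ρ (i + 1))

/-- The part of a sequence of bits up to a leaf. -/
def trunc : Tree X Y → List Bool → List Bool
  | _, [] => []
  | t, b :: l => if t.owner.isNone then [] else b :: (t.nodeAt [b]).trunc l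

/-- Alice's table. -/
def aliceTable (t : Tree X Y) (A : List Bool → ℝ) (x : X) (h : List Bool) : ℝ :=
  (t.nodeAt h).aliceProb x (A h)

/-- Bob's table. -/
def bobTable (t : Tree X Y) (B : List Bool → ℝ) (y : Y) (h : List Bool) : ℝ :=
  (t.nodeAt h).bobProb y (B h)

/-- The expected distance, along the path of the protocol, between the probabilities of the bits
and the belief of the player who does not send them. -/
def beliefGap : Tree X Y → (List Bool → ℝ) → (List Bool → ℝ) → X → Y → ℝ
  | leaf, _, _, _, _ => 0
  | alice p t₀ t₁, A, B, x, y => |p x - B []| +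
      ((p x : ℝ) * t₁.beliefGap (fun h => A (true :: h)) (fun h => B (true :: h)) x y +
        (1 - p x) * t₀.beliefGap (fun h => A (false :: h)) (fun h => B (false :: h)) x y)
  | bob p t₀ t₁, A, B, x, y => |A [] - p y| +
      ((p y : ℝ) * t₁.beliefGap (fun h => A (true :: h)) (fun h => B (true :: h)) x y +
        (1 - p y) * t₀.beliefGap (fun h => A (false :: h)) (fun h => B (false :: h)) x y)

theorem nodeAt_cons (t : Tree X Y) (b : Bool) (h : List Bool) :
    t.nodeAt (b :: h) = (t.nodeAt [b]).nodeAt h := by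
  cases t <;> cases b <;> simp [nodeAt, nodeAt_leaf]

theorem depth_nodeAt_le {t : Tree X Y} {n : ℕ} (h : t.depth ≤ n + 1) (b : Bool) :
    (t.nodeAt [b]).depth ≤ n := by
  cases t <;> cases b <;> simp_all [nodeAt, depth]

theorem beliefGap_nonneg (t : Tree X Y) (A B : List Bool → ℝ) (x : X) (y : Y) :
    0 ≤ t.beliefGap A B x y := by
  induction t generalizing A B with
  | leaf => exact le_rfl
  | alice p t₀ t₁ h₀ h₁ =>
    have := (p x).2.1
    have := sub_nonneg.2 (p x).2.2
    have := h₀ (fun h => A (false :: h)) (fun h => B (false :: h))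
    have := h₁ (fun h => A (true :: h)) (fun h => B (true :: h))
    simp only [beliefGap]; positivity
  | bob p t₀ t₁ h₀ h₁ =>
    have := (p y).2.1
    have := sub_nonneg.2 (p y).2.2
    have := h₀ (fun h => A (false :: h)) (fun h => B (false :: h))
    have := h₁ (fun h => A (true :: h)) (fun h => B (true :: h))
    simp only [beliefGap]; positivity

/-- The beliefs drop out: at each node the joint table consults only the owner, who uses the true
probability. -/
theorem jointTable_thr (t : Tree X Y) (A B : List Bool → ℝ) (x : X) (y : Y) (ρ : ℕ → ℝ) :
    jointTable (fun h => (t.nodeAt h).isAlice) (thr (t.aliceTable A x) ρ)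
      (thr (t.bobTable B y) ρ) = thr (fun h => (t.nodeAt h).bias x y) ρ := by
  funext h
  have key : ∀ s : Tree X Y, (if s.isAlice then decide (ρ h.length < s.aliceProb x (A h))
      else decide (ρ h.length < s.bobProb y (B h))) = decide (ρ h.length < s.bias x y) := by
    intro s
    cases s <;> rfl
  exact key _

/-- The walk always has `n` bits; those sent after a leaf carry no meaning and are cut off. -/
theorem trunc_walk {t : Tree X Y} {n : ℕ} (h : t.depth ≤ n) (x : X) (y : Y) (ρ : ℕ → ℝ) :
    t.trunc (walk (thr (fun h => (t.nodeAt h).bias x y) ρ) n) = t.leafPath x y ρ := by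
  induction n generalizing t ρ with
  | zero => cases t <;> simp_all [depth, walk, trunc, leafPath]
  | succ n ih =>
    have key : ∀ b : Bool, (t.nodeAt [b]).trunc (walk (fun h =>
        thr (fun h => (t.nodeAt h).bias x y) ρ (b :: h)) n) =
        (t.nodeAt [b]).leafPath x y (fun i => ρ (i + 1)) := by
      intro b
      rw [← ih (depth_nodeAt_le h b)]
      congr 2
      funext h
      simp only [thr, List.length_cons, nodeAt_cons t b h]
    rw [walk_succ_eq_cons]
    simp only [trunc, key]
    cases t with
    | leaf => simp [owner, leafPath]
    | alice p t₀ t₁ => by_cases hp : ρ 0 < p x <;> simp [owner, leafPath, thr, bias, nodeAt, hp]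
    | bob p t₀ t₁ => by_cases hp : ρ 0 < p y <;> simp [owner, leafPath, thr, bias, nodeAt, hp]

end Tree

theorem card_mistakes_succ (n : ℕ) (own a b : List Bool → Bool) :
    (mistakes (n + 1) own a b).card = (if a [] = b [] then 0 else 1) +
      (mistakes n (fun h => own (jointTable own a b [] :: h))
        (fun h => a (jointTable own a b [] :: h)) (fun h => b (jointTable own a b [] :: h))).card := by
  simp only [mistakes, Finset.card_filter, Finset.sum_range_succ']
  rw [add_comm]
  congr 1
  · simp only [walk]
    split_ifs <;> simp_all
  · simp only [walk_succ_eq_cons]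
    rfl

/-! ### The randomness of the thresholds -/

/-- Finitely many points of the unit interval, extended to an infinite sequence. -/
def thresholds {n : ℕ} (ρ : Fin n → unitInterval) (i : ℕ) : ℝ := if h : i < n then ρ ⟨i, h⟩ else 1

theorem thresholds_cons_zero {n : ℕ} (c : unitInterval) (ρ : Fin n → unitInterval) :
    thresholds (Fin.cons c ρ : Fin (n + 1) → unitInterval) 0 = c := by
  simp [thresholds]

theorem thresholds_cons_succ {n : ℕ} (c : unitInterval) (ρ : Fin n → unitInterval) (i : ℕ) :
    thresholds (Fin.cons c ρ : Fin (n + 1) → unitInterval) (i + 1) = thresholds ρ i := by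
  by_cases h : i < n
  · simp only [thresholds, h, dif_pos, Nat.succ_lt_succ h]
    exact congrArg Subtype.val (Fin.cons_succ (α := fun _ => unitInterval) c ρ ⟨i, h⟩)
  · simp [thresholds, h]

theorem measurable_thresholds (n i : ℕ) :
    Measurable fun ρ : Fin n → unitInterval => thresholds ρ i := by
  simp only [thresholds]
  split_ifs
  · exact measurable_subtype_coe.comp (measurable_pi_apply _)
  · exact measurable_const

theorem measurable_thr {Ω : Type*} [MeasurableSpace Ω] {α : Ω → List Bool → ℝ} {ρ : Ω → ℕ → ℝ}
    (hα : ∀ h, Measurable fun ω => α ω h) (hρ : ∀ i, Measurable fun ω => ρ ω i) (h : List Bool) :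
    Measurable fun ω => thr (α ω) (ρ ω) h := by
  refine measurable_to_bool ?_
  have : (fun ω => thr (α ω) (ρ ω) h) ⁻¹' {true} = {ω | ρ ω h.length < α ω h} := by
    ext ω; simp [thr]
  rw [this]
  exact measurableSet_lt (hρ _) (hα h)

theorem lintegral_fin_succ {n : ℕ} {F : (Fin (n + 1) → unitInterval) → ENNReal}
    (hF : Measurable F) : ∫⁻ ρ, F ρ = ∫⁻ c, ∫⁻ ρ, F (Fin.cons c ρ) := by
  have h := (volume_preserving_piFinSuccAbove (fun _ : Fin (n + 1) => unitInterval) 0).symm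
  rw [← h.lintegral_comp hF, Measure.volume_eq_prod, lintegral_prod]
  · simp_rw [MeasurableEquiv.piFinSuccAbove_symm_apply, Fin.insertNthEquiv, Equiv.coe_fn_mk,
      Fin.insertNth_zero]
    rfl
  · exact (hF.comp (MeasurableEquiv.measurable _)).aemeasurable

theorem lintegral_ite_lt (p : unitInterval) (c₁ c₀ : ENNReal) :
    ∫⁻ c : unitInterval, (if (c : ℝ) < p then c₁ else c₀) =
      ENNReal.ofReal p * c₁ + ENNReal.ofReal (1 - p) * c₀ := by
  have h : (fun c : unitInterval => if (c : ℝ) < p then c₁ else c₀) = fun c =>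
      (Set.Iio p).indicator (fun _ => c₁) c + (Set.Ici p).indicator (fun _ => c₀) c := by
    funext c
    by_cases hc : c < p
    · have : (c : ℝ) < p := hc
      simp [hc, this]
    · have h2 : ¬ (c : ℝ) < p := hc
      rw [if_neg h2]
      simp [hc, not_lt.1 hc]
  rw [h, lintegral_add_left (measurable_const.indicator measurableSet_Iio),
    lintegral_indicator_const measurableSet_Iio, lintegral_indicator_const measurableSet_Ici,
    unitInterval.volume_Iio, unitInterval.volume_Ici, mul_comm, mul_comm c₀]

/-- Two comparisons with a common threshold disagree only if it falls between `p` and `q`. The bound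
is not an equality since `p` and `q` need not lie in the unit interval. -/
theorem lintegral_threshold_ne_le (p q : ℝ) :
    ∫⁻ c : unitInterval, (if decide ((c : ℝ) < p) = decide ((c : ℝ) < q) then (0 : ENNReal) else 1) ≤
      ENNReal.ofReal |p - q| := by
  calc _ ≤ ∫⁻ c : unitInterval, ((Subtype.val ⁻¹' Set.Ico (min p q) (max p q) :
        Set unitInterval).indicator (fun _ => 1) c) := by
        refine lintegral_mono fun c => ?_
        split_ifs with h
        · exact zero_le
        · rw [Set.indicator_of_mem]
          rw [Set.mem_preimage, Set.mem_Ico, min_le_iff, lt_max_iff]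
          by_cases h1 : (c : ℝ) < p <;> by_cases h2 : (c : ℝ) < q <;> simp_all
    _ ≤ _ := by
        rw [lintegral_indicator_const (measurable_subtype_coe measurableSet_Ico), one_mul,
          unitInterval.volume_apply]
        refine (measure_mono (Set.image_preimage_subset _ _)).trans ?_
        rw [Real.volume_Ico, max_sub_min_eq_abs, abs_sub_comm]

theorem measurable_leafPath (t : Tree X Y) (x : X) (y : Y) {Ω : Type*} [MeasurableSpace Ω]
    {ρ : Ω → ℕ → ℝ} (hρ : ∀ i, Measurable fun ω => ρ ω i) :
    Measurable fun ω => t.leafPath x y (ρ ω) := by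
  have hc : ∀ b : Bool, Measurable fun l : List Bool => b :: l := fun b => Measurable.of_discrete
  induction t generalizing ρ with
  | leaf => exact measurable_const
  | alice p t₀ t₁ h₀ h₁ =>
    exact Measurable.ite (measurableSet_lt (hρ 0) measurable_const)
      ((hc true).comp (h₁ fun i => hρ (i + 1))) ((hc false).comp (h₀ fun i => hρ (i + 1)))
  | bob p t₀ t₁ h₀ h₁ =>
    exact Measurable.ite (measurableSet_lt (hρ 0) measurable_const)
      ((hc true).comp (h₁ fun i => hρ (i + 1))) ((hc false).comp (h₀ fun i => hρ (i + 1)))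

theorem toMeasure_node (p : unitInterval) (f : Bool → PMF (List Bool)) (S : Set (List Bool)) :
    ((Tree.bitLaw p).bind fun b => (f b).map (List.cons b)).toMeasure S =
      ENNReal.ofReal p * (f true).toMeasure (List.cons true ⁻¹' S) +
        ENNReal.ofReal (1 - p) * (f false).toMeasure (List.cons false ⁻¹' S) := by
  have hc : ∀ b : Bool, Measurable fun l : List Bool => b :: l := fun b => Measurable.of_discrete
  rw [PMF.toMeasure_bind_apply _ _ _ MeasurableSet.of_discrete, tsum_bool, add_comm]
  simp only [PMF.toMeasure_map_apply _ _ _ (hc _) MeasurableSet.of_discrete, Tree.bitLaw,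
    PMF.ofFintype_apply]
  simp

theorem lintegral_threshold_node {n : ℕ} (p : unitInterval) {G₁ G₀ : (ℕ → ℝ) → ENNReal}
    (h₁ : Measurable G₁) (h₀ : Measurable G₀) :
    ∫⁻ ρ : Fin (n + 1) → unitInterval, (if thresholds ρ 0 < p then
        G₁ (fun i => thresholds ρ (i + 1)) else G₀ (fun i => thresholds ρ (i + 1))) =
      ENNReal.ofReal p * (∫⁻ ρ : Fin n → unitInterval, G₁ (thresholds ρ)) +
        ENNReal.ofReal (1 - p) * (∫⁻ ρ : Fin n → unitInterval, G₀ (thresholds ρ)) := by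
  have hs : Measurable fun ρ : Fin (n + 1) → unitInterval => fun i => thresholds ρ (i + 1) :=
    measurable_pi_lambda _ fun i => measurable_thresholds (n + 1) (i + 1)
  refine (lintegral_fin_succ (Measurable.ite (measurableSet_lt (measurable_thresholds (n + 1) 0)
    measurable_const) (h₁.comp hs) (h₀.comp hs))).trans ?_
  rw [← lintegral_ite_lt]
  refine lintegral_congr fun c => ?_
  simp only [thresholds_cons_zero, Function.comp_def, thresholds_cons_succ]
  split_ifs <;> rfl

/-- With independent uniform thresholds the leaf that is reached has the law of the protocol. -/
theorem lintegral_leafPath {t : Tree X Y} {n : ℕ} (h : t.depth ≤ n) (x : X) (y : Y)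
    (S : Set (List Bool)) :
    ∫⁻ ρ : Fin n → unitInterval, S.indicator (fun _ => (1 : ENNReal))
      (t.leafPath x y (thresholds ρ)) = (t.law x y).toMeasure S := by
  -- The owner plays no role here, so one argument serves both kinds of inner nodes: integrate over
  -- the first threshold, which is independent of those used in the subtree.
  have node : ∀ (p : unitInterval) (t₀ t₁ : Tree X Y) (n : ℕ),
      (∀ S : Set (List Bool), ∫⁻ ρ : Fin n → unitInterval, S.indicator (fun _ => (1 : ENNReal))
        (t₀.leafPath x y (thresholds ρ)) = (t₀.law x y).toMeasure S) →
      (∀ S : Set (List Bool), ∫⁻ ρ : Fin n → unitInterval, S.indicator (fun _ => (1 : ENNReal))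
        (t₁.leafPath x y (thresholds ρ)) = (t₁.law x y).toMeasure S) →
      ∀ S : Set (List Bool),
      ∫⁻ ρ : Fin (n + 1) → unitInterval, S.indicator (fun _ => (1 : ENNReal))
          (if thresholds ρ 0 < p then
            true :: t₁.leafPath x y (fun i => thresholds ρ (i + 1)) else
            false :: t₀.leafPath x y (fun i => thresholds ρ (i + 1))) =
        ((Tree.bitLaw p).bind fun b => (if b then t₁.law x y else t₀.law x y).map
          (List.cons b)).toMeasure S := by
    intro p t₀ t₁ n h₀ h₁ S
    have hm : ∀ (t : Tree X Y) (b : Bool), Measurable fun ρ : ℕ → ℝ =>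
        S.indicator (fun _ => (1 : ENNReal)) (b :: t.leafPath x y ρ) := fun t b =>
      (Measurable.of_discrete (f := fun l : List Bool =>
        S.indicator (fun _ => (1 : ENNReal)) (b :: l))).comp
        (measurable_leafPath t x y fun i => measurable_pi_apply i)
    rw [toMeasure_node p fun b => if b then t₁.law x y else t₀.law x y]
    simp only [if_true, Bool.false_eq_true, if_false]
    rw [← h₀, ← h₁]
    refine Eq.trans (lintegral_congr fun ρ => ?_)
      (lintegral_threshold_node p (hm t₁ true) (hm t₀ false))
    split_ifs <;> rfl
  induction t generalizing n S with
  | leaf =>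
    have : (PMF.pure ([] : List Bool)).toMeasure S = S.indicator (fun _ => (1 : ENNReal)) [] :=
      (PMF.toMeasure_pure_apply _ _ MeasurableSet.of_discrete).trans (by
        by_cases hS : [] ∈ S <;> simp [hS])
    rw [Tree.law, this]
    simp only [Tree.leafPath]
    rw [lintegral_const, measure_univ, mul_one]
  | alice p t₀ t₁ h₀ h₁ =>
    obtain ⟨n, rfl⟩ : ∃ m, n = m + 1 := ⟨n - 1, by simp only [Tree.depth] at h; omega⟩
    simp only [Tree.depth, Nat.add_le_add_iff_right, max_le_iff] at h
    exact node _ _ _ _ (h₀ h.1) (h₁ h.2) S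
  | bob p t₀ t₁ h₀ h₁ =>
    obtain ⟨n, rfl⟩ : ∃ m, n = m + 1 := ⟨n - 1, by simp only [Tree.depth] at h; omega⟩
    simp only [Tree.depth, Nat.add_le_add_iff_right, max_le_iff] at h
    exact node _ _ _ _ (h₀ h.1) (h₁ h.2) S

/-- The number of mistakes when the tree is run with the thresholds `ρ`. -/
def numMistakes (n : ℕ) (t : Tree X Y) (A B : List Bool → ℝ) (x : X) (y : Y) (ρ : ℕ → ℝ) : ℕ :=
  (mistakes n (fun h => (t.nodeAt h).isAlice) (thr (t.aliceTable A x) ρ)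
    (thr (t.bobTable B y) ρ)).card

theorem numMistakes_leaf (n : ℕ) (A B : List Bool → ℝ) (x : X) (y : Y) (ρ : ℕ → ℝ) :
    numMistakes n (Tree.leaf : Tree X Y) A B x y ρ = 0 := by
  simp [numMistakes, mistakes, thr, Tree.aliceTable, Tree.bobTable, nodeAt_leaf, Tree.aliceProb,
    Tree.bobProb]

/-- The path continues with the owner's bit whether or not the other player guessed it, so a mistake
does not affect the subtree reached. Only one node per level is visited, hence one threshold per
level is enough. -/
theorem numMistakes_succ (n : ℕ) (t : Tree X Y) (A B : List Bool → ℝ) (x : X) (y : Y)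
    (ρ : ℕ → ℝ) :
    numMistakes (n + 1) t A B x y ρ =
      (if decide (ρ 0 < t.aliceProb x (A [])) = decide (ρ 0 < t.bobProb y (B [])) then 0 else 1) +
      if ρ 0 < t.bias x y then
        numMistakes n (t.nodeAt [true]) (fun h => A (true :: h)) (fun h => B (true :: h)) x y
          (fun i => ρ (i + 1))
      else
        numMistakes n (t.nodeAt [false]) (fun h => A (false :: h)) (fun h => B (false :: h)) x y
          (fun i => ρ (i + 1)) := by
  rw [numMistakes, card_mistakes_succ, Tree.jointTable_thr]
  congr 1
  · cases t <;> rfl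
  · have key : ∀ b : Bool, (mistakes n (fun h => (t.nodeAt (b :: h)).isAlice)
        (fun h => thr (t.aliceTable A x) ρ (b :: h))
        (fun h => thr (t.bobTable B y) ρ (b :: h))).card =
        numMistakes n (t.nodeAt [b]) (fun h => A (b :: h)) (fun h => B (b :: h)) x y
          (fun i => ρ (i + 1)) := by
      intro b
      simp only [numMistakes]
      congr 2
      · funext h; rw [t.nodeAt_cons]
      · funext h
        exact decide_eq_decide.2 (by rw [Tree.aliceTable, t.nodeAt_cons b h]; rfl)
      · funext h
        exact decide_eq_decide.2 (by rw [Tree.bobTable, t.nodeAt_cons b h]; rfl)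
    have hb : thr (fun h => (t.nodeAt h).bias x y) ρ [] = decide (ρ 0 < t.bias x y) := by
      cases t <;> rfl
    rw [hb, key]
    split_ifs with h <;> simp [h]

theorem measurable_numMistakes {Ω : Type*} [MeasurableSpace Ω] (n : ℕ) (t : Tree X Y)
    (A B : List Bool → ℝ) (x : X) (y : Y) :
    Measurable fun ρ : ℕ → ℝ => numMistakes n t A B x y ρ :=
  measurable_card_mistakes n (fun _ => measurable_const)
    (measurable_thr (fun _ => measurable_const) fun i => measurable_pi_apply i)
    (measurable_thr (fun _ => measurable_const) fun i => measurable_pi_apply i)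

/-- The expected number of mistakes is at most the belief gap. -/
theorem lintegral_numMistakes_le (n : ℕ) (t : Tree X Y) (A B : List Bool → ℝ) (x : X) (y : Y) :
    ∫⁻ ρ : Fin n → unitInterval, (numMistakes n t A B x y (thresholds ρ) : ENNReal) ≤
      ENNReal.ofReal (t.beliefGap A B x y) := by
  induction n generalizing t A B with
  | zero => simp [numMistakes, mistakes]
  | succ n ih =>
    have hG : ∀ b : Bool, Measurable fun ρ : ℕ → ℝ => (numMistakes n (t.nodeAt [b])
        (fun h => A (b :: h)) (fun h => B (b :: h)) x y ρ : ENNReal) := fun b =>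
      (Measurable.of_discrete (f := fun k : ℕ => (k : ENNReal))).comp
        (measurable_numMistakes (Ω := ℕ) n _ _ _ x y)
    -- The first threshold accounts for the disagreement at the root and chooses the subtree; the
    -- other `n` are independent of it and are left to the induction.
    have node : ∀ p : unitInterval, t.bias x y = p →
        ∫⁻ ρ : Fin (n + 1) → unitInterval,
          (numMistakes (n + 1) t A B x y (thresholds ρ) : ENNReal) ≤
        ENNReal.ofReal (|t.aliceProb x (A []) - t.bobProb y (B [])| +
          (p * (t.nodeAt [true]).beliefGap (fun h => A (true :: h)) (fun h => B (true :: h)) x y +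
          (1 - p) * (t.nodeAt [false]).beliefGap (fun h => A (false :: h))
            (fun h => B (false :: h)) x y)) := by
      intro p hp
      have hp0 := p.2.1
      have hp1 := sub_nonneg.2 p.2.2
      have hn := fun b : Bool => (t.nodeAt [b]).beliefGap_nonneg (fun h => A (b :: h))
        (fun h => B (b :: h)) x y
      rw [ENNReal.ofReal_add (abs_nonneg _) (add_nonneg (mul_nonneg hp0 (hn _))
        (mul_nonneg hp1 (hn _))), ENNReal.ofReal_add (mul_nonneg hp0 (hn _))
        (mul_nonneg hp1 (hn _)), ENNReal.ofReal_mul hp0, ENNReal.ofReal_mul hp1]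
      simp only [numMistakes_succ, hp, Nat.cast_add, Nat.cast_ite, Nat.cast_zero, Nat.cast_one]
      have hmeas : Measurable fun ρ : Fin (n + 1) → unitInterval =>
          (if decide (thresholds ρ 0 < t.aliceProb x (A [])) =
            decide (thresholds ρ 0 < t.bobProb y (B [])) then (0 : ENNReal) else 1) := by
        have h1 := fun q : ℝ => measurable_thr (Ω := Fin (n + 1) → unitInterval)
          (α := fun _ _ => q) (ρ := thresholds) (fun _ => measurable_const)
          (measurable_thresholds (n + 1)) []
        exact (Measurable.of_discrete (f := fun b : Bool × Bool =>
          if b.1 = b.2 then (0 : ENNReal) else 1)).comp ((h1 _).prodMk (h1 _))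
      rw [lintegral_add_left hmeas, lintegral_threshold_node p (hG true) (hG false)]
      gcongr
      · rw [lintegral_fin_succ hmeas]
        simp only [thresholds_cons_zero, lintegral_const, measure_univ, mul_one]
        exact lintegral_threshold_ne_le _ _
      · exact ih _ _ _
      · exact ih _ _ _
    cases t with
    | leaf => simp [numMistakes_leaf]
    | alice p t₀ t₁ => simpa [Tree.aliceProb, Tree.bobProb, Tree.nodeAt, Tree.beliefGap] using node (p x) rfl
    | bob p t₀ t₁ => simpa [Tree.aliceProb, Tree.bobProb, Tree.nodeAt, Tree.beliefGap] using node (p y) rfl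

end Thresholds

/-! ### Measurable families of protocol trees -/

section Families

variable {X : Type u} {Y : Type v} {Ω : Type*} [MeasurableSpace Ω]

/-- A family of protocol trees whose owners and transition probabilities are measurable. -/
structure MeasurableTree (t : Ω → Tree X Y) : Prop where
  owner : ∀ (h : List Bool) (o : Option Player), MeasurableSet {ω | ((t ω).nodeAt h).owner = o}
  bias : ∀ (h : List Bool) (x : X) (y : Y), Measurable fun ω => ((t ω).nodeAt h).bias x y

theorem Protocol.measurableTree (π : Protocol.{u, v, w} X Y) : MeasurableTree π.tree :=
  ⟨π.measurable_owner, π.measurable_bias⟩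

theorem MeasurableTree.comp {Ω' : Type*} [MeasurableSpace Ω'] {t : Ω → Tree X Y}
    (ht : MeasurableTree t) {f : Ω' → Ω} (hf : Measurable f) : MeasurableTree fun ω => t (f ω) :=
  ⟨fun h o => hf (ht.owner h o), fun h x y => (ht.bias h x y).comp hf⟩

theorem MeasurableTree.nodeAt {t : Ω → Tree X Y} (ht : MeasurableTree t) (b : Bool) :
    MeasurableTree fun ω => (t ω).nodeAt [b] :=
  ⟨fun h o => by simpa only [← Tree.nodeAt_cons] using ht.owner (b :: h) o,
    fun h x y => by simpa only [← Tree.nodeAt_cons] using ht.bias (b :: h) x y⟩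

theorem MeasurableTree.owner_root {t : Ω → Tree X Y} (ht : MeasurableTree t) (o : Option Player) :
    MeasurableSet {ω | (t ω).owner = o} := by
  have : ∀ s : Tree X Y, s.nodeAt [] = s := fun s => by cases s <;> rfl
  simpa only [this] using ht.owner [] o

theorem MeasurableTree.bias_root {t : Ω → Tree X Y} (ht : MeasurableTree t) (x : X) (y : Y) :
    Measurable fun ω => (t ω).bias x y := by
  have : ∀ s : Tree X Y, s.nodeAt [] = s := fun s => by cases s <;> rfl
  simpa only [this] using ht.bias [] x y

theorem Tree.isAlice_eq_true_iff (t : Tree X Y) : t.isAlice = true ↔ t.owner = some .alice := by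
  cases t <;> simp [Tree.isAlice, Tree.owner]

theorem MeasurableTree.isAlice {t : Ω → Tree X Y} (ht : MeasurableTree t) (h : List Bool) :
    Measurable fun ω => ((t ω).nodeAt h).isAlice := by
  refine measurable_to_bool ?_
  convert ht.owner h (some .alice) using 1
  ext ω
  exact Tree.isAlice_eq_true_iff _

/-- Measurability in the public randomness is given only for the bias. At Alice's nodes it does not
depend on `y`, so an arbitrary `y` extracts her probability. -/
theorem MeasurableTree.aliceTable [Nonempty Y] {t : Ω → Tree X Y} (ht : MeasurableTree t)
    {A : Ω → List Bool → ℝ} (hA : ∀ h, Measurable fun ω => A ω h) (x : X) (h : List Bool) :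
    Measurable fun ω => (t ω).aliceTable (A ω) x h := by
  classical
  have : (fun ω => (t ω).aliceTable (A ω) x h) = fun ω =>
      if ((t ω).nodeAt h).owner = some .bob then A ω h
      else ((t ω).nodeAt h).bias x (Classical.arbitrary Y) *
        if ((t ω).nodeAt h).owner = some .alice then 1 else 0 := by
    funext ω
    simp only [Tree.aliceTable]
    cases (t ω).nodeAt h <;> simp [Tree.aliceProb, Tree.owner, Tree.bias]
  rw [this]
  exact Measurable.ite (ht.owner h _) (hA h) ((ht.bias h _ _).mul
    (Measurable.ite (ht.owner h _) measurable_const measurable_const))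

theorem MeasurableTree.bobTable [Nonempty X] {t : Ω → Tree X Y} (ht : MeasurableTree t)
    {B : Ω → List Bool → ℝ} (hB : ∀ h, Measurable fun ω => B ω h) (y : Y) (h : List Bool) :
    Measurable fun ω => (t ω).bobTable (B ω) y h := by
  classical
  have : (fun ω => (t ω).bobTable (B ω) y h) = fun ω =>
      if ((t ω).nodeAt h).owner = some .alice then B ω h
      else ((t ω).nodeAt h).bias (Classical.arbitrary X) y *
        if ((t ω).nodeAt h).owner = some .bob then 1 else 0 := by
    funext ω
    simp only [Tree.bobTable]
    cases (t ω).nodeAt h <;> simp [Tree.bobProb, Tree.owner, Tree.bias]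
  rw [this]
  exact Measurable.ite (ht.owner h _) (hB h) ((ht.bias h _ _).mul
    (Measurable.ite (ht.owner h _) measurable_const measurable_const))

theorem MeasurableTree.trunc {t : Ω → Tree X Y} (ht : MeasurableTree t) (l : List Bool) :
    Measurable fun ω => (t ω).trunc l := by
  induction l generalizing t with
  | nil => simpa only [Tree.trunc] using measurable_const
  | cons b l ih =>
    simp only [Tree.trunc, Option.isNone_iff_eq_none]
    exact Measurable.ite (ht.owner_root none) measurable_const
      ((Measurable.of_discrete (f := fun l : List Bool => b :: l)).comp (ih (ht.nodeAt b)))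

end Families

/-! ### Total variation distance and laws of transcripts -/

/-- Coupling: both laws are images of one measure under maps that agree off `S`. -/
theorem tvDist_map_le {Ω α : Type*} [MeasurableSpace Ω] [MeasurableSpace α] (κ : Measure Ω)
    [IsFiniteMeasure κ] {F G : Ω → α} (hF : Measurable F) (hG : Measurable G) {S : Set Ω}
    (h : ∀ ω, ω ∉ S → F ω = G ω) : tvDist (κ.map F) (κ.map G) ≤ κ.real S := by
  have key : ∀ {F G : Ω → α}, (∀ ω, ω ∉ S → F ω = G ω) → ∀ A : Set α,
      κ.real (F ⁻¹' A) ≤ κ.real (G ⁻¹' A) + κ.real S := by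
    intro F G h A
    refine (measureReal_mono (s₂ := G ⁻¹' A ∪ S) fun ω hω => ?_).trans (measureReal_union_le _ _)
    by_cases hS : ω ∈ S
    · exact Or.inr hS
    · exact Or.inl (by rw [Set.mem_preimage, ← h ω hS]; exact hω)
  have : Nonempty {S : Set α // MeasurableSet S} := ⟨⟨∅, MeasurableSet.empty⟩⟩
  refine ciSup_le fun A => ?_
  rw [map_measureReal_apply hF A.2, map_measureReal_apply hG A.2, abs_le]
  have h1 := key h A.1
  have h2 := key (fun ω hω => (h ω hω).symm) A.1
  constructor <;> linarith

theorem tvDist_nonneg {α : Type*} [MeasurableSpace α] (P Q : Measure α) : 0 ≤ tvDist P Q :=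
  Real.iSup_nonneg fun _ => abs_nonneg _

theorem tvDist_self {α : Type*} [MeasurableSpace α] (P : Measure α) : tvDist P P = 0 := by
  simp [tvDist]

namespace Protocol

variable {X : Type u} {Y : Type v}

theorem simulates_self (π : Protocol.{u, v, w} X Y) (μ : PMF (X × Y)) {ε : ℝ} (hε : 0 ≤ ε) :
    π.Simulates π μ ε :=
  ⟨fun _ t => t, fun _ t => t, fun _ => measurable_id, fun _ => measurable_id, by
    simpa [tvDist_self] using hε⟩

/-- If every transcript is a function `m` of the public randomness, then its law is an image of
the law of the public randomness. -/
theorem transcriptLaw_eq_map (τ : Protocol.{u, v, w} X Y) (x : X) (y : Y) {m : τ.Pub → List Bool}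
    (hm : Measurable m) (h : ∀ r, (τ.tree r).law x y = PMF.pure (m r)) :
    τ.transcriptLaw x y = τ.coin.map fun r => (r, m r) := by
  have : (fun r => (((τ.tree r).law x y).map (Prod.mk r)).toMeasure) =
      fun r => Measure.dirac (r, m r) := by
    funext r
    rw [h, PMF.pure_map, PMF.toMeasure_pure]
  rw [transcriptLaw, this]
  exact Measure.bind_dirac_eq_map _ (measurable_id.prodMk hm)

variable (π : Protocol.{u, v, w} X Y) (n : ℕ)

/-- The law of the public randomness together with independent uniform thresholds. -/
def thresholdLaw : Measure (π.Pub × (Fin n → unitInterval)) := π.coin.prod volume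

instance : IsProbabilityMeasure (π.thresholdLaw n) := by
  unfold thresholdLaw; infer_instance

variable {π n}

theorem measurable_thresholds_snd (i : ℕ) :
    Measurable fun ω : π.Pub × (Fin n → unitInterval) => thresholds ω.2 i :=
  (measurable_thresholds n i).comp measurable_snd

theorem measurable_leafPath_tree (h : ∀ r, (π.tree r).depth ≤ n) (x : X) (y : Y) :
    Measurable fun ω : π.Pub × (Fin n → unitInterval) =>
      (π.tree ω.1).leafPath x y (thresholds ω.2) := by
  simp only [← Tree.trunc_walk (h _)]
  have ht : MeasurableTree fun ω : π.Pub × (Fin n → unitInterval) => π.tree ω.1 :=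
    π.measurableTree.comp measurable_fst
  exact Measurable.apply_countable ht.trunc
    (measurable_walk (measurable_thr (fun h => ht.bias h x y) measurable_thresholds_snd) n)

/-- The law of the transcript, in terms of thresholds. -/
theorem transcriptLaw_eq_thresholdLaw (h : ∀ r, (π.tree r).depth ≤ n) (x : X) (y : Y) :
    π.transcriptLaw x y = (π.thresholdLaw n).map fun ω =>
      (ω.1, (π.tree ω.1).leafPath x y (thresholds ω.2)) := by
  have hm := measurable_leafPath_tree h x y
  have hp := measurable_fst.prodMk hm
  have key : ∀ (S : Set π.Transcript), MeasurableSet S → ∀ r,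
      (((π.tree r).law x y).map (Prod.mk r)).toMeasure S =
        volume (Prod.mk r ⁻¹' ((fun ω : π.Pub × (Fin n → unitInterval) =>
          (ω.1, (π.tree ω.1).leafPath x y (thresholds ω.2))) ⁻¹' S)) := by
    intro S hS r
    rw [PMF.toMeasure_map_apply _ _ _ measurable_prodMk_left hS, ← lintegral_leafPath (h r),
      ← lintegral_indicator_one (measurable_prodMk_left (hp hS))]
    rfl
  ext S hS
  rw [Measure.map_apply hp hS, thresholdLaw, Measure.prod_apply (hp hS), transcriptLaw,
    Measure.bind_apply hS]
  · exact lintegral_congr fun r => key S hS r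
  · refine (Measure.measurable_of_measurable_coe _ fun S hS => ?_).aemeasurable
    simp only [key S hS]
    exact measurable_measure_prodMk_left (hp hS)

end Protocol

namespace Protocol

variable {X : Type u} {Y : Type v}

/-! ### The simulating protocol -/

section Simulation

variable (π : Protocol.{u, v, w} X Y) (n : ℕ) (A : π.Pub → X → List Bool → ℝ)
  (B : π.Pub → Y → List Bool → ℝ)

/-- The owners of the nodes. -/
def ownTable (ω : π.Pub × (Fin n → unitInterval)) (h : List Bool) : Bool :=
  ((π.tree ω.1).nodeAt h).isAlice

/-- Alice's guesses of all bits. -/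
def aliceGuess (x : X) (ω : π.Pub × (Fin n → unitInterval)) : List Bool → Bool :=
  thr ((π.tree ω.1).aliceTable (A ω.1 x) x) (thresholds ω.2)

/-- Bob's guesses of all bits. -/
def bobGuess (y : Y) (ω : π.Pub × (Fin n → unitInterval)) : List Bool → Bool :=
  thr ((π.tree ω.1).bobTable (B ω.1 y) y) (thresholds ω.2)

/-- The event that the given rounds do not find all mistakes. -/
def failure (ops : List (Option (Coin n))) (x : X) (y : Y) :
    Set (π.Pub × (Fin n → unitInterval)) :=
  {ω | finalFixes ops (π.ownTable n ω) (π.aliceGuess n A x ω) (π.bobGuess n B y ω) =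
    mistakes n (π.ownTable n ω) (π.aliceGuess n A x ω) (π.bobGuess n B y ω)}ᶜ

/-- The transcript of `π` that a player with the given guesses computes. -/
def output (own a : List Bool → Bool) (ops : List (Option (Coin n)))
    (t : (π.Pub × (Fin n → unitInterval)) × List Bool) : π.Transcript :=
  (t.1.1, (π.tree t.1.1).trunc (walk (corrected own a (replay ops (SimState.init n) t.2).1) n))

variable {π n A B}

theorem measurable_ownTable (h : List Bool) : Measurable fun ω => π.ownTable n ω h :=
  (π.measurableTree.comp measurable_fst).isAlice h

theorem measurable_aliceGuess [Nonempty Y] (hA : ∀ x h, Measurable fun r => A r x h) (x : X)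
    (h : List Bool) : Measurable fun ω => π.aliceGuess n A x ω h :=
  measurable_thr ((π.measurableTree.comp measurable_fst).aliceTable
    (fun h => (hA x h).comp measurable_fst) x) measurable_thresholds_snd h

theorem measurable_bobGuess [Nonempty X] (hB : ∀ y h, Measurable fun r => B r y h) (y : Y)
    (h : List Bool) : Measurable fun ω => π.bobGuess n B y ω h :=
  measurable_thr ((π.measurableTree.comp measurable_fst).bobTable
    (fun h => (hB y h).comp measurable_fst) y) measurable_thresholds_snd h

theorem measurable_output {own a : π.Pub × (Fin n → unitInterval) → List Bool → Bool}
    (ho : ∀ h, Measurable fun ω => own ω h) (ha : ∀ h, Measurable fun ω => a ω h)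
    (ops : List (Option (Coin n))) :
    Measurable fun t : (π.Pub × (Fin n → unitInterval)) × List Bool =>
      π.output n (own t.1) (a t.1) ops t := by
  refine measurable_from_prod_countable_left fun m => measurable_fst.prodMk ?_
  exact Measurable.apply_countable
    (f := fun (ω : π.Pub × (Fin n → unitInterval)) l => (π.tree ω.1).trunc l)
    (g := fun ω => walk (corrected (own ω) (a ω) (replay ops (SimState.init n) m).1) n)
    (π.measurableTree.comp measurable_fst).trunc
    (measurable_walk (measurable_corrected ho ha _) n)

variable (π n A B) in
/-- The protocol that runs the given rounds. -/
def simulation [Nonempty X] [Nonempty Y] (hA : ∀ x h, Measurable fun r => A r x h)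
    (hB : ∀ y h, Measurable fun r => B r y h) (ops : List (Option (Coin n))) :
    Protocol.{u, v, w} X Y where
  Pub := π.Pub × (Fin n → unitInterval)
  coin := π.thresholdLaw n
  tree ω := roundTree (fun x => correctedBits (π.ownTable n ω) (π.aliceGuess n A x ω))
    (fun y => correctedBits (fun h => !π.ownTable n ω h) (π.bobGuess n B y ω)) ops
    (SimState.init n)
  measurable_owner h o := by
    obtain ⟨o', ho⟩ := (roundTree_measurable
      (fun x => measurable_correctedBits measurable_ownTable (measurable_aliceGuess hA x))
      (fun y => measurable_correctedBits (measurable_not_own measurable_ownTable)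
        (measurable_bobGuess hB y)) ops (SimState.init n) h).1
    exact (MeasurableSet.const (o' = o)).congr (Set.ext fun ω =>
      ⟨fun h' => (ho ω).trans h', fun h' => (ho ω).symm.trans h'⟩)
  measurable_bias h := (roundTree_measurable
      (fun x => measurable_correctedBits measurable_ownTable (measurable_aliceGuess hA x))
      (fun y => measurable_correctedBits (measurable_not_own measurable_ownTable)
        (measurable_bobGuess hB y)) ops (SimState.init n) h).2

theorem comm_simulation [Nonempty X] [Nonempty Y] (hA : ∀ x h, Measurable fun r => A r x h)
    (hB : ∀ y h, Measurable fun r => B r y h)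
    (ops : List (Option (Coin n))) :
    (π.simulation n A B hA hB ops).comm = (2 * numRounds ops : ℕ) := by
  have : Nonempty (π.simulation n A B hA hB ops).Pub :=
    (π.simulation n A B hA hB ops).coin.nonempty_of_neZero
  have h : ∀ r, (((π.simulation n A B hA hB ops).tree r).depth : ℕ∞) =
      (2 * numRounds ops : ℕ) := fun r =>
    congrArg Nat.cast (depth_roundTree _ _ _ _)
  rw [comm]
  simp only [h, ciSup_const]

theorem measurableSet_failure [Nonempty X] [Nonempty Y] (hA : ∀ x h, Measurable fun r => A r x h)
    (hB : ∀ y h, Measurable fun r => B r y h)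
    (ops : List (Option (Coin n))) (x : X) (y : Y) :
    MeasurableSet (π.failure n A B ops x y) :=
  (measurableSet_finalFixes_eq ops measurable_ownTable (measurable_aliceGuess hA x)
    (measurable_bobGuess hB y)).compl

/-- Both transcript laws are images of the law of the thresholds. Off the failure event the replayed
corrections are all the mistakes, so both corrected walks are the joint walk, and its truncation is
the leaf reached by `π` with these thresholds. -/
theorem simulates_simulation [Nonempty X] [Nonempty Y] (hA : ∀ x h, Measurable fun r => A r x h)
    (hB : ∀ y h, Measurable fun r => B r y h)
    (hn : ∀ r, (π.tree r).depth ≤ n) (μ : PMF (X × Y))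
    (ops : List (Option (Coin n))) {ε : ℝ}
    (hε : ∑' z : X × Y, (μ z).toReal * (π.thresholdLaw n).real (π.failure n A B ops z.1 z.2) ≤ ε) :
    (π.simulation n A B hA hB ops).Simulates π μ ε := by
  have hgA := fun x => measurable_output (π := π) (n := n) measurable_ownTable
    (measurable_aliceGuess hA x) ops
  have hgB := fun y => measurable_output (π := π) (n := n) (measurable_not_own measurable_ownTable)
    (measurable_bobGuess hB y) ops
  refine ⟨fun x t => π.output n (π.ownTable n t.1) (π.aliceGuess n A x t.1) ops t,
    fun y t => π.output n (fun h => !π.ownTable n t.1 h) (π.bobGuess n B y t.1) ops t, hgA, hgB, ?_⟩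
  have hs : Summable fun z : X × Y => (μ z).toReal := ENNReal.summable_toReal μ.tsum_coe_ne_top
  have htv : ∀ z : X × Y, tvDist
      (((π.simulation n A B hA hB ops).transcriptLaw z.1 z.2).map fun t =>
        (π.output n (π.ownTable n t.1) (π.aliceGuess n A z.1 t.1) ops t,
          π.output n (fun h => !π.ownTable n t.1 h) (π.bobGuess n B z.2 t.1) ops t))
      ((π.transcriptLaw z.1 z.2).map fun t => (t, t)) ≤
        (π.thresholdLaw n).real (π.failure n A B ops z.1 z.2) := by
    intro z
    have hm : Measurable fun ω => roundBits (correctedBits (π.ownTable n ω)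
        (π.aliceGuess n A z.1 ω)) (correctedBits (fun h => !π.ownTable n ω h)
          (π.bobGuess n B z.2 ω)) ops (SimState.init n) :=
      measurable_roundBits (measurable_correctedBits measurable_ownTable
        (measurable_aliceGuess hA z.1)) (measurable_correctedBits
          (measurable_not_own measurable_ownTable) (measurable_bobGuess hB z.2)) ops _
    have hleaf := measurable_fst.prodMk (measurable_leafPath_tree hn z.1 z.2)
    have hgAB := (hgA z.1).prodMk (hgB z.2)
    refine (congrArg₂ tvDist ((congrArg _ (transcriptLaw_eq_map (π.simulation n A B hA hB ops)
      z.1 z.2 hm fun r => law_roundTree _ _ _ _ _ _)).trans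
        (Measure.map_map hgAB (measurable_id.prodMk hm)))
      ((congrArg _ (transcriptLaw_eq_thresholdLaw hn z.1 z.2)).trans
        (Measure.map_map (measurable_id.prodMk measurable_id) hleaf))).trans_le ?_
    refine tvDist_map_le (π.thresholdLaw n) (hgAB.comp (measurable_id.prodMk hm))
      ((measurable_id.prodMk measurable_id).comp hleaf) fun ω hω => ?_
    have hω' := Set.notMem_compl_iff.1 hω
    have hw := walk_corrected_eq (n := n) (own := π.ownTable n ω)
      (a := π.aliceGuess n A z.1 ω) (b := π.bobGuess n B z.2 ω)
      (isNext_self fun i hi => Finset.mem_range.1 (Finset.mem_filter.1 hi).1) le_rfl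
    have hJ : (replay ops (SimState.init n) (roundBits (correctedBits (π.ownTable n ω)
        (π.aliceGuess n A z.1 ω)) (correctedBits (fun h => !π.ownTable n ω h)
          (π.bobGuess n B z.2 ω)) ops (SimState.init n))).1 = _ :=
      (finalFixes_eq ops _ _ _).symm.trans hω'
    have hl : (π.tree ω.1).trunc (walk (jointTable (π.ownTable n ω) (π.aliceGuess n A z.1 ω)
        (π.bobGuess n B z.2 ω)) n) = (π.tree ω.1).leafPath z.1 z.2 (thresholds ω.2) := by
      rw [← Tree.trunc_walk (hn ω.1), ← Tree.jointTable_thr _ (A ω.1 z.1) (B ω.1 z.2)]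
      rfl
    simp only [Function.comp_apply, output, id_eq, hJ, hw.1, hw.2, hl]
  refine le_trans (Summable.tsum_le_tsum (fun z => mul_le_mul_of_nonneg_left (htv z)
    ENNReal.toReal_nonneg) ?_ ?_) hε
  · exact hs.of_nonneg_of_le (fun z => mul_nonneg ENNReal.toReal_nonneg (tvDist_nonneg _ _))
      fun z => mul_le_of_le_one_right ENNReal.toReal_nonneg ((htv z).trans measureReal_le_one)
  · exact hs.of_nonneg_of_le (fun z => mul_nonneg ENNReal.toReal_nonneg measureReal_nonneg)
      fun z => mul_le_of_le_one_right ENNReal.toReal_nonneg measureReal_le_one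

theorem failure_sum_eq (μ : PMF (X × Y)) (ops : List (Option (Coin n))) :
    ∑' z : X × Y, (μ z).toReal * (π.thresholdLaw n).real (π.failure n A B ops z.1 z.2) =
      (∑' z : X × Y, μ z * π.thresholdLaw n (π.failure n A B ops z.1 z.2)).toReal := by
  rw [ENNReal.tsum_toReal_eq fun z =>
    ENNReal.mul_ne_top (μ.apply_ne_top z) (measure_ne_top _ _)]
  simp only [ENNReal.toReal_mul, Measure.real]

theorem failure_sum_le_one (μ : PMF (X × Y)) (ops : List (Option (Coin n))) :
    ∑' z : X × Y, μ z * π.thresholdLaw n (π.failure n A B ops z.1 z.2) ≤ 1 := by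
  rw [← μ.tsum_coe]
  exact ENNReal.tsum_le_tsum fun z => mul_le_of_le_one_right' prob_le_one

/-- The simulation with at most `T` corrected mistakes, each found with `N` rounds. -/
theorem exists_simulation [Nonempty X] [Nonempty Y] (hA : ∀ x h, Measurable fun r => A r x h)
    (hB : ∀ y h, Measurable fun r => B r y h)
    (hn : ∀ r, (π.tree r).depth ≤ n) (μ : PMF (X × Y)) (T N : ℕ) {δ : ℝ}
    (hδ : 0 ≤ δ)
    (hgap : ∑' z : X × Y, μ z * ∫⁻ ω, (numMistakes n (π.tree ω.1) (A ω.1 z.1) (B ω.1 z.2) z.1 z.2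
      (thresholds ω.2) : ENNReal) ∂π.thresholdLaw n ≤ ENNReal.ofReal δ) :
    ∃ τ : Protocol.{u, v, w} X Y, τ.comm = (2 * (T * N) : ℕ) ∧
      ∀ ε : ℝ, (δ / (T + 1) + T * (n * (39 / 40) ^ N) ≤ ε ∨ 1 ≤ ε) → τ.Simulates π μ ε := by
  classical
  obtain ⟨ι, _, _, L, hL, hfail⟩ := exists_coins n N T
  set c : ℝ := T * (n * (39 / 40) ^ N) with hc
  have hc0 : 0 ≤ c := by positivity
  -- Markov's inequality before integration: with at most `T` mistakes the fraction of bad coin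
  -- lists is at most `c`; with more, one is at most the number of mistakes divided by `T + 1`.
  have hpt : ∀ (x : X) (y : Y) (ω : π.Pub × (Fin n → unitInterval)),
      ∑ i, (π.failure n A B (L i) x y).indicator (fun _ => (1 : ENNReal)) ω ≤
        Fintype.card ι * (ENNReal.ofReal c + ENNReal.ofReal (1 / (T + 1)) *
          (numMistakes n (π.tree ω.1) (A ω.1 x) (B ω.1 y) x y (thresholds ω.2) : ENNReal)) := by
    intro x y ω
    by_cases hT : numMistakes n (π.tree ω.1) (A ω.1 x) (B ω.1 y) x y (thresholds ω.2) ≤ T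
    · have h := hfail (π.ownTable n ω) (π.aliceGuess n A x ω) (π.bobGuess n B y ω) hT
      calc _ = ENNReal.ofReal (∑ i, if finalFixes (L i) (π.ownTable n ω) (π.aliceGuess n A x ω)
            (π.bobGuess n B y ω) = mistakes n (π.ownTable n ω) (π.aliceGuess n A x ω)
            (π.bobGuess n B y ω) then (0 : ℝ) else 1) := by
            rw [ENNReal.ofReal_sum_of_nonneg fun i _ => by split_ifs <;> norm_num]
            refine Finset.sum_congr rfl fun i _ => ?_
            by_cases hi : finalFixes (L i) (π.ownTable n ω) (π.aliceGuess n A x ω)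
              (π.bobGuess n B y ω) = mistakes n (π.ownTable n ω) (π.aliceGuess n A x ω)
              (π.bobGuess n B y ω) <;> simp [failure, hi]
        _ ≤ ENNReal.ofReal (Fintype.card ι * c) := ENNReal.ofReal_le_ofReal h
        _ = Fintype.card ι * ENNReal.ofReal c := by
            rw [ENNReal.ofReal_mul (by positivity), ENNReal.ofReal_natCast]
        _ ≤ _ := by gcongr; exact le_self_add
    · have h1 : (1 : ENNReal) ≤ ENNReal.ofReal (1 / (T + 1)) *
          (numMistakes n (π.tree ω.1) (A ω.1 x) (B ω.1 y) x y (thresholds ω.2) : ENNReal) := by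
        rw [← ENNReal.ofReal_natCast, ← ENNReal.ofReal_mul (by positivity),
          ENNReal.one_le_ofReal, div_mul_eq_mul_div, one_mul, one_le_div (by positivity)]
        exact_mod_cast not_le.1 hT
      have h2 : ∑ i, (π.failure n A B (L i) x y).indicator (fun _ => (1 : ENNReal)) ω ≤
          ∑ _i : ι, (1 : ENNReal) := Finset.sum_le_sum fun i _ => by
        simp only [Set.indicator]
        split_ifs <;> simp
      refine h2.trans ?_
      rw [Finset.sum_const, Finset.card_univ, nsmul_eq_mul]
      gcongr
      exact h1.trans le_add_self
  have hsum : ∀ z : X × Y, ∑ i, π.thresholdLaw n (π.failure n A B (L i) z.1 z.2) ≤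
      Fintype.card ι * (ENNReal.ofReal c + ENNReal.ofReal (1 / (T + 1)) *
        ∫⁻ ω, (numMistakes n (π.tree ω.1) (A ω.1 z.1) (B ω.1 z.2) z.1 z.2
          (thresholds ω.2) : ENNReal) ∂π.thresholdLaw n) := by
    intro z
    have hM : Measurable fun ω : π.Pub × (Fin n → unitInterval) =>
        (numMistakes n (π.tree ω.1) (A ω.1 z.1) (B ω.1 z.2) z.1 z.2 (thresholds ω.2) : ENNReal) :=
      (Measurable.of_discrete (f := fun k : ℕ => (k : ENNReal))).comp
        (measurable_card_mistakes n measurable_ownTable (measurable_aliceGuess hA z.1)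
          (measurable_bobGuess hB z.2))
    calc _ = ∫⁻ ω, ∑ i, (π.failure n A B (L i) z.1 z.2).indicator (fun _ => (1 : ENNReal)) ω
          ∂π.thresholdLaw n := by
          rw [lintegral_finsetSum _ fun i _ =>
            measurable_const.indicator (measurableSet_failure hA hB (L i) z.1 z.2)]
          refine Finset.sum_congr rfl fun i _ => ?_
          rw [lintegral_indicator_const (measurableSet_failure hA hB (L i) z.1 z.2), one_mul]
      _ ≤ _ := lintegral_mono (hpt z.1 z.2)
      _ = _ := by
          rw [lintegral_const_mul _ ((hM.const_mul _).const_add _),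
            lintegral_add_left measurable_const, lintegral_const_mul _ hM]
          simp
  have htot : ∑ i, ∑' z : X × Y, μ z * π.thresholdLaw n (π.failure n A B (L i) z.1 z.2) ≤
      ∑ _i : ι, ENNReal.ofReal (δ / (T + 1) + c) := by
    rw [← Summable.tsum_finsetSum fun i _ => ENNReal.summable]
    simp only [← Finset.mul_sum]
    calc _ ≤ ∑' z : X × Y, μ z * (Fintype.card ι * (ENNReal.ofReal c + ENNReal.ofReal (1 / (T + 1)) *
          ∫⁻ ω, (numMistakes n (π.tree ω.1) (A ω.1 z.1) (B ω.1 z.2) z.1 z.2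
          (thresholds ω.2) : ENNReal) ∂π.thresholdLaw n)) :=
          ENNReal.tsum_le_tsum fun z => by gcongr; exact hsum z
      _ = Fintype.card ι * (ENNReal.ofReal c * ∑' z, μ z + ENNReal.ofReal (1 / (T + 1)) *
          ∑' z : X × Y, μ z * ∫⁻ ω, (numMistakes n (π.tree ω.1) (A ω.1 z.1) (B ω.1 z.2) z.1 z.2
          (thresholds ω.2) : ENNReal) ∂π.thresholdLaw n) := by
          simp only [← ENNReal.tsum_mul_left, ← ENNReal.tsum_add]
          refine tsum_congr fun z => by ring
      _ ≤ Fintype.card ι * (ENNReal.ofReal c * 1 + ENNReal.ofReal (1 / (T + 1)) *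
          ENNReal.ofReal δ) := by rw [μ.tsum_coe]; gcongr
      _ = _ := by
          rw [mul_one, ← ENNReal.ofReal_mul (by positivity), ← ENNReal.ofReal_add hc0
            (by positivity), Finset.sum_const, Finset.card_univ, nsmul_eq_mul]
          congr 2
          ring
  -- Some coin list is at least as good as the average for this `μ`. It is fixed once and for all,
  -- so the simulation draws no hash coins.
  obtain ⟨i, hi⟩ : ∃ i, ∑' z : X × Y, μ z * π.thresholdLaw n (π.failure n A B (L i) z.1 z.2) ≤
      ENNReal.ofReal (δ / (T + 1) + c) := by
    by_contra! hcon
    exact absurd htot (not_le.2 (ENNReal.sum_lt_sum_of_nonempty Finset.univ_nonempty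
      fun i _ => hcon i))
  refine ⟨π.simulation n A B hA hB (L i), by rw [comm_simulation, hL], fun ε hε => ?_⟩
  refine simulates_simulation hA hB hn μ (L i) ?_
  rw [failure_sum_eq]
  rcases hε with hε | hε
  · exact (ENNReal.toReal_le_of_le_ofReal (by positivity) hi).trans hε
  · exact (ENNReal.toReal_le_of_le_ofReal zero_le_one
      (by simpa using failure_sum_le_one μ (L i))).trans hε

end Simulation

end Protocol

open Real (negMulLog)

/-! ### Sums over bit strings of bounded length -/

/-- The bit strings of length at most `n`. -/
def bitStrings : ℕ → Finset (List Bool)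
  | 0 => {[]}
  | n + 1 => insert [] ((bitStrings n).image (List.cons true) ∪ (bitStrings n).image (List.cons false))

theorem mem_bitStrings {n : ℕ} {l : List Bool} : l ∈ bitStrings n ↔ l.length ≤ n := by
  induction n generalizing l with
  | zero => simp [bitStrings, List.length_eq_zero_iff]
  | succ n ih =>
    cases l with
    | nil => simp [bitStrings]
    | cons b l => cases b <;> simp [bitStrings, ih]

theorem sum_bitStrings_succ (n : ℕ) (f : List Bool → ℝ) :
    ∑ l ∈ bitStrings (n + 1), f l = f [] + (∑ l ∈ bitStrings n, f (true :: l) +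
      ∑ l ∈ bitStrings n, f (false :: l)) := by
  rw [bitStrings, Finset.sum_insert (by simp), Finset.sum_union]
  · rw [Finset.sum_image (by simp), Finset.sum_image (by simp)]
  · rw [Finset.disjoint_left]
    simp only [Finset.mem_image]
    rintro _ ⟨l, _, rfl⟩ ⟨l', _, h⟩
    simp at h

theorem tsum_eq_sum_bitStrings {n : ℕ} {f : List Bool → ℝ} (hf : ∀ l, n < l.length → f l = 0) :
    ∑' l, f l = ∑ l ∈ bitStrings n, f l :=
  tsum_eq_sum fun l hl => hf l (not_le.1 fun h => hl (mem_bitStrings.2 h))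

/-! ### The law of a protocol tree as a real function -/

section Law

variable {X : Type u} {Y : Type v}

/-- The probability of the bit `b`, if that of a one is `p`. -/
def bitProb (b : Bool) (p : ℝ) : ℝ := if b then p else 1 - p

theorem bitProb_add (p : ℝ) : bitProb true p + bitProb false p = 1 := by simp [bitProb]

theorem bitProb_nonneg (b : Bool) {p : ℝ} (h0 : 0 ≤ p) (h1 : p ≤ 1) : 0 ≤ bitProb b p := by
  cases b <;> simp [bitProb] <;> linarith

theorem bitProb_le_one (b : Bool) {p : ℝ} (h0 : 0 ≤ p) (h1 : p ≤ 1) : bitProb b p ≤ 1 := by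
  cases b <;> simp [bitProb] <;> linarith

namespace Tree

theorem bias_nonneg (t : Tree X Y) (x : X) (y : Y) : 0 ≤ t.bias x y := by
  cases t with
  | leaf => exact le_rfl
  | alice p _ _ => exact (p x).2.1
  | bob p _ _ => exact (p y).2.1

theorem bias_le_one (t : Tree X Y) (x : X) (y : Y) : t.bias x y ≤ 1 := by
  cases t with
  | leaf => exact zero_le_one
  | alice p _ _ => exact (p x).2.2
  | bob p _ _ => exact (p y).2.2

/-- The probability of a sequence of bits, as a real number. -/
def prob (t : Tree X Y) (x : X) (y : Y) (l : List Bool) : ℝ := (t.law x y l).toReal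

theorem prob_nonneg (t : Tree X Y) (x : X) (y : Y) (l : List Bool) : 0 ≤ t.prob x y l :=
  ENNReal.toReal_nonneg

theorem prob_leaf (x : X) (y : Y) (l : List Bool) :
    (leaf : Tree X Y).prob x y l = if l = [] then 1 else 0 := by
  simp only [prob, law, PMF.pure_apply]
  split_ifs <;> simp

theorem map_cons_apply_cons (p : PMF (List Bool)) (b c : Bool) (l : List Bool) :
    (p.map (List.cons b)) (c :: l) = if c = b then p l else 0 := by
  rw [PMF.map_apply, tsum_eq_single l]
  · simp
  · intro l' hl'
    simp [hl'.symm]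

theorem bitLaw_apply (p : unitInterval) (b : Bool) :
    bitLaw p b = ENNReal.ofReal (bitProb b p) := by
  simp [bitLaw, bitProb]

theorem node_apply_nil (p : unitInterval) (f : Bool → PMF (List Bool)) :
    ((bitLaw p).bind fun b => (f b).map (List.cons b)) [] = 0 := by
  simp [PMF.bind_apply]

theorem node_apply_cons (p : unitInterval) (f : Bool → PMF (List Bool)) (b : Bool)
    (l : List Bool) : ((bitLaw p).bind fun b => (f b).map (List.cons b)) (b :: l) =
      ENNReal.ofReal (bitProb b p) * f b l := by
  rw [PMF.bind_apply, tsum_eq_single b]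
  · rw [map_cons_apply_cons, if_pos rfl, bitLaw_apply]
  · intro c hc
    rw [map_cons_apply_cons, if_neg hc.symm, mul_zero]

theorem prob_nil {t : Tree X Y} (ht : t.owner ≠ none) (x : X) (y : Y) : t.prob x y [] = 0 := by
  cases t with
  | leaf => simp [owner] at ht
  | alice p t₀ t₁ => simp only [prob, law, node_apply_nil _ (fun b => if b then t₁.law x y else
      t₀.law x y), ENNReal.toReal_zero]
  | bob p t₀ t₁ => simp only [prob, law, node_apply_nil _ (fun b => if b then t₁.law x y else
      t₀.law x y), ENNReal.toReal_zero]

theorem prob_cons {t : Tree X Y} (ht : t.owner ≠ none) (x : X) (y : Y) (b : Bool)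
    (l : List Bool) : t.prob x y (b :: l) =
      bitProb b (t.bias x y) * (t.nodeAt [b]).prob x y l := by
  cases t with
  | leaf => simp [owner] at ht
  | alice p t₀ t₁ =>
    rw [prob, law, node_apply_cons _ (fun b => if b then t₁.law x y else t₀.law x y),
      ENNReal.toReal_mul, ENNReal.toReal_ofReal (bitProb_nonneg _ (p x).2.1 (p x).2.2)]
    cases b <;> simp [prob, bias, nodeAt]
  | bob p t₀ t₁ =>
    rw [prob, law, node_apply_cons _ (fun b => if b then t₁.law x y else t₀.law x y),
      ENNReal.toReal_mul, ENNReal.toReal_ofReal (bitProb_nonneg _ (p y).2.1 (p y).2.2)]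
    cases b <;> simp [prob, bias, nodeAt]

theorem prob_le_one (t : Tree X Y) (x : X) (y : Y) (l : List Bool) : t.prob x y l ≤ 1 :=
  ENNReal.toReal_le_of_le_ofReal zero_le_one (by simpa using PMF.coe_le_one _ _)

theorem prob_eq_zero {t : Tree X Y} {n : ℕ} (h : t.depth ≤ n) (x : X) (y : Y) {l : List Bool}
    (hl : n < l.length) : t.prob x y l = 0 := by
  induction n generalizing t l with
  | zero =>
    cases t with
    | leaf => rw [prob_leaf, if_neg]; rintro rfl; simp at hl
    | alice p t₀ t₁ => simp [depth] at h
    | bob p t₀ t₁ => simp [depth] at h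
  | succ n ih =>
    by_cases ht : t.owner = none
    · cases t with
      | leaf => rw [prob_leaf, if_neg]; rintro rfl; simp at hl
      | alice p t₀ t₁ => simp [owner] at ht
      | bob p t₀ t₁ => simp [owner] at ht
    · cases l with
      | nil => simp at hl
      | cons b l =>
        rw [prob_cons ht, ih (depth_nodeAt_le h b) (by simpa using hl), mul_zero]

theorem sum_prob {t : Tree X Y} {n : ℕ} (h : t.depth ≤ n) (x : X) (y : Y) :
    ∑ l ∈ bitStrings n, t.prob x y l = 1 := by
  rw [← tsum_eq_sum_bitStrings fun l hl => prob_eq_zero h x y hl]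
  simp only [prob]
  rw [← ENNReal.tsum_toReal_eq fun l => (t.law x y).apply_ne_top l, PMF.tsum_coe,
    ENNReal.toReal_one]

end Tree

end Law

/-! ### Pinsker's inequality for bits -/

/-- This is log t ≤ t - 1 at t = √(q / p). Summed over both values of a bit, it bounds the
divergence below by the squared Hellinger distance. -/
theorem mul_log_sub_ge {p q : ℝ} (hp : 0 ≤ p) (hq : 0 ≤ q) (h : q = 0 → p = 0) :
    2 * p - 2 * (√p * √q) ≤ p * (Real.log p - Real.log q) := by
  rcases hp.eq_or_lt with rfl | hp
  · simp
  have hq' : 0 < q := hq.lt_of_ne fun h0 => hp.ne' (h h0.symm)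
  have h1 := Real.log_le_sub_one_of_pos (x := √q / √p) (by positivity)
  rw [Real.log_div (by positivity) (by positivity), Real.log_sqrt hq, Real.log_sqrt hp.le] at h1
  have h2 : p * (√q / √p) = √p * √q := by
    have : √p * √p = p := Real.mul_self_sqrt hp.le
    field_simp
    nlinarith
  nlinarith

/-- Factor p - q = (√p - √q)(√p + √q), where the second factor is at most 2. -/
theorem sq_sub_le {p q : ℝ} (hp : 0 ≤ p) (hq : 0 ≤ q) (hp1 : p ≤ 1) (hq1 : q ≤ 1) :
    (p - q) ^ 2 ≤ 4 * (p + q - 2 * (√p * √q)) := by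
  have h1 : √p ≤ 1 := Real.sqrt_le_one.2 hp1
  have h2 : √q ≤ 1 := Real.sqrt_le_one.2 hq1
  have h3 := Real.sqrt_nonneg p
  have h4 := Real.sqrt_nonneg q
  have h5 : (p - q) ^ 2 = (√p - √q) ^ 2 * (√p + √q) ^ 2 := by
    rw [← mul_pow, mul_comm, ← sq_sub_sq, Real.sq_sqrt hp, Real.sq_sqrt hq]
  have h6 : p + q - 2 * (√p * √q) = (√p - √q) ^ 2 := by
    rw [sub_sq, Real.sq_sqrt hp, Real.sq_sqrt hq]; ring
  have h7 : (√p + √q) ^ 2 ≤ 4 := by nlinarith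
  rw [h5, h6]
  nlinarith [sq_nonneg (√p - √q)]

/-- Pinsker's inequality by way of the Hellinger distance. The constant is not optimal, which
affects only the universal constant of the theorem. -/
theorem sq_sub_le_kl {p q : ℝ} (hp : 0 ≤ p) (hp1 : p ≤ 1) (hq : 0 ≤ q) (hq1 : q ≤ 1)
    (h0 : q = 0 → p = 0) (h1 : 1 - q = 0 → 1 - p = 0) :
    (p - q) ^ 2 ≤ 2 * (p * (Real.log p - Real.log q) +
      (1 - p) * (Real.log (1 - p) - Real.log (1 - q))) := by
  have hp' := sub_nonneg.2 hp1
  have hq' := sub_nonneg.2 hq1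
  have a1 := mul_log_sub_ge hp hq h0
  have a2 := mul_log_sub_ge hp' hq' h1
  have a3 := sq_sub_le hp hq hp1 hq1
  have a4 := sq_sub_le hp' hq' (by linarith) (by linarith)
  have : (1 - p - (1 - q)) ^ 2 = (p - q) ^ 2 := by ring
  linarith

/-! ### The information revealed by one bit -/

theorem summable_mul_of_bounded {α : Type*} {w g : α → ℝ} (hw : Summable w) (hw0 : ∀ x, 0 ≤ w x)
    (M : ℝ) (hg : ∀ x, |g x| ≤ M) : Summable fun x => w x * g x := by
  refine Summable.of_norm_bounded (hw.mul_right M) fun x => ?_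
  rw [Real.norm_eq_abs, abs_mul, abs_of_nonneg (hw0 x)]
  exact mul_le_mul_of_nonneg_left (hg x) (hw0 x)

theorem abs_le_one_of_mem {p : ℝ} (h0 : 0 ≤ p) (h1 : p ≤ 1) : |p| ≤ 1 :=
  abs_le.2 ⟨by linarith, h1⟩

theorem abs_negMulLog_le {p : ℝ} (h0 : 0 ≤ p) (h1 : p ≤ 1) : |negMulLog p| ≤ 1 :=
  abs_le_one_of_mem (Real.negMulLog_nonneg h0 h1) ((Real.negMulLog_le_one_sub_self h0).trans (by linarith))

/-- The information about `x` (distributed with weights `w`) in a bit with bias `p x`. -/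
def bitInfo {α : Type*} (w p : α → ℝ) : ℝ :=
  negMulLog (∑' x, w x * p x) + negMulLog (∑' x, w x * (1 - p x)) - negMulLog (∑' x, w x) -
    ∑' x, w x * (negMulLog (p x) + negMulLog (1 - p x))

section BitInfo

variable {α : Type*} {w p : α → ℝ} (hw : Summable w) (hw0 : ∀ x, 0 ≤ w x) (hp0 : ∀ x, 0 ≤ p x)
  (hp1 : ∀ x, p x ≤ 1)
include hw hw0 hp0 hp1

/-- `bitInfo` is the weighted sum of the divergences of `p x` from the mean bias, so Pinsker's
inequality applies term by term. -/
theorem tsum_sq_le_bitInfo :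
    Summable (fun x => w x * (p x - (∑' x, w x * p x) / ∑' x, w x) ^ 2) ∧
    ∑' x, w x * (p x - (∑' x, w x * p x) / ∑' x, w x) ^ 2 ≤ 2 * bitInfo w p := by
  have hs1 : Summable fun x => w x * p x :=
    summable_mul_of_bounded hw hw0 1 fun x => abs_le_one_of_mem (hp0 x) (hp1 x)
  have hs0 : Summable fun x => w x * (1 - p x) :=
    summable_mul_of_bounded hw hw0 1 fun x =>
      abs_le_one_of_mem (by linarith [hp1 x]) (by linarith [hp0 x])
  have hse : Summable fun x => w x * (negMulLog (p x) + negMulLog (1 - p x)) :=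
    summable_mul_of_bounded hw hw0 2 fun x => (abs_add_le _ _).trans (by
      linarith [abs_negMulLog_le (hp0 x) (hp1 x), abs_negMulLog_le (p := 1 - p x)
        (by linarith [hp1 x]) (by linarith [hp0 x])])
  set S := ∑' x, w x with hS
  set S₁ := ∑' x, w x * p x with hS1
  set S₀ := ∑' x, w x * (1 - p x) with hS0
  have hadd : S₁ + S₀ = S := by
    rw [hS1, hS0, ← hs1.tsum_add hs0]
    exact tsum_congr fun x => by ring
  have hS1n : 0 ≤ S₁ := tsum_nonneg fun x => mul_nonneg (hw0 x) (hp0 x)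
  have hS0n : 0 ≤ S₀ := tsum_nonneg fun x => mul_nonneg (hw0 x) (by linarith [hp1 x])
  have hSn : 0 ≤ S := tsum_nonneg hw0
  have hq0 : 0 ≤ S₁ / S := by positivity
  have hq1 : S₁ / S ≤ 1 := div_le_one_of_le₀ (by linarith) hSn
  have hsq : Summable fun x => w x * (p x - S₁ / S) ^ 2 :=
    summable_mul_of_bounded hw hw0 1 fun x => by
      rw [abs_of_nonneg (sq_nonneg _)]
      nlinarith [hp0 x, hp1 x]
  refine ⟨hsq, ?_⟩
  have hexp : HasSum (fun x => -(w x * p x) * Real.log S₁ - w x * (1 - p x) * Real.log S₀ +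
      w x * Real.log S - w x * (negMulLog (p x) + negMulLog (1 - p x))) (bitInfo w p) := by
    have := (((hs1.hasSum.neg.mul_right (Real.log S₁)).sub
      (hs0.hasSum.mul_right (Real.log S₀))).add (hw.hasSum.mul_right (Real.log S))).sub hse.hasSum
    have e : bitInfo w p = (-S₁) * Real.log S₁ - S₀ * Real.log S₀ + S * Real.log S -
        ∑' x, w x * (negMulLog (p x) + negMulLog (1 - p x)) := by
      change negMulLog S₁ + negMulLog S₀ - negMulLog S - _ = _
      generalize ∑' x, w x * (negMulLog (p x) + negMulLog (1 - p x)) = E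
      simp only [negMulLog]
      ring
    rw [e]
    exact this
  rw [← hexp.tsum_eq, ← tsum_mul_left]
  refine hsq.tsum_le_tsum (fun x => ?_) (hexp.summable.mul_left 2)
  rcases (hw0 x).eq_or_lt with h | h
  · simp [← h]
  have hSpos : 0 < S := h.trans_le (hw.le_tsum x fun j _ => hw0 j)
  -- Absolute continuity: at a point of positive weight, the mean can vanish only together with `p
  -- x`; likewise for the complementary bit below.
  have h1 : p x ≠ 0 → 0 < S₁ := fun hne =>
    (mul_pos h ((hp0 x).lt_of_ne hne.symm)).trans_le
      (hs1.le_tsum x fun j _ => mul_nonneg (hw0 j) (hp0 j))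
  have h0 : 1 - p x ≠ 0 → 0 < S₀ := fun hne =>
    (mul_pos h ((sub_nonneg.2 (hp1 x)).lt_of_ne hne.symm)).trans_le
      (hs0.le_tsum x fun j _ => mul_nonneg (hw0 j) (by linarith [hp1 j]))
  have hqc : 1 - S₁ / S = S₀ / S := by
    rw [eq_div_iff hSpos.ne', sub_mul, div_mul_cancel₀ _ hSpos.ne']; linarith
  have key := sq_sub_le_kl (hp0 x) (hp1 x) hq0 hq1
    (fun hz => by
      by_contra hne
      exact (div_pos (h1 hne) hSpos).ne' hz)
    (fun hz => by
      by_contra hne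
      rw [hqc] at hz
      exact (div_pos (h0 hne) hSpos).ne' hz)
  have e1 : p x * Real.log (S₁ / S) = p x * (Real.log S₁ - Real.log S) := by
    by_cases hpx : p x = 0
    · simp [hpx]
    · rw [Real.log_div (h1 hpx).ne' hSpos.ne']
  have e0 : (1 - p x) * Real.log (1 - S₁ / S) = (1 - p x) * (Real.log S₀ - Real.log S) := by
    by_cases hpx : 1 - p x = 0
    · simp [hpx]
    · rw [hqc, Real.log_div (h0 hpx).ne' hSpos.ne']
  have key2 := mul_le_mul_of_nonneg_left key h.le
  simp only [negMulLog]
  rw [mul_sub, mul_sub, e1, e0] at key2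
  linarith

theorem bitInfo_nonneg : 0 ≤ bitInfo w p := by
  have h := (tsum_sq_le_bitInfo hw hw0 hp0 hp1).2
  have : 0 ≤ ∑' x, w x * (p x - (∑' x, w x * p x) / ∑' x, w x) ^ 2 :=
    tsum_nonneg fun x => mul_nonneg (hw0 x) (sq_nonneg _)
  linarith

/-- From |d| ≤ λ + d²/λ. Unlike Cauchy–Schwarz, this is linear in the weights and in the
information, so it can be summed over nodes, inputs and public coins with the same `lam`, which is
optimised at the very end. -/
theorem tsum_abs_le_bitInfo {lam : ℝ} (hlam : 0 < lam) :
    ∑' x, w x * |p x - (∑' x, w x * p x) / ∑' x, w x| ≤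
      lam * ∑' x, w x + 2 / lam * bitInfo w p := by
  obtain ⟨h1, h2⟩ := tsum_sq_le_bitInfo hw hw0 hp0 hp1
  set q := (∑' x, w x * p x) / ∑' x, w x
  have hb : Summable fun x => lam * w x + 1 / lam * (w x * (p x - q) ^ 2) :=
    (hw.mul_left lam).add (h1.mul_left (1 / lam))
  have hpt : ∀ x, w x * |p x - q| ≤ lam * w x + 1 / lam * (w x * (p x - q) ^ 2) := by
    intro x
    have : |p x - q| ≤ lam + 1 / lam * (p x - q) ^ 2 := by
      rw [← sq_abs]
      have h3 := abs_nonneg (p x - q)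
      set d := |p x - q|
      rcases le_total d lam with h | h
      · have : 0 ≤ 1 / lam * d ^ 2 := by positivity
        linarith
      · have : d ≤ 1 / lam * d ^ 2 := by
          rw [one_div, inv_mul_eq_div, le_div_iff₀ hlam]
          nlinarith
        linarith
    calc _ ≤ w x * (lam + 1 / lam * (p x - q) ^ 2) := mul_le_mul_of_nonneg_left this (hw0 x)
      _ = _ := by ring
  calc _ ≤ ∑' x, (lam * w x + 1 / lam * (w x * (p x - q) ^ 2)) :=
        Summable.tsum_le_tsum hpt (hb.of_nonneg_of_le
          (fun x => mul_nonneg (hw0 x) (abs_nonneg _)) hpt) hb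
    _ = lam * ∑' x, w x + 1 / lam * ∑' x, w x * (p x - q) ^ 2 := by
        rw [(hw.mul_left lam).tsum_add (h1.mul_left _), tsum_mul_left, tsum_mul_left]
    _ ≤ lam * ∑' x, w x + 1 / lam * (2 * bitInfo w p) := by gcongr
    _ = _ := by ring

end BitInfo

-- The belief gap against the information in all bits

section TreeInfo

variable {X : Type u} {Y : Type v}

namespace Tree

/-- Bob's belief about the bits: the probability of a one at the node `h` given `y`, when `x` is
distributed with weights `w`. -/
def posteriorBias (t : Tree X Y) (w : X → ℝ) (y : Y) : List Bool → ℝ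
  | [] => (∑' x, w x * t.bias x y) / ∑' x, w x
  | b :: h => (t.nodeAt [b]).posteriorBias (fun x => w x * bitProb b (t.bias x y)) y h

/-- The part of the belief gap from the nodes of Alice. -/
def aliceGap : Tree X Y → (List Bool → ℝ) → X → Y → ℝ
  | leaf, _, _, _ => 0
  | alice p t₀ t₁, B, x, y => |p x - B []| +
      ((p x : ℝ) * t₁.aliceGap (fun h => B (true :: h)) x y +
        (1 - p x) * t₀.aliceGap (fun h => B (false :: h)) x y)
  | bob p t₀ t₁, B, x, y =>
      ((p y : ℝ) * t₁.aliceGap (fun h => B (true :: h)) x y +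
        (1 - p y) * t₀.aliceGap (fun h => B (false :: h)) x y)

theorem aliceGap_nonneg (t : Tree X Y) (B : List Bool → ℝ) (x : X) (y : Y) :
    0 ≤ t.aliceGap B x y := by
  induction t generalizing B with
  | leaf => exact le_rfl
  | alice p t₀ t₁ h₀ h₁ =>
    have := (p x).2.1
    have := sub_nonneg.2 (p x).2.2
    have := h₀ fun h => B (false :: h)
    have := h₁ fun h => B (true :: h)
    simp only [aliceGap]; positivity
  | bob p t₀ t₁ h₀ h₁ =>
    have := (p y).2.1
    have := sub_nonneg.2 (p y).2.2
    have := h₀ fun h => B (false :: h)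
    have := h₁ fun h => B (true :: h)
    simp only [aliceGap]; positivity

/-- Beliefs are arbitrary reals, but a finite tree consults only finitely many. The bound is uniform
in `x` and serves summability. -/
theorem exists_aliceGap_le (t : Tree X Y) (B : List Bool → ℝ) (y : Y) :
    ∃ M, 0 ≤ M ∧ ∀ x, t.aliceGap B x y ≤ M := by
  have conv : ∀ {p a b : ℝ}, 0 ≤ p → p ≤ 1 → 0 ≤ a → 0 ≤ b → p * a + (1 - p) * b ≤ a + b := by
    intro p a b h0 h1 ha hb
    nlinarith
  induction t generalizing B with
  | leaf => exact ⟨0, le_rfl, fun _ => le_rfl⟩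
  | alice p t₀ t₁ h₀ h₁ =>
    obtain ⟨M₀, h0, hM₀⟩ := h₀ fun h => B (false :: h)
    obtain ⟨M₁, h1, hM₁⟩ := h₁ fun h => B (true :: h)
    refine ⟨(1 + |B []|) + (M₁ + M₀), by positivity, fun x => ?_⟩
    have hp : |(p x : ℝ) - B []| ≤ 1 + |B []| := (abs_sub _ _).trans
      (by linarith [abs_le_one_of_mem (p x).2.1 (p x).2.2])
    have := conv (p x).2.1 (p x).2.2 (t₁.aliceGap_nonneg (fun h => B (true :: h)) x y)
      (t₀.aliceGap_nonneg (fun h => B (false :: h)) x y)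
    simp only [aliceGap]
    linarith [hM₀ x, hM₁ x]
  | bob p t₀ t₁ h₀ h₁ =>
    obtain ⟨M₀, h0, hM₀⟩ := h₀ fun h => B (false :: h)
    obtain ⟨M₁, h1, hM₁⟩ := h₁ fun h => B (true :: h)
    refine ⟨M₁ + M₀, by positivity, fun x => ?_⟩
    have := conv (p y).2.1 (p y).2.2 (t₁.aliceGap_nonneg (fun h => B (true :: h)) x y)
      (t₀.aliceGap_nonneg (fun h => B (false :: h)) x y)
    simp only [aliceGap]
    linarith [hM₀ x, hM₁ x]

theorem summable_aliceGap (t : Tree X Y) (B : List Bool → ℝ) (y : Y) {w : X → ℝ}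
    (hw : Summable w) (hw0 : ∀ x, 0 ≤ w x) : Summable fun x => w x * t.aliceGap B x y := by
  obtain ⟨M, hM, h⟩ := t.exists_aliceGap_le B y
  exact summable_mul_of_bounded hw hw0 M fun x => by
    rw [abs_of_nonneg (t.aliceGap_nonneg B x y)]; exact h x

/-- The weight of the bits `l`, when `x` is distributed with weights `w`. -/
def marginal (t : Tree X Y) (w : X → ℝ) (y : Y) (l : List Bool) : ℝ := ∑' x, w x * t.prob x y l

/-- The entropy of the bits on the inputs `x`, `y` (with natural logarithms). -/
def bitsEntropy (n : ℕ) (t : Tree X Y) (x : X) (y : Y) : ℝ :=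
  ∑ l ∈ bitStrings n, negMulLog (t.prob x y l)

/-- The information about `x` in the bits (with natural logarithms), when `x` is distributed with
weights `w`. -/
def bitsInfo (n : ℕ) (t : Tree X Y) (w : X → ℝ) (y : Y) : ℝ :=
  ∑ l ∈ bitStrings n, negMulLog (t.marginal w y l) - negMulLog (∑' x, w x) -
    ∑' x, w x * t.bitsEntropy n x y

theorem sum_bitStrings_eq_nil {n : ℕ} {f : List Bool → ℝ} (hf : ∀ l, l ≠ [] → f l = 0) :
    ∑ l ∈ bitStrings n, f l = f [] :=
  Finset.sum_eq_single_of_mem [] (mem_bitStrings.2 (by simp)) fun l _ hl => hf l hl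

theorem bitsInfo_leaf (n : ℕ) (w : X → ℝ) (y : Y) : (leaf : Tree X Y).bitsInfo n w y = 0 := by
  have h1 : ∀ x, (leaf : Tree X Y).bitsEntropy n x y = 0 := fun x => by
    rw [bitsEntropy, sum_bitStrings_eq_nil fun l hl => by rw [prob_leaf, if_neg hl]; simp,
      prob_leaf]
    simp
  have h2 : ∀ l, (leaf : Tree X Y).marginal w y l = if l = [] then ∑' x, w x else 0 := fun l => by
    simp only [marginal, prob_leaf]
    split_ifs <;> simp
  rw [bitsInfo, sum_bitStrings_eq_nil fun l hl => by rw [h2, if_neg hl]; simp]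
  simp [h1, h2]

theorem bitsEntropy_bounds {n : ℕ} (t : Tree X Y) (x : X) (y : Y) :
    0 ≤ t.bitsEntropy n x y ∧ t.bitsEntropy n x y ≤ (bitStrings n).card := by
  have h := fun l => Real.negMulLog_nonneg (t.prob_nonneg x y l) (t.prob_le_one x y l)
  refine ⟨Finset.sum_nonneg fun l _ => h l, ?_⟩
  calc _ ≤ ∑ _l ∈ bitStrings n, (1 : ℝ) := Finset.sum_le_sum fun l _ =>
        (Real.negMulLog_le_one_sub_self (t.prob_nonneg x y l)).trans
          (by linarith [t.prob_nonneg x y l])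
    _ = _ := by simp

theorem bitsEntropy_succ {t : Tree X Y} {n : ℕ} (h : t.depth ≤ n + 1) (ht : t.owner ≠ none)
    (x : X) (y : Y) : t.bitsEntropy (n + 1) x y =
      (negMulLog (t.bias x y) + negMulLog (1 - t.bias x y)) +
      (bitProb true (t.bias x y) * (t.nodeAt [true]).bitsEntropy n x y +
        bitProb false (t.bias x y) * (t.nodeAt [false]).bitsEntropy n x y) := by
  have key : ∀ b : Bool, ∑ l ∈ bitStrings n, negMulLog (t.prob x y (b :: l)) =
      negMulLog (bitProb b (t.bias x y)) +
        bitProb b (t.bias x y) * (t.nodeAt [b]).bitsEntropy n x y := by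
    intro b
    simp only [prob_cons ht, Real.negMulLog_mul, Finset.sum_add_distrib, ← Finset.sum_mul,
      ← Finset.mul_sum, bitsEntropy]
    rw [sum_prob (depth_nodeAt_le h b), one_mul]
  rw [bitsEntropy, sum_bitStrings_succ, prob_nil ht, key, key]
  simp only [Real.negMulLog_zero, bitProb, if_true, Bool.false_eq_true, if_false]
  ring

/-- The chain rule for the information in the bits. -/
theorem bitsInfo_succ {t : Tree X Y} {n : ℕ} (h : t.depth ≤ n + 1) (ht : t.owner ≠ none)
    {w : X → ℝ} (hw : Summable w) (hw0 : ∀ x, 0 ≤ w x) (y : Y) :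
    t.bitsInfo (n + 1) w y = bitInfo w (fun x => t.bias x y) +
      ((t.nodeAt [true]).bitsInfo n (fun x => w x * bitProb true (t.bias x y)) y +
        (t.nodeAt [false]).bitsInfo n (fun x => w x * bitProb false (t.bias x y)) y) := by
  have hb : ∀ b x, |bitProb b (t.bias x y)| ≤ 1 := fun b x => abs_le_one_of_mem
    (bitProb_nonneg b (t.bias_nonneg x y) (t.bias_le_one x y))
    (bitProb_le_one b (t.bias_nonneg x y) (t.bias_le_one x y))
  -- Weights are not renormalised after a bit, so the conditional terms of the chain rule carry
  -- their probabilities by themselves and no case of probability zero arises.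
  have hm : ∀ b l, t.marginal w y (b :: l) =
      (t.nodeAt [b]).marginal (fun x => w x * bitProb b (t.bias x y)) y l := fun b l => by
    simp only [marginal, prob_cons ht, mul_assoc]
  have hm0 : t.marginal w y [] = 0 := by simp [marginal, prob_nil ht]
  have hs1 : Summable fun x => w x * (negMulLog (t.bias x y) + negMulLog (1 - t.bias x y)) :=
    summable_mul_of_bounded hw hw0 2 fun x => (abs_add_le _ _).trans (by
      linarith [abs_negMulLog_le (t.bias_nonneg x y) (t.bias_le_one x y),
        abs_negMulLog_le (p := 1 - t.bias x y)
          (by linarith [t.bias_le_one x y]) (by linarith [t.bias_nonneg x y])])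
  have hs2 : ∀ b, Summable fun x =>
      w x * bitProb b (t.bias x y) * (t.nodeAt [b]).bitsEntropy n x y := fun b =>
    summable_mul_of_bounded (summable_mul_of_bounded hw hw0 1 (hb b)) (fun x => mul_nonneg (hw0 x)
      (bitProb_nonneg b (t.bias_nonneg x y) (t.bias_le_one x y))) (bitStrings n).card fun x => by
        rw [abs_of_nonneg (bitsEntropy_bounds _ _ _).1]
        exact (bitsEntropy_bounds _ _ _).2
  have he : ∑' x, w x * t.bitsEntropy (n + 1) x y =
      ∑' x, w x * (negMulLog (t.bias x y) + negMulLog (1 - t.bias x y)) +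
      (∑' x, w x * bitProb true (t.bias x y) * (t.nodeAt [true]).bitsEntropy n x y +
        ∑' x, w x * bitProb false (t.bias x y) * (t.nodeAt [false]).bitsEntropy n x y) := by
    rw [← (hs2 true).tsum_add (hs2 false), ← hs1.tsum_add ((hs2 true).add (hs2 false))]
    exact tsum_congr fun x => by rw [bitsEntropy_succ h ht]; ring
  have h1 : ∀ x, bitProb true (t.bias x y) = t.bias x y := fun x => by simp [bitProb]
  have h0 : ∀ x, bitProb false (t.bias x y) = 1 - t.bias x y := fun x => by simp [bitProb]
  rw [bitsInfo, sum_bitStrings_succ, he, hm0]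
  simp only [hm, bitsInfo, bitInfo, Real.negMulLog_zero, h1, h0]
  ring

/-- The expected gap between Alice's probabilities and Bob's beliefs is bounded by the information
about Alice's input in the bits. -/
theorem tsum_aliceGap_le {t : Tree X Y} {n : ℕ} (h : t.depth ≤ n) {w : X → ℝ} (hw : Summable w)
    (hw0 : ∀ x, 0 ≤ w x) (y : Y) {lam : ℝ} (hlam : 0 < lam) :
    ∑' x, w x * t.aliceGap (t.posteriorBias w y) x y ≤
      lam * n * ∑' x, w x + 2 / lam * t.bitsInfo n w y := by
  induction n generalizing t w with
  | zero =>
    cases t with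
    | leaf => simp [aliceGap, bitsInfo_leaf]
    | alice p t₀ t₁ => simp [depth] at h
    | bob p t₀ t₁ => simp [depth] at h
  | succ n ih =>
    by_cases ht : t.owner = none
    · cases t with
      | leaf =>
        simp only [aliceGap, bitsInfo_leaf, mul_zero, tsum_zero, add_zero]
        have : 0 ≤ ∑' x, w x := tsum_nonneg hw0
        positivity
      | alice p t₀ t₁ => simp [owner] at ht
      | bob p t₀ t₁ => simp [owner] at ht
    · have hb0 : ∀ b x, 0 ≤ bitProb b (t.bias x y) := fun b x =>
        bitProb_nonneg b (t.bias_nonneg x y) (t.bias_le_one x y)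
      have hb1 : ∀ b x, |bitProb b (t.bias x y)| ≤ 1 := fun b x => abs_le_one_of_mem (hb0 b x)
        (bitProb_le_one b (t.bias_nonneg x y) (t.bias_le_one x y))
      have hwb : ∀ b, Summable fun x => w x * bitProb b (t.bias x y) := fun b =>
        summable_mul_of_bounded hw hw0 1 (hb1 b)
      have hwb0 : ∀ b x, 0 ≤ w x * bitProb b (t.bias x y) := fun b x =>
        mul_nonneg (hw0 x) (hb0 b x)
      have hsum : ∑' x, w x = ∑' x, w x * bitProb true (t.bias x y) +
          ∑' x, w x * bitProb false (t.bias x y) := by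
        rw [← (hwb true).tsum_add (hwb false)]
        exact tsum_congr fun x => by rw [← mul_add, bitProb_add, mul_one]
      have hg : ∀ b, Summable fun x => w x * bitProb b (t.bias x y) * (t.nodeAt [b]).aliceGap
          (fun h => t.posteriorBias w y (b :: h)) x y := fun b =>
        summable_aliceGap _ _ _ (hwb b) (hwb0 b)
      -- Below the bit `b`, the posterior is by definition that of the subtree for the updated
      -- weights, so the induction hypothesis applies as it stands.
      have hih : ∀ b, ∑' x, w x * bitProb b (t.bias x y) * (t.nodeAt [b]).aliceGap
          (fun h => t.posteriorBias w y (b :: h)) x y ≤ _ := fun b =>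
        ih (depth_nodeAt_le h b) (hwb b) (hwb0 b)
      have hinfo := bitInfo_nonneg hw hw0 (fun x => t.bias_nonneg x y) fun x => t.bias_le_one x y
      have hpin := tsum_abs_le_bitInfo hw hw0 (fun x => t.bias_nonneg x y)
        (fun x => t.bias_le_one x y) hlam
      have hroot : Summable fun x => w x * |t.bias x y - t.posteriorBias w y []| :=
        summable_mul_of_bounded hw hw0 (1 + |t.posteriorBias w y []|) fun x => by
          rw [abs_abs]
          exact (abs_sub _ _).trans (by
            linarith [abs_le_one_of_mem (t.bias_nonneg x y) (t.bias_le_one x y)])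
      -- The root is charged for its gap whoever owns it. At Bob's nodes this only adds a
      -- nonnegative term, and the information bound needs no distinction of owners.
      have hle : ∑' x, w x * t.aliceGap (t.posteriorBias w y) x y ≤
          (lam * ∑' x, w x + 2 / lam * bitInfo w fun x => t.bias x y) +
          (∑' x, w x * bitProb true (t.bias x y) * (t.nodeAt [true]).aliceGap
            (fun h => t.posteriorBias w y (true :: h)) x y +
          ∑' x, w x * bitProb false (t.bias x y) * (t.nodeAt [false]).aliceGap
            (fun h => t.posteriorBias w y (false :: h)) x y) := by
        refine le_trans (b := ∑' x, w x * |t.bias x y - t.posteriorBias w y []| + _) ?_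
          (add_le_add_left hpin _)
        rw [← (hg true).tsum_add (hg false), ← hroot.tsum_add ((hg true).add (hg false))]
        refine (t.summable_aliceGap _ y hw hw0).tsum_le_tsum (fun x => ?_)
          (hroot.add ((hg true).add (hg false)))
        rw [mul_assoc, mul_assoc, ← mul_add, ← mul_add]
        refine mul_le_mul_of_nonneg_left ?_ (hw0 x)
        generalize t.posteriorBias w y = B
        cases t with
        | leaf => simp [owner] at ht
        | alice p t₀ t₁ => simp [aliceGap, bias, bitProb, nodeAt]
        | bob p t₀ t₁ => simp [aliceGap, bias, bitProb, nodeAt]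
      have h1 := hih true
      have h0 := hih false
      rw [bitsInfo_succ h ht hw hw0]
      push_cast
      calc _ ≤ _ := hle
        _ ≤ _ := add_le_add_right (add_le_add h1 h0) _
        _ = _ := by
          rw [hsum]
          ring

end Tree

end TreeInfo

/-! ### Entropies of the bits of a protocol tree -/

/-- Entropy in homogeneous form: weights of total mass `S` need no normalisation, and both sides
vanish for `S = 0`. Dividing by log 2 passes from natural logarithms to bits. -/
theorem mul_entropy_div {n : ℕ} {v : List Bool → ℝ} (hv : ∀ l, 0 ≤ v l)
    (hn : ∀ l, n < l.length → v l = 0) {S : ℝ} (hS : ∑ l ∈ bitStrings n, v l = S) :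
    S * entropy (fun l => v l / S) =
      (∑ l ∈ bitStrings n, negMulLog (v l) - negMulLog S) / Real.log 2 := by
  have hS0 : 0 ≤ S := hS ▸ Finset.sum_nonneg fun l _ => hv l
  rcases hS0.eq_or_lt with h0 | hpos
  · have : ∀ l ∈ bitStrings n, v l = 0 :=
      (Finset.sum_eq_zero_iff_of_nonneg fun l _ => hv l).1 (hS.trans h0.symm)
    rw [← h0, Finset.sum_congr rfl fun l hl => by rw [this l hl, Real.negMulLog_zero]]
    simp
  · rw [entropy, tsum_eq_sum_bitStrings (n := n) fun l hl => by simp [hn l hl], Finset.mul_sum]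
    have key : ∀ l, S * (v l / S * Real.logb 2 (1 / (v l / S))) =
        (negMulLog (v l) + v l * Real.log S) / Real.log 2 := by
      intro l
      rcases (hv l).eq_or_lt with h | h
      · simp [← h]
      · rw [Real.logb, one_div_div, Real.log_div hpos.ne' h.ne', negMulLog]
        field_simp
        ring
    simp only [key]
    rw [← Finset.sum_div, Finset.sum_add_distrib, ← Finset.sum_mul, hS, negMulLog]
    ring

/-- The crude bound by the number of strings is enough: it only provides summability over inputs and
integrability over public coins. -/
theorem entropy_sum_bounds {n : ℕ} {v : List Bool → ℝ} (hv : ∀ l, 0 ≤ v l) {S : ℝ}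
    (hS : ∑ l ∈ bitStrings n, v l = S) :
    0 ≤ ∑ l ∈ bitStrings n, negMulLog (v l) - negMulLog S ∧
      ∑ l ∈ bitStrings n, negMulLog (v l) - negMulLog S ≤ (bitStrings n).card * S := by
  have hS0 : 0 ≤ S := hS ▸ Finset.sum_nonneg fun l _ => hv l
  rcases hS0.eq_or_lt with h0 | hpos
  · have : ∀ l ∈ bitStrings n, v l = 0 :=
      (Finset.sum_eq_zero_iff_of_nonneg fun l _ => hv l).1 (hS.trans h0.symm)
    rw [← h0, Finset.sum_congr rfl fun l hl => by rw [this l hl, Real.negMulLog_zero]]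
    simp
  · have hd : ∑ l ∈ bitStrings n, negMulLog (v l) - negMulLog S =
        S * ∑ l ∈ bitStrings n, negMulLog (v l / S) := by
      have : ∀ l, negMulLog (v l) = v l / S * negMulLog S + S * negMulLog (v l / S) := fun l => by
        rw [← Real.negMulLog_mul, mul_div_cancel₀ _ hpos.ne']
      rw [Finset.sum_congr rfl fun l _ => this l, Finset.sum_add_distrib, ← Finset.sum_mul,
        ← Finset.sum_div, hS, div_self hpos.ne', Finset.mul_sum]
      ring
    have h01 : ∀ l ∈ bitStrings n, 0 ≤ v l / S ∧ v l / S ≤ 1 := fun l hl =>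
      ⟨div_nonneg (hv l) hS0, div_le_one_of_le₀
        (hS ▸ Finset.single_le_sum (f := v) (fun l _ => hv l) hl) hS0⟩
    rw [hd]
    refine ⟨mul_nonneg hS0 (Finset.sum_nonneg fun l hl =>
      Real.negMulLog_nonneg (h01 l hl).1 (h01 l hl).2), ?_⟩
    rw [mul_comm]
    refine mul_le_mul_of_nonneg_right ?_ hS0
    calc _ ≤ ∑ _l ∈ bitStrings n, (1 : ℝ) := Finset.sum_le_sum fun l hl =>
          (Real.negMulLog_le_one_sub_self (h01 l hl).1).trans (by linarith [(h01 l hl).1])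
      _ = _ := by simp

-- Conditional mutual information as a sum over Bob's inputs

section JointLaw

variable {X : Type u} {Y : Type v}

/-- The joint law of the bits and the inputs. -/
def jointLaw (t : Tree X Y) (μ : PMF (X × Y)) : PMF (List Bool × X × Y) :=
  μ.bind fun z => (t.law z.1 z.2).map fun m => (m, z.1, z.2)

/-- The weights of Alice's inputs together with the input `y` of Bob. -/
def weight (μ : PMF (X × Y)) (y : Y) (x : X) : ℝ := (μ (x, y)).toReal

theorem weight_nonneg (μ : PMF (X × Y)) (y : Y) (x : X) : 0 ≤ weight μ y x := ENNReal.toReal_nonneg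

theorem summable_toReal_pmf {α : Type*} (μ : PMF α) : Summable fun z => (μ z).toReal :=
  ENNReal.summable_toReal μ.tsum_coe_ne_top

theorem summable_weight_swap (μ : PMF (X × Y)) :
    Summable fun q : Y × X => weight μ q.1 q.2 :=
  ((Equiv.prodComm Y X).summable_iff (f := fun z : X × Y => (μ z).toReal)).2 (summable_toReal_pmf μ)

theorem summable_weight (μ : PMF (X × Y)) (y : Y) : Summable (weight μ y) :=
  (summable_weight_swap μ).prod_factor y

theorem tsum_toReal_pmf {α : Type*} (μ : PMF α) : ∑' z, (μ z).toReal = 1 := by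
  rw [← ENNReal.tsum_toReal_eq fun z => μ.apply_ne_top z, μ.tsum_coe, ENNReal.toReal_one]

theorem tsum_prod_swap {f : X × Y → ℝ} (hf : Summable f) :
    ∑' z, f z = ∑' y, ∑' x, f (x, y) := by
  rw [← (Equiv.prodComm Y X).tsum_eq]
  exact ((Equiv.prodComm Y X).summable_iff.2 hf).tsum_prod

theorem hasSum_weight (μ : PMF (X × Y)) : HasSum (fun y => ∑' x, weight μ y x) 1 := by
  have h : ∑' y, ∑' x, weight μ y x = 1 :=
    (tsum_prod_swap (summable_toReal_pmf μ)).symm.trans (tsum_toReal_pmf μ)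
  exact h ▸ (summable_weight_swap μ).prod.hasSum

open Classical in
theorem map_pair_apply {α β : Type*} (p : PMF α) (c : β) (m : α) (c' : β) :
    (p.map fun m => (m, c)) (m, c') = if c' = c then p m else 0 := by
  rw [PMF.map_apply, tsum_eq_single m]
  · simp
  · intro m' hm'
    simp [hm'.symm]

theorem jointLaw_apply (t : Tree X Y) (μ : PMF (X × Y)) (m : List Bool) (z : X × Y) :
    jointLaw t μ (m, z) = μ z * t.law z.1 z.2 m := by
  classical
  rw [jointLaw, PMF.bind_apply, tsum_eq_single z]
  · rw [map_pair_apply, if_pos rfl]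
  · intro z' hz'
    rw [map_pair_apply, if_neg hz'.symm, mul_zero]

theorem jointLaw_map_snd (t : Tree X Y) (μ : PMF (X × Y)) : (jointLaw t μ).map Prod.snd = μ := by
  rw [jointLaw, PMF.map_bind]
  have h : ∀ (p : PMF (List Bool)) (z : X × Y), p.map (fun _ => z) = PMF.pure z := fun p z =>
    PMF.map_const p z
  simp only [PMF.map_comp, Function.comp_def, Prod.mk.eta, h, PMF.bind_pure]

theorem jointLaw_map_apply (t : Tree X Y) (μ : PMF (X × Y)) (m : List Bool) (y : Y) :
    ((jointLaw t μ).map fun q => (q.1, q.2.2)) (m, y) = ∑' x, μ (x, y) * t.law x y m := by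
  classical
  rw [jointLaw, PMF.map_bind]
  simp only [PMF.map_comp, Function.comp_def]
  rw [PMF.bind_apply, ENNReal.tsum_prod']
  refine tsum_congr fun x => ?_
  rw [tsum_eq_single y]
  · rw [map_pair_apply, if_pos rfl]
  · intro y' hy'
    rw [map_pair_apply, if_neg hy'.symm, mul_zero]

theorem jointLaw_map_map_apply (t : Tree X Y) (μ : PMF (X × Y)) (y : Y) :
    (((jointLaw t μ).map fun q => (q.1, q.2.2)).map Prod.snd) y = ∑' x, μ (x, y) := by
  classical
  rw [PMF.map_comp, show (Prod.snd ∘ fun q : List Bool × X × Y => (q.1, q.2.2)) =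
    Prod.snd ∘ Prod.snd from rfl, ← PMF.map_comp, jointLaw_map_snd, PMF.map_apply,
    ENNReal.tsum_prod']
  refine tsum_congr fun x => ?_
  rw [tsum_eq_single y]
  · simp
  · intro y' hy'
    simp [hy'.symm]

theorem toReal_tsum_mul_law (t : Tree X Y) (μ : PMF (X × Y)) (m : List Bool) (y : Y) :
    (∑' x, μ (x, y) * t.law x y m).toReal = t.marginal (weight μ y) y m := by
  rw [ENNReal.tsum_toReal_eq fun x => ENNReal.mul_ne_top (μ.apply_ne_top _)
    ((t.law x y).apply_ne_top _)]
  simp only [ENNReal.toReal_mul]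
  rfl

theorem toReal_tsum_weight (μ : PMF (X × Y)) (y : Y) :
    (∑' x, μ (x, y)).toReal = ∑' x, weight μ y x :=
  ENNReal.tsum_toReal_eq fun _ => μ.apply_ne_top _

theorem sum_marginal {t : Tree X Y} {n : ℕ} (h : t.depth ≤ n) {w : X → ℝ} (hw : Summable w)
    (hw0 : ∀ x, 0 ≤ w x) (y : Y) : ∑ l ∈ bitStrings n, t.marginal w y l = ∑' x, w x := by
  simp only [Tree.marginal]
  rw [← Summable.tsum_finsetSum fun l _ => summable_mul_of_bounded hw hw0 1 fun x =>
    abs_le_one_of_mem (t.prob_nonneg x y l) (t.prob_le_one x y l)]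
  simp only [← Finset.mul_sum, Tree.sum_prob h, mul_one]

theorem marginal_nonneg (t : Tree X Y) {w : X → ℝ} (hw0 : ∀ x, 0 ≤ w x) (y : Y)
    (l : List Bool) : 0 ≤ t.marginal w y l :=
  tsum_nonneg fun x => mul_nonneg (hw0 x) (t.prob_nonneg x y l)

theorem marginal_eq_zero {t : Tree X Y} {n : ℕ} (h : t.depth ≤ n) (w : X → ℝ) (y : Y)
    {l : List Bool} (hl : n < l.length) : t.marginal w y l = 0 := by
  simp [Tree.marginal, Tree.prob_eq_zero h _ _ hl]

/-- The contribution of `y` to the entropy of the bits given Bob's input. -/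
def marginalEntropy (n : ℕ) (t : Tree X Y) (μ : PMF (X × Y)) (y : Y) : ℝ :=
  ∑ l ∈ bitStrings n, negMulLog (t.marginal (weight μ y) y l) - negMulLog (∑' x, weight μ y x)

theorem marginalEntropy_bounds {t : Tree X Y} {n : ℕ} (h : t.depth ≤ n) (μ : PMF (X × Y)) (y : Y) :
    0 ≤ marginalEntropy n t μ y ∧
      marginalEntropy n t μ y ≤ (bitStrings n).card * ∑' x, weight μ y x :=
  entropy_sum_bounds (marginal_nonneg t (weight_nonneg μ y) y)
    (sum_marginal h (summable_weight μ y) (weight_nonneg μ y) y)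

theorem condEntropy_jointLaw_map {t : Tree X Y} {n : ℕ} (h : t.depth ≤ n) (μ : PMF (X × Y)) :
    condEntropy ((jointLaw t μ).map fun q => (q.1, q.2.2)) =
      (∑' y, marginalEntropy n t μ y) / Real.log 2 := by
  rw [condEntropy, ← tsum_div_const]
  refine tsum_congr fun y => ?_
  simp only [jointLaw_map_apply, jointLaw_map_map_apply, toReal_tsum_mul_law, toReal_tsum_weight]
  exact mul_entropy_div (marginal_nonneg t (weight_nonneg μ y) y)
    (fun l hl => marginal_eq_zero h _ y hl)
    (sum_marginal h (summable_weight μ y) (weight_nonneg μ y) y)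

theorem condEntropy_jointLaw {t : Tree X Y} {n : ℕ} (h : t.depth ≤ n) (μ : PMF (X × Y)) :
    condEntropy (jointLaw t μ) =
      (∑' z : X × Y, (μ z).toReal * t.bitsEntropy n z.1 z.2) / Real.log 2 := by
  rw [condEntropy, ← tsum_div_const, jointLaw_map_snd]
  refine tsum_congr fun z => ?_
  simp only [jointLaw_apply, ENNReal.toReal_mul]
  have hs : ∑ l ∈ bitStrings n, (μ z).toReal * (t.law z.1 z.2 l).toReal = (μ z).toReal := by
    rw [← Finset.mul_sum]
    exact (congrArg _ (Tree.sum_prob h z.1 z.2)).trans (mul_one _)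
  rw [mul_entropy_div (fun l => mul_nonneg ENNReal.toReal_nonneg ENNReal.toReal_nonneg)
    (fun l hl => mul_eq_zero_of_right _ (Tree.prob_eq_zero h z.1 z.2 hl)) hs]
  congr 1
  simp only [Real.negMulLog_mul, Finset.sum_add_distrib, ← Finset.sum_mul, ← Finset.mul_sum]
  have := Tree.sum_prob h z.1 z.2
  simp only [Tree.prob] at this
  rw [this, Tree.bitsEntropy]
  simp only [Tree.prob]
  ring

theorem summable_marginalEntropy {t : Tree X Y} {n : ℕ} (h : t.depth ≤ n) (μ : PMF (X × Y)) :
    Summable (marginalEntropy n t μ) :=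
  Summable.of_nonneg_of_le (fun y => (marginalEntropy_bounds h μ y).1)
    (fun y => (marginalEntropy_bounds h μ y).2) ((summable_weight_swap μ).prod.mul_left _)

theorem summable_mul_bitsEntropy (n : ℕ) (t : Tree X Y) (μ : PMF (X × Y)) :
    Summable fun z : X × Y => (μ z).toReal * t.bitsEntropy n z.1 z.2 :=
  summable_mul_of_bounded (summable_toReal_pmf μ) (fun _ => ENNReal.toReal_nonneg)
    (bitStrings n).card fun z => by
      rw [abs_of_nonneg (Tree.bitsEntropy_bounds _ _ _).1]
      exact (Tree.bitsEntropy_bounds _ _ _).2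

/-- Both conditional entropies split over `y`, and their difference at `y` is the unnormalised
information; log 2 changes bits to natural units. -/
theorem hasSum_bitsInfo {t : Tree X Y} {n : ℕ} (h : t.depth ≤ n) (μ : PMF (X × Y)) :
    HasSum (fun y => t.bitsInfo n (weight μ y) y) (Real.log 2 * condMutualInfo (jointLaw t μ)) := by
  have h1 := summable_mul_bitsEntropy n t μ
  have h2 := (((Equiv.prodComm Y X).summable_iff.2 h1).prod).hasSum
  have h3 := (summable_marginalEntropy h μ).hasSum.sub h2
  have hlog : Real.log 2 ≠ 0 := (Real.log_pos one_lt_two).ne'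
  rw [condMutualInfo, condEntropy_jointLaw_map h, condEntropy_jointLaw h, ← sub_div,
    mul_div_cancel₀ _ hlog, tsum_prod_swap h1]
  exact h3

/-- The expected gap between Alice's probabilities and Bob's beliefs, in terms of the conditional
mutual information. -/
theorem tsum_ofReal_aliceGap_le {t : Tree X Y} {n : ℕ} (h : t.depth ≤ n) (μ : PMF (X × Y))
    {lam : ℝ} (hlam : 0 < lam) :
    0 ≤ lam * n + 2 * Real.log 2 / lam * condMutualInfo (jointLaw t μ) ∧
    ∑' z : X × Y, μ z * ENNReal.ofReal
      (t.aliceGap (t.posteriorBias (weight μ z.2) z.2) z.1 z.2) ≤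
      ENNReal.ofReal (lam * n + 2 * Real.log 2 / lam * condMutualInfo (jointLaw t μ)) := by
  have hle := fun y => Tree.tsum_aliceGap_le h (summable_weight μ y) (weight_nonneg μ y) y hlam
  have h0 : ∀ x y, 0 ≤ weight μ y x *
      t.aliceGap (t.posteriorBias (weight μ y) y) x y := fun x y =>
    mul_nonneg (weight_nonneg μ y x) (t.aliceGap_nonneg _ x y)
  have hn : ∀ y, 0 ≤ lam * n * ∑' x, weight μ y x + 2 / lam * t.bitsInfo n (weight μ y) y :=
    fun y => (tsum_nonneg fun x => h0 x y).trans (hle y)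
  -- The bound for fixed `y` is linear in mass and information, so it sums over `y` to total mass
  -- one and to the conditional mutual information.
  have hsum : HasSum (fun y => lam * n * ∑' x, weight μ y x +
      2 / lam * t.bitsInfo n (weight μ y) y)
      (lam * n + 2 * Real.log 2 / lam * condMutualInfo (jointLaw t μ)) := by
    have e : lam * n + 2 * Real.log 2 / lam * condMutualInfo (jointLaw t μ) =
        lam * n * 1 + 2 / lam * (Real.log 2 * condMutualInfo (jointLaw t μ)) := by ring
    rw [e]
    exact ((hasSum_weight μ).mul_left (lam * n)).add ((hasSum_bitsInfo h μ).mul_left (2 / lam))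
  refine ⟨hsum.tsum_eq ▸ tsum_nonneg hn, ?_⟩
  calc _ = ∑' y, ∑' x, ENNReal.ofReal (weight μ y x *
        t.aliceGap (t.posteriorBias (weight μ y) y) x y) := by
        rw [ENNReal.tsum_prod', ENNReal.tsum_comm]
        refine tsum_congr fun y => tsum_congr fun x => ?_
        rw [ENNReal.ofReal_mul (weight_nonneg μ y x), weight,
          ENNReal.ofReal_toReal (μ.apply_ne_top _)]
    _ = ∑' y, ENNReal.ofReal (∑' x, weight μ y x *
        t.aliceGap (t.posteriorBias (weight μ y) y) x y) :=
        tsum_congr fun y => (ENNReal.ofReal_tsum_of_nonneg (fun x => h0 x y)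
          (t.summable_aliceGap _ y (summable_weight μ y) (weight_nonneg μ y))).symm
    _ ≤ ∑' y, ENNReal.ofReal (lam * n * ∑' x, weight μ y x +
        2 / lam * t.bitsInfo n (weight μ y) y) :=
        ENNReal.tsum_le_tsum fun y => ENNReal.ofReal_le_ofReal (hle y)
    _ = _ := by rw [← ENNReal.ofReal_tsum_of_nonneg hn hsum.summable, hsum.tsum_eq]

end JointLaw

/-! ### Exchanging the roles of the players -/

section Swap

variable {X : Type u} {Y : Type v}

namespace Tree

/-- The same tree with the roles of Alice and Bob exchanged. -/
def swap : Tree X Y → Tree Y X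
  | leaf => leaf
  | alice p t₀ t₁ => bob p t₀.swap t₁.swap
  | bob p t₀ t₁ => alice p t₀.swap t₁.swap

theorem depth_swap (t : Tree X Y) : t.swap.depth = t.depth := by
  induction t <;> simp_all [swap, depth]

theorem law_swap (t : Tree X Y) (x : X) (y : Y) : t.swap.law y x = t.law x y := by
  induction t <;> simp_all [swap, law]

theorem nodeAt_swap (t : Tree X Y) (h : List Bool) : t.swap.nodeAt h = (t.nodeAt h).swap := by
  induction h generalizing t with
  | nil => cases t <;> rfl
  | cons b h ih =>
    cases t <;> cases b <;> simp [swap, nodeAt, nodeAt_leaf, ih]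

theorem bias_swap (t : Tree X Y) (x : X) (y : Y) : t.swap.bias y x = t.bias x y := by
  cases t <;> rfl

theorem owner_swap (t : Tree X Y) (o : Option Player) : t.swap.owner = o ↔
    t.owner = o.map fun q => match q with
      | .alice => .bob
      | .bob => .alice := by
  cases t <;> rcases o with _ | _ | _ <;> simp [swap, owner]

/-- The belief gap is the sum of the gaps at the nodes of the two players. -/
theorem beliefGap_eq (t : Tree X Y) (A B : List Bool → ℝ) (x : X) (y : Y) :
    t.beliefGap A B x y = t.aliceGap B x y + t.swap.aliceGap A y x := by
  induction t generalizing A B with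
  | leaf => simp [beliefGap, aliceGap, swap]
  | alice p t₀ t₁ h₀ h₁ => simp only [beliefGap, aliceGap, swap, h₀, h₁]; ring
  | bob p t₀ t₁ h₀ h₁ => simp only [beliefGap, aliceGap, swap, h₀, h₁, abs_sub_comm (A [])]; ring

end Tree

theorem map_swap_apply (μ : PMF (X × Y)) (y : Y) (x : X) : (μ.map Prod.swap) (y, x) = μ (x, y) := by
  classical
  rw [PMF.map_apply, tsum_eq_single (x, y)]
  · simp
  · rintro ⟨x', y'⟩ h
    rw [if_neg]
    simp only [Prod.swap_prod_mk, Prod.mk.injEq]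
    rintro ⟨rfl, rfl⟩
    exact h rfl

/-- This turns the second term of the information cost into the first term for the exchanged tree,
so only Bob's beliefs ever need an analysis. -/
theorem jointLaw_swap (t : Tree X Y) (μ : PMF (X × Y)) :
    (jointLaw t μ).map (fun q => (q.1, q.2.2, q.2.1)) = jointLaw t.swap (μ.map Prod.swap) := by
  rw [jointLaw, jointLaw, PMF.map_bind, PMF.bind_map]
  simp only [PMF.map_comp, Function.comp_def, Prod.fst_swap, Prod.snd_swap, Tree.law_swap]

theorem MeasurableTree.swap {Ω : Type*} [MeasurableSpace Ω] {t : Ω → Tree X Y}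
    (ht : MeasurableTree t) : MeasurableTree fun ω => (t ω).swap where
  owner h o := by
    simp only [Tree.nodeAt_swap, Tree.owner_swap]
    exact ht.owner h _
  bias h y x := by
    simp only [Tree.nodeAt_swap, Tree.bias_swap]
    exact ht.bias h x y

end Swap

/-! ### Sums with countable support -/

section CountableSums

variable {Ω : Type*} [MeasurableSpace Ω] {β : Type*} {S : Set β}

theorem tsum_eq_tsum_subtype {M : Type*} [AddCommMonoid M] [TopologicalSpace M] {f : β → M}
    (h : ∀ b ∉ S, f b = 0) : ∑' b, f b = ∑' b : S, f b :=
  (tsum_subtype_eq_of_support_subset fun b hb => by_contra fun hS => hb (h b hS)).symm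

theorem measurable_ennreal_tsum {g : β → Ω → ENNReal} (hS : S.Countable)
    (hg : ∀ b, Measurable (g b)) (h0 : ∀ b ∉ S, ∀ ω, g b ω = 0) :
    Measurable fun ω => ∑' b, g b ω := by
  have := hS.to_subtype
  simp only [fun ω => tsum_eq_tsum_subtype (f := fun b => g b ω) fun b hb => h0 b hb ω]
  exact Measurable.tsum fun b => hg b

/-- The input sets may be uncountable, but `μ` has countable support. Nonnegativity allows the sum
to be taken in `ENNReal`. -/
theorem measurable_real_tsum {g : β → Ω → ℝ} (hS : S.Countable) (hg : ∀ b, Measurable (g b))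
    (hn : ∀ b ω, 0 ≤ g b ω) (h0 : ∀ b ∉ S, ∀ ω, g b ω = 0) : Measurable fun ω => ∑' b, g b ω := by
  have : (fun ω => ∑' b, g b ω) = fun ω => (∑' b, ENNReal.ofReal (g b ω)).toReal := by
    funext ω
    rw [ENNReal.tsum_toReal_eq fun _ => ENNReal.ofReal_ne_top]
    exact tsum_congr fun b => (ENNReal.toReal_ofReal (hn b ω)).symm
  rw [this]
  exact (measurable_ennreal_tsum hS (fun b => (hg b).ennreal_ofReal)
    fun b hb ω => by rw [h0 b hb, ENNReal.ofReal_zero]).ennreal_toReal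

theorem tsum_lintegral {ν : Measure Ω} {g : β → Ω → ENNReal} (hS : S.Countable)
    (hg : ∀ b, Measurable (g b)) (h0 : ∀ b ∉ S, ∀ ω, g b ω = 0) :
    ∑' b, ∫⁻ ω, g b ω ∂ν = ∫⁻ ω, ∑' b, g b ω ∂ν := by
  have := hS.to_subtype
  simp only [fun ω => tsum_eq_tsum_subtype (f := fun b => g b ω) fun b hb => h0 b hb ω]
  rw [lintegral_tsum fun b : S => (hg b).aemeasurable]
  exact tsum_eq_tsum_subtype fun b hb => by simp [h0 b hb]

end CountableSums

/-! ### Measurability of beliefs and information -/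

section Families

variable {X : Type u} {Y : Type v} {Ω : Type*} [MeasurableSpace Ω] {t : Ω → Tree X Y}

theorem Tree.eq_leaf {t : Tree X Y} (h : t.owner = none) : t = leaf := by
  cases t <;> simp_all [owner]

theorem measurable_bitProb {f : Ω → ℝ} (hf : Measurable f) (b : Bool) :
    Measurable fun ω => bitProb b (f ω) := by
  cases b
  · simpa [bitProb] using hf.const_sub 1
  · simpa [bitProb] using hf

theorem MeasurableTree.prob (ht : MeasurableTree t) (x : X) (y : Y) (l : List Bool) :
    Measurable fun ω => (t ω).prob x y l := by
  classical
  induction l generalizing t with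
  | nil =>
    have : (fun ω => (t ω).prob x y []) = fun ω => if (t ω).owner = none then 1 else 0 := by
      funext ω
      split_ifs with h
      · rw [Tree.eq_leaf h, Tree.prob_leaf, if_pos rfl]
      · exact Tree.prob_nil h x y
    rw [this]
    exact Measurable.ite (ht.owner_root none) measurable_const measurable_const
  | cons b l ih =>
    have : (fun ω => (t ω).prob x y (b :: l)) = fun ω => if (t ω).owner = none then 0 else
        bitProb b ((t ω).bias x y) * ((t ω).nodeAt [b]).prob x y l := by
      funext ω
      split_ifs with h
      · rw [Tree.eq_leaf h, Tree.prob_leaf, if_neg (List.cons_ne_nil b l)]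
      · exact Tree.prob_cons h x y b l
    rw [this]
    exact Measurable.ite (ht.owner_root none) measurable_const
      ((measurable_bitProb (ht.bias_root x y) b).mul (ih (ht.nodeAt b)))

/-- The weights must be allowed to depend on `ω`: after one bit they contain the bias at the node
just passed. -/
theorem MeasurableTree.posteriorBias (ht : MeasurableTree t) {S : Set X} (hS : S.Countable)
    {w : Ω → X → ℝ} (hw : ∀ x, Measurable fun ω => w ω x) (hw0 : ∀ ω x, 0 ≤ w ω x)
    (hwS : ∀ x ∉ S, ∀ ω, w ω x = 0) (y : Y) (h : List Bool) :
    Measurable fun ω => (t ω).posteriorBias (w ω) y h := by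
  induction h generalizing t w with
  | nil =>
    refine Measurable.div (measurable_real_tsum hS (fun x => (hw x).mul (ht.bias_root x y))
      (fun x ω => mul_nonneg (hw0 ω x) ((t ω).bias_nonneg x y)) fun x hx ω => ?_)
      (measurable_real_tsum hS hw (fun x ω => hw0 ω x) hwS)
    simp [hwS x hx]
  | cons b h ih =>
    exact ih (ht.nodeAt b) (fun x => (hw x).mul (measurable_bitProb (ht.bias_root x y) b))
      (fun ω x => mul_nonneg (hw0 ω x)
        (bitProb_nonneg b ((t ω).bias_nonneg x y) ((t ω).bias_le_one x y)))
      fun x hx ω => by simp [hwS x hx]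

theorem weight_eq_zero (μ : PMF (X × Y)) {y : Y} {x : X} (h : (x, y) ∉ μ.support) :
    weight μ y x = 0 := by
  rw [weight, (μ.apply_eq_zero_iff _).2 h, ENNReal.toReal_zero]

theorem MeasurableTree.belief (ht : MeasurableTree t) (μ : PMF (X × Y)) (y : Y) (h : List Bool) :
    Measurable fun ω => (t ω).posteriorBias (weight μ y) y h :=
  ht.posteriorBias (w := fun _ => weight μ y) (μ.support_countable.image Prod.fst)
    (fun _ => measurable_const) (fun _ => weight_nonneg μ y)
    (fun x hx _ => weight_eq_zero μ fun h => hx ⟨(x, y), h, rfl⟩) y h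

theorem MeasurableTree.marginal (ht : MeasurableTree t) (μ : PMF (X × Y)) (y : Y) (l : List Bool) :
    Measurable fun ω => (t ω).marginal (weight μ y) y l :=
  measurable_real_tsum (μ.support_countable.image Prod.fst) (fun x => (ht.prob x y l).const_mul _)
    (fun x ω => mul_nonneg (weight_nonneg μ y x) ((t ω).prob_nonneg x y l))
    (fun x hx ω => by rw [weight_eq_zero μ fun h => hx ⟨(x, y), h, rfl⟩, zero_mul])

variable {n : ℕ}

theorem measurable_tsum_marginalEntropy (ht : MeasurableTree t) (hn : ∀ ω, (t ω).depth ≤ n)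
    (μ : PMF (X × Y)) : Measurable fun ω => ∑' y, marginalEntropy n (t ω) μ y := by
  refine measurable_real_tsum (μ.support_countable.image Prod.snd) (fun y => ?_)
    (fun y ω => (marginalEntropy_bounds (hn ω) μ y).1) fun y hy ω => ?_
  · exact (Finset.measurable_fun_sum _ fun l _ =>
      Real.continuous_negMulLog.measurable.comp (ht.marginal μ y l)).sub_const _
  · have : ∀ x, weight μ y x = 0 := fun x => weight_eq_zero μ fun h => hy ⟨(x, y), h, rfl⟩
    simp [marginalEntropy, Tree.marginal, this]

theorem measurable_tsum_bitsEntropy (ht : MeasurableTree t) (μ : PMF (X × Y)) :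
    Measurable fun ω => ∑' z : X × Y, (μ z).toReal * (t ω).bitsEntropy n z.1 z.2 := by
  refine measurable_real_tsum μ.support_countable (fun z => Measurable.const_mul ?_ _)
    (fun z ω => mul_nonneg ENNReal.toReal_nonneg (Tree.bitsEntropy_bounds _ _ _).1) fun z hz ω => ?_
  · exact Finset.measurable_fun_sum _ fun l _ =>
      Real.continuous_negMulLog.measurable.comp (ht.prob z.1 z.2 l)
  · rw [(μ.apply_eq_zero_iff _).2 hz, ENNReal.toReal_zero, zero_mul]

theorem integrable_condMutualInfo (ht : MeasurableTree t) (hn : ∀ ω, (t ω).depth ≤ n)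
    (μ : PMF (X × Y)) (ν : Measure Ω) [IsFiniteMeasure ν] :
    Integrable (fun ω => condMutualInfo (jointLaw (t ω) μ)) ν := by
  simp only [condMutualInfo, fun ω => condEntropy_jointLaw_map (hn ω) μ,
    fun ω => condEntropy_jointLaw (hn ω) μ]
  refine (Integrable.div_const ?_ _).sub (Integrable.div_const ?_ _)
  · refine .of_bound (measurable_tsum_marginalEntropy ht hn μ).aestronglyMeasurable
      ((bitStrings n).card * 1) (Filter.Eventually.of_forall fun ω => ?_)
    rw [Real.norm_of_nonneg (tsum_nonneg fun y => (marginalEntropy_bounds (hn ω) μ y).1)]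
    exact hasSum_le (fun y => (marginalEntropy_bounds (hn ω) μ y).2)
      (summable_marginalEntropy (hn ω) μ).hasSum ((hasSum_weight μ).mul_left _)
  · refine .of_bound (measurable_tsum_bitsEntropy ht μ).aestronglyMeasurable
      (1 * (bitStrings n).card) (Filter.Eventually.of_forall fun ω => ?_)
    rw [Real.norm_of_nonneg (tsum_nonneg fun z => mul_nonneg ENNReal.toReal_nonneg
      (Tree.bitsEntropy_bounds _ _ _).1)]
    rw [← tsum_toReal_pmf μ, ← tsum_mul_right]
    exact (summable_mul_bitsEntropy n (t ω) μ).tsum_le_tsum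
      (fun z => mul_le_mul_of_nonneg_left (Tree.bitsEntropy_bounds _ _ _).2 ENNReal.toReal_nonneg)
      ((summable_toReal_pmf μ).mul_right _)

theorem lintegral_ofReal_info (ht : MeasurableTree t) (hn : ∀ ω, (t ω).depth ≤ n)
    (μ : PMF (X × Y)) (ν : Measure Ω) [IsProbabilityMeasure ν] {lam : ℝ} (hlam : 0 < lam) :
    0 ≤ lam * n + 2 * Real.log 2 / lam * ∫ ω, condMutualInfo (jointLaw (t ω) μ) ∂ν ∧
    ∫⁻ ω, ENNReal.ofReal (lam * n + 2 * Real.log 2 / lam * condMutualInfo (jointLaw (t ω) μ)) ∂ν =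
      ENNReal.ofReal
        (lam * n + 2 * Real.log 2 / lam * ∫ ω, condMutualInfo (jointLaw (t ω) μ) ∂ν) := by
  have hi := (integrable_condMutualInfo ht hn μ ν).const_mul (2 * Real.log 2 / lam)
  have h0 := fun ω => (tsum_ofReal_aliceGap_le (hn ω) μ hlam).1
  have he : ∫ ω, (lam * n + 2 * Real.log 2 / lam * condMutualInfo (jointLaw (t ω) μ)) ∂ν =
      lam * n + 2 * Real.log 2 / lam * ∫ ω, condMutualInfo (jointLaw (t ω) μ) ∂ν := by
    rw [integral_add (integrable_const _) hi, integral_const_mul]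
    simp [integral_const_mul]
  rw [← he]
  exact ⟨integral_nonneg h0, (ofReal_integral_eq_lintegral_ofReal ((integrable_const _).add hi)
    (Filter.Eventually.of_forall h0)).symm⟩

end Families

/-! ### The expected number of mistakes -/

namespace Protocol

variable {X : Type u} {Y : Type v} {π : Protocol.{u, v, w} X Y} {n : ℕ}

/-- Alice's beliefs about the bits of Bob. -/
def aliceBelief (π : Protocol.{u, v, w} X Y) (μ : PMF (X × Y)) (r : π.Pub) (x : X) :
    List Bool → ℝ :=
  (π.tree r).swap.posteriorBias (weight (μ.map Prod.swap) x) x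

/-- Bob's beliefs about the bits of Alice. -/
def bobBelief (π : Protocol.{u, v, w} X Y) (μ : PMF (X × Y)) (r : π.Pub) (y : Y) :
    List Bool → ℝ :=
  (π.tree r).posteriorBias (weight μ y) y

theorem measurable_aliceBelief (μ : PMF (X × Y)) (x : X) (h : List Bool) :
    Measurable fun r => π.aliceBelief μ r x h :=
  π.measurableTree.swap.belief (μ.map Prod.swap) x h

theorem measurable_bobBelief (μ : PMF (X × Y)) (y : Y) (h : List Bool) :
    Measurable fun r => π.bobBelief μ r y h :=
  π.measurableTree.belief μ y h

/-- Each node contributes to the gap of one player only; Bob's nodes are Alice's nodes of the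
exchanged tree. This is why `lam * n` appears twice. -/
theorem tsum_ofReal_beliefGap_le (hn : ∀ r, (π.tree r).depth ≤ n) (μ : PMF (X × Y)) (r : π.Pub)
    {lam : ℝ} (hlam : 0 < lam) :
    ∑' z : X × Y, μ z * ENNReal.ofReal
      ((π.tree r).beliefGap (π.aliceBelief μ r z.1) (π.bobBelief μ r z.2) z.1 z.2) ≤
      ENNReal.ofReal (lam * n + 2 * Real.log 2 / lam * condMutualInfo (jointLaw (π.tree r) μ)) +
      ENNReal.ofReal (lam * n + 2 * Real.log 2 / lam *
        condMutualInfo (jointLaw (π.tree r).swap (μ.map Prod.swap))) := by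
  have hs : ((π.tree r).swap).depth ≤ n := (Tree.depth_swap _).trans_le (hn r)
  have h1 := (tsum_ofReal_aliceGap_le (hn r) μ hlam).2
  have h2 := (tsum_ofReal_aliceGap_le hs (μ.map Prod.swap) hlam).2
  rw [← (Equiv.prodComm X Y).tsum_eq] at h2
  refine le_trans (le_of_eq ?_) (add_le_add h1 h2)
  rw [← ENNReal.tsum_add]
  refine tsum_congr fun z => ?_
  rw [Tree.beliefGap_eq, ENNReal.ofReal_add (Tree.aliceGap_nonneg _ _ _ _)
    (Tree.aliceGap_nonneg _ _ _ _), mul_add]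
  congr 1
  exact congrArg (· * _) (map_swap_apply μ z.2 z.1).symm

theorem expected_numMistakes_le (hn : ∀ r, (π.tree r).depth ≤ n) [Nonempty X] [Nonempty Y]
    (μ : PMF (X × Y)) {lam : ℝ} (hlam : 0 < lam) :
    ∑' z : X × Y, μ z * ∫⁻ ω, (numMistakes n (π.tree ω.1) (π.aliceBelief μ ω.1 z.1)
      (π.bobBelief μ ω.1 z.2) z.1 z.2 (thresholds ω.2) : ENNReal) ∂π.thresholdLaw n ≤
      ENNReal.ofReal (2 * lam * n + 2 * Real.log 2 / lam * π.infoCost μ) := by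
  have hM : ∀ z : X × Y, Measurable fun ω : π.Pub × (Fin n → unitInterval) =>
      (numMistakes n (π.tree ω.1) (π.aliceBelief μ ω.1 z.1) (π.bobBelief μ ω.1 z.2) z.1 z.2
        (thresholds ω.2) : ENNReal) := fun z =>
    (Measurable.of_discrete (f := fun k : ℕ => (k : ENNReal))).comp
      (measurable_card_mistakes n measurable_ownTable
        (measurable_aliceGuess (A := π.aliceBelief μ) (measurable_aliceBelief μ) z.1)
        (measurable_bobGuess (B := π.bobBelief μ) (measurable_bobBelief μ) z.2))
  have hm := fun z => (hM z).lintegral_prod_right' (ν := (volume : Measure (Fin n → unitInterval)))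
  obtain ⟨h01, h1⟩ := lintegral_ofReal_info π.measurableTree hn μ π.coin hlam
  obtain ⟨h02, h2⟩ := lintegral_ofReal_info π.measurableTree.swap
    (fun r => (Tree.depth_swap _).trans_le (hn r)) (μ.map Prod.swap) π.coin hlam
  have hi := integrable_condMutualInfo π.measurableTree hn μ π.coin
  calc _ = ∑' z : X × Y, ∫⁻ r, μ z * ∫⁻ ρ : Fin n → unitInterval,
        (numMistakes n (π.tree r) (π.aliceBelief μ r z.1)
          (π.bobBelief μ r z.2) z.1 z.2 (thresholds ρ) : ENNReal) ∂volume ∂π.coin := by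
        refine tsum_congr fun z => ?_
        rw [lintegral_const_mul _ (hm z), thresholdLaw, lintegral_prod _ (hM z).aemeasurable]
    _ = ∫⁻ r, ∑' z : X × Y, μ z * ∫⁻ ρ : Fin n → unitInterval,
        (numMistakes n (π.tree r) (π.aliceBelief μ r z.1)
          (π.bobBelief μ r z.2) z.1 z.2 (thresholds ρ) : ENNReal) ∂volume ∂π.coin :=
        tsum_lintegral μ.support_countable (fun z => (hm z).const_mul _)
          fun z hz r => by rw [(μ.apply_eq_zero_iff _).2 hz, zero_mul]
    _ ≤ ∫⁻ r, (ENNReal.ofReal (lam * n + 2 * Real.log 2 / lam *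
          condMutualInfo (jointLaw (π.tree r) μ)) + ENNReal.ofReal (lam * n +
          2 * Real.log 2 / lam * condMutualInfo (jointLaw (π.tree r).swap (μ.map Prod.swap))))
          ∂π.coin :=
        lintegral_mono fun r => (ENNReal.tsum_le_tsum fun z => by
          gcongr
          exact lintegral_numMistakes_le n _ _ _ _ _).trans (tsum_ofReal_beliefGap_le hn μ r hlam)
    _ = _ := by
        rw [lintegral_add_left' ((hi.aestronglyMeasurable.aemeasurable.const_mul _).const_add _).ennreal_ofReal, h1, h2,
          ← ENNReal.ofReal_add h01 h02, infoCost]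
        simp only [lawMXY, ← jointLaw_swap]
        congr 1
        simp only [jointLaw]
        ring

theorem expected_numMistakes_le_sqrt (hn : ∀ r, (π.tree r).depth ≤ n) [Nonempty X] [Nonempty Y]
    (μ : PMF (X × Y)) (hn0 : n ≠ 0) :
    ∑' z : X × Y, μ z * ∫⁻ ω, (numMistakes n (π.tree ω.1) (π.aliceBelief μ ω.1 z.1)
      (π.bobBelief μ ω.1 z.2) z.1 z.2 (thresholds ω.2) : ENNReal) ∂π.thresholdLaw n ≤
      ENNReal.ofReal (4 * √(n * π.infoCost μ)) := by
  have h := fun lam hlam => expected_numMistakes_le hn μ (lam := lam) hlam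
  set I := π.infoCost μ
  have hn' : (0 : ℝ) < n := Nat.cast_pos.2 (Nat.pos_of_ne_zero hn0)
  have hl : 0 < Real.log 2 := Real.log_pos one_lt_two
  rcases le_or_gt I 0 with hI | hI
  -- Here the square root is zero, so the bound must vanish: let `lam` tend to zero, with `lam = e /
  -- (2n)` leaving at most `e`.
  · refine le_trans (ENNReal.le_of_forall_pos_le_add fun e he _ => ?_) zero_le
    rw [zero_add, ← ENNReal.ofReal_coe_nnreal]
    have he' : (0 : ℝ) < e := he
    refine (h (e / (2 * n)) (by positivity)).trans (ENNReal.ofReal_le_ofReal ?_)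
    have h1 : 2 * ((e : ℝ) / (2 * n)) * n = e := by field_simp
    have h2 : 2 * Real.log 2 / ((e : ℝ) / (2 * n)) * I ≤ 0 :=
      mul_nonpos_of_nonneg_of_nonpos (by positivity) hI
    linarith
  · have hs : 0 < √(n * I) := Real.sqrt_pos.2 (mul_pos hn' hI)
    -- This is `lam = √(I / n)`, which makes both terms multiples of √(nI) with factors 2 and 2 log
    -- 2, together below 4.
    refine (h (√(n * I) / n) (by positivity)).trans (ENNReal.ofReal_le_ofReal ?_)
    have h1 : 2 * (√(n * I) / n) * n = 2 * √(n * I) := by field_simp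
    have h2 : 2 * Real.log 2 / (√(n * I) / n) * I = 2 * Real.log 2 * √(n * I) := by
      have := Real.mul_self_sqrt (mul_pos hn' hI).le
      field_simp
      nlinarith
    rw [h1, h2]
    nlinarith [Real.log_two_lt_d9]

end Protocol

/-! ### The choice of the parameters -/

/-- 28 rounds halve the failure bound since (40/39)^28 ≥ 2, so 84 L = 3 · 28 L rounds gain the
factor (a/ε)³, which is at least 2a²/ε because a/ε ≥ 2 and ε < 1. -/
theorem pow_mul_le {a ε L : ℝ} {N : ℕ} (hε : 0 < ε) (hε1 : ε < 1) (h2 : 2 ≤ a / ε)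
    (hL : L = Real.logb 2 (a / ε)) (hN : 84 * L ≤ N) : a * (a * (39 / 40) ^ N) ≤ ε / 2 := by
  have hd : 0 < a / ε := two_pos.trans_le h2
  have ha : 0 < a := by have := mul_pos hd hε; rwa [div_mul_cancel₀ _ hε.ne'] at this
  have hl2 : 0 < Real.log 2 := Real.log_pos one_lt_two
  have h28 : Real.log 2 ≤ 28 * Real.log (40 / 39) := by
    rw [show (28 : ℝ) = (28 : ℕ) by norm_num, ← Real.log_pow]
    exact Real.log_le_log two_pos (by norm_num)
  have h3 : 2 * a ^ 2 / ε ≤ (a / ε) ^ 3 := by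
    have h4 : a ^ 2 / ε ≤ (a / ε) ^ 2 := by
      rw [div_pow]
      exact div_le_div_of_nonneg_left (by positivity) (by positivity) (by nlinarith)
    calc 2 * a ^ 2 / ε = 2 * (a ^ 2 / ε) := by ring
      _ ≤ (a / ε) * (a / ε) ^ 2 := by gcongr
      _ = _ := by ring
  have h5 : Real.log (2 * a ^ 2 / ε) ≤ Real.log ((40 / 39) ^ N) := by
    refine (Real.log_le_log (by positivity) h3).trans ?_
    have h6 : L * Real.log 2 = Real.log (a / ε) := by
      rw [hL, Real.logb, div_mul_cancel₀ _ hl2.ne']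
    have hL0 : 0 ≤ L := hL ▸ Real.logb_nonneg one_lt_two (by linarith)
    rw [Real.log_pow, Real.log_pow, ← h6]
    push_cast
    have h7 := mul_le_mul_of_nonneg_left h28 hL0
    have h8 := mul_le_mul_of_nonneg_right hN (Real.log_nonneg (x := 40 / 39) (by norm_num))
    linarith
  have h9 := (Real.log_le_log_iff (by positivity) (by positivity)).1 h5
  rw [div_le_iff₀ hε] at h9
  have h10 : ((40 : ℝ) / 39) ^ N * (39 / 40) ^ N = 1 := by rw [← mul_pow]; norm_num
  have h11 := mul_le_mul_of_nonneg_right h9 (by positivity : (0 : ℝ) ≤ (39 / 40) ^ N)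
  have h12 : (40 / 39 : ℝ) ^ N * ε * (39 / 40) ^ N = ε := by
    rw [mul_right_comm, h10, one_mul]
  rw [h12] at h11
  linarith

namespace Protocol

variable {X : Type u} {Y : Type v} {π : Protocol.{u, v, w} X Y} {n : ℕ}

theorem depth_le_of_comm (h : π.comm = n) (r : π.Pub) : (π.tree r).depth ≤ n := by
  have h1 : ((π.tree r).depth : ℕ∞) ≤ π.comm := le_iSup (fun r => ((π.tree r).depth : ℕ∞)) r
  rw [h] at h1
  exact_mod_cast h1

/-- At most one bit is sent, and no probability is further than 1/2 from the constant belief 1/2. -/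
theorem beliefGap_half_le {t : Tree X Y} (h : t.depth ≤ 1) (x : X) (y : Y) :
    t.beliefGap (fun _ => 1 / 2) (fun _ => 1 / 2) x y ≤ 1 / 2 := by
  have hleaf : ∀ s : Tree X Y, s.depth = 0 → s = Tree.leaf := fun s hs => by
    cases s <;> simp_all [Tree.depth]
  cases t with
  | leaf => simp [Tree.beliefGap]
  | alice p t₀ t₁ =>
    simp only [Tree.depth] at h
    rw [hleaf t₀ (by omega), hleaf t₁ (by omega)]
    simp only [Tree.beliefGap, mul_zero, add_zero]
    exact abs_le.2 ⟨by linarith [(p x).2.1], by linarith [(p x).2.2]⟩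
  | bob p t₀ t₁ =>
    simp only [Tree.depth] at h
    rw [hleaf t₀ (by omega), hleaf t₁ (by omega)]
    simp only [Tree.beliefGap, mul_zero, add_zero]
    exact abs_le.2 ⟨by linarith [(p y).2.2], by linarith [(p y).2.1]⟩

/-- A protocol with one bit can be simulated without communication up to an error of one half. -/
theorem exists_simulation_of_depth_le_one [Nonempty X] [Nonempty Y]
    (hn : ∀ r, (π.tree r).depth ≤ 1) (μ : PMF (X × Y)) :
    ∃ τ : Protocol.{u, v, w} X Y, τ.comm = (0 : ℕ) ∧ ∀ ε : ℝ, 1 / 2 ≤ ε → τ.Simulates π μ ε := by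
  obtain ⟨τ, hτ, hs⟩ := exists_simulation (π := π) (n := 1) (A := fun _ _ _ => 1 / 2)
    (B := fun _ _ _ => 1 / 2) (fun _ _ => measurable_const) (fun _ _ => measurable_const) hn μ 0 0
    (δ := 1 / 2) (by norm_num) (by
      have hz : ∀ z : X × Y, ∫⁻ ω, (numMistakes 1 (π.tree ω.1) (fun _ => 1 / 2) (fun _ => 1 / 2)
          z.1 z.2 (thresholds ω.2) : ENNReal) ∂π.thresholdLaw 1 ≤ ENNReal.ofReal (1 / 2) := by
        intro z
        refine (lintegral_prod_le _).trans ?_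
        calc _ ≤ ∫⁻ _r, ENNReal.ofReal (1 / 2) ∂π.coin := lintegral_mono fun r =>
              (lintegral_numMistakes_le 1 _ _ _ _ _).trans
                (ENNReal.ofReal_le_ofReal (beliefGap_half_le (hn r) _ _))
          _ = _ := by simp
      calc _ ≤ ∑' z, μ z * ENNReal.ofReal (1 / 2) :=
            ENNReal.tsum_le_tsum fun z => mul_le_mul_right (hz z) _
        _ = _ := by rw [ENNReal.tsum_mul_right, μ.tsum_coe, one_mul])
  exact ⟨τ, by simpa using hτ, fun ε hε => hs ε (Or.inl (by simpa using hε))⟩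

/-- Compression of a protocol, when the error is at most `n / 2`. -/
theorem exists_compression [Nonempty X] [Nonempty Y] (hn : π.comm = n) (hn0 : n ≠ 0)
    (μ : PMF (X × Y)) {ε : ℝ} (hε : 0 < ε) (hε1 : ε < 1) (h2 : 2 ≤ n / ε) :
    ∃ τ : Protocol.{u, v, w} X Y, τ.Simulates π μ ε ∧ ∃ N : ℕ, τ.comm = N ∧
      (N : ℝ) ≤ 1360 * (√(n * π.infoCost μ) * (Real.logb 2 (n / ε) / ε)) := by
  set S := √(n * π.infoCost μ)
  set L := Real.logb 2 (n / ε) with hL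
  have hS : 0 ≤ S := Real.sqrt_nonneg _
  have hL1 : 1 ≤ L := by
    rw [hL, Real.le_logb_iff_rpow_le one_lt_two (by linarith), Real.rpow_one]
    exact h2
  -- With expected number of mistakes at most 4S, more than `T` mistakes occur with probability at
  -- most 4S / (T + 1) ≤ ε / 2.
  set T := ⌊8 * S / ε⌋₊
  have hT : (T : ℝ) ≤ 8 * S / ε := Nat.floor_le (by positivity)
  have hT1 : 8 * S / ε < T + 1 := Nat.lt_floor_add_one _
  -- If `n ≤ T`, then `π` already meets the bound. Otherwise `T < n` replaces the number of phases
  -- by `n` in the failure bound.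
  rcases le_or_gt n T with hTn | hTn
  · refine ⟨π, simulates_self π μ hε.le, n, hn, ?_⟩
    calc (n : ℝ) ≤ T := Nat.cast_le.2 hTn
      _ ≤ 8 * S / ε := hT
      _ = 8 * (S * (1 / ε)) := by ring
      _ ≤ 1360 * (S * (L / ε)) := by gcongr; norm_num
  · obtain ⟨τ, hτ, hs⟩ := exists_simulation (measurable_aliceBelief μ) (measurable_bobBelief μ)
      (depth_le_of_comm hn) μ T ⌈84 * L⌉₊ (δ := 4 * S) (by positivity)
      (expected_numMistakes_le_sqrt (depth_le_of_comm hn) μ hn0)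
    refine ⟨τ, hs ε (Or.inl ?_), _, hτ, ?_⟩
    · have h3 := pow_mul_le hε hε1 h2 hL (Nat.le_ceil (84 * L))
      have h4 : (T : ℝ) * (n * (39 / 40) ^ ⌈84 * L⌉₊) ≤ n * (n * (39 / 40) ^ ⌈84 * L⌉₊) := by
        gcongr
      have h5 : 4 * S / (T + 1) ≤ ε / 2 := by
        rw [div_le_iff₀ (by positivity)]
        rw [div_lt_iff₀ hε] at hT1
        linarith
      linarith
    -- Rounding up costs at most `L` because `L ≥ 1`. The constant is 2 · 8 · 85 = 1360: two bits
    -- per round, 8S/ε phases, 85 L rounds each.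
    · have h6 : (⌈84 * L⌉₊ : ℝ) ≤ 85 * L :=
        (Nat.ceil_lt_add_one (by positivity)).le.trans (by linarith)
      push_cast
      calc (2 : ℝ) * (T * ⌈84 * L⌉₊) ≤ 2 * (8 * S / ε * (85 * L)) := by gcongr
        _ = _ := by ring

end Protocol

end CommCompression

end

-- The theorem, with the degenerate parameters

theorem mainTheorem1 :
    ∃ K : ℝ, 0 < K ∧
      ∀ (X : Type u) (Y : Type v) (μ : PMF (X × Y))
        (π : CommCompression.Protocol.{u, v, w} X Y) (C : ℕ) (I : ℝ),
        π.comm = C → π.infoCost μ = I →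
        ∀ ε : ℝ, 0 < ε →
          ∃ τ : CommCompression.Protocol.{u, v, w} X Y,
            τ.Simulates π μ ε ∧
            ∃ N : ℕ, τ.comm = N ∧
              (N : ℝ) ≤ K * (√(C * I) * (max 0 (Real.logb 2 (C / ε)) / ε)) := by
  refine ⟨1360, by norm_num, fun X Y μ π C I hC hI ε hε => ?_⟩
  subst hI
  obtain ⟨z, -⟩ := μ.support_nonempty
  have : Nonempty X := ⟨z.1⟩
  have : Nonempty Y := ⟨z.2⟩
  have hpos : 0 ≤ 1360 * (√(C * π.infoCost μ) * (max 0 (Real.logb 2 (C / ε)) / ε)) := by positivity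
  rcases eq_or_ne C 0 with rfl | hC0
  · exact ⟨π, π.simulates_self μ hε.le, 0, hC, by exact_mod_cast hpos⟩
  have hn := CommCompression.Protocol.depth_le_of_comm hC
  have hC1 : (1 : ℝ) ≤ C := Nat.one_le_cast.2 (Nat.one_le_iff_ne_zero.2 hC0)
  -- An error of one permits any output, and the logarithm may be zero here, so the simulation is
  -- run with no phases and no bits.
  rcases le_or_gt 1 ε with hε1 | hε1
  · obtain ⟨τ, hτ, hs⟩ := CommCompression.Protocol.exists_simulation
      (CommCompression.Protocol.measurable_aliceBelief μ)
      (CommCompression.Protocol.measurable_bobBelief μ) hn μ 0 0 (by positivity)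
      (CommCompression.Protocol.expected_numMistakes_le_sqrt hn μ hC0)
    exact ⟨τ, hs ε (Or.inr hε1), 0, by simpa using hτ, by exact_mod_cast hpos⟩
  rcases le_or_gt 2 ((C : ℝ) / ε) with h2 | h2
  · obtain ⟨τ, hs, N, hN, hle⟩ :=
      CommCompression.Protocol.exists_compression hC hC0 μ hε hε1 h2
    exact ⟨τ, hs, N, hN, hle.trans (by gcongr; exact le_max_right _ _)⟩
  -- Here C = 1 and 1/2 < ε < 1. The logarithm tends to zero as ε tends to 1, so the bit is guessed
  -- without communication, with error at most 1/2.
  · rw [div_lt_iff₀ hε] at h2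
    have hC2 : C ≤ 1 := Nat.lt_succ_iff.1 (by exact_mod_cast (by linarith : (C : ℝ) < 2))
    obtain ⟨τ, hτ, hs⟩ := CommCompression.Protocol.exists_simulation_of_depth_le_one
      (fun r => (hn r).trans hC2) μ
    exact ⟨τ, hs ε (by linarith), 0, hτ, by exact_mod_cast hpos⟩
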